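/- **Setting.** Let $n\ge 2$, $r,s>0$. $|\cdot|$ is the Euclidean norm on $\mathbb R^n,\mathbb C^n$ and $|k|_1=\sum_j|k_j|$. For $D\subseteq\mathbb R^n$ let $D_r=\{z\in\mathbb C^n: |z-y|<r \text{ for some } y\in D\}$, and let $\mathbb T^n_s=\{x\in\mathbb C^n:|\mathrm{Im}\,x_j|<s\ \forall j\}/2\pi\mathbb Z^n$. For $f$ on $D_r\times\mathbb T^n_s$ with Fourier coefficients $f_k(y)$, $k\in\mathbb Z^n$, in the angles $x$, put $$\|f\|_{D,r,s}=\sup_{k\in\mathbb Z^n}\sup_{y\in D_r}|f_k(y)|e^{|k|_1s},\qquad |||f|||_{D,r,s}=\sup_{y\in D_r}\sum_{k\in\mathbb Z^n}|f_k(y)|e^{|k|_1s},$$ $P_\Lambda f=\sum_{k\in\Lambda}f_k(y)e^{ik\cdot x}$ for a sublattice $\Lambda\subseteq\mathbb Z^n$, and $\langle f\rangle=P_{\{0\}}f=f_0(y)$. Let $D\subset\mathbb R^n$ be a bounded domain and let $h$ be a real-analytic function on $D$ with a holomorphic extension to $D_r$. Let $\omega=\partial_yh$ and $M=\sup_D|\omega|$,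 and assume that for constants $L,\bar L>0$ $$|\omega(y)-\omega(y_0)|\le L|y-y_0|\quad (y,y_0\in D_r),\qquad |y-y_0|\,\bar L^{-1}\le|\omega(y)-\omega(y_0)|\quad(y,y_0\in D)$$ (so $\omega$ is a diffeomorphism of $D$ onto $\omega(D)$). Let $f:D_r\times\mathbb T^n_s\to\mathbb C$ be holomorphic with $\|f\|_{D,r,s}=1$, let $\varepsilon>0$ and $H(y,x)=h(y)+\varepsilon f(y,x)$. Let $K_1,K_2,\nu$ be real numbers with $$K_2\ge3K_1\ge6,\qquad \nu\ge n+2,\qquad\text{and put }\ \alpha:=\sqrt\varepsilon\,K_2^\nu .$$ Let $\mathcal G_K$ be the set of $k\in\mathbb Z^n\setminus\{0\}$ whose first non-zero component is positive, with $\gcd(k_1,\dots,k_n)=1$ and $|k|_1\le K$. Write $\pi_k^\perp\omega=\omega-\frac{\omega\cdot k}{|k|^2}k$ and set $$D^0=\{y\in D:\ |\omega(y)|<M,\ |\omega(y)\cdot k|>\alpha/2\ \ \forall k\in\mathcal G_{K_1}\},$$ for $k\in\mathcal G_{K_1}$, $$\Omega^{1,k}=\Big\{\omega\in\mathbb R^n:\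 |\omega\cdot k|<\alpha,\ |\pi_k^\perp\omega|<M,\ |\pi_k^\perp\omega\cdot\ell|>\tfrac{3\alpha K_2}{|k|}\ \ \forall \ell\in\mathcal G_{K_2}\setminus\mathbb Zk\Big\},\quad D^{1,k}=\{y\in D:\omega(y)\in\Omega^{1,k}\},$$ and $D^1=\{y\in D:\omega(y)\in\bigcup_{k\in\mathcal G_{K_1}}\Omega^{1,k}\}$. Put $$r_0=\frac{\alpha}{4LK_1},\quad r_k=\frac{\alpha}{L|k|},\quad \bar\vartheta=2^{14}n^{2n}\frac{L}{s^{2n+1}}\frac1{K_2^{2\nu-2n-3}},\quad \vartheta=2^{2n+10}n^{2n}\frac{L}{s^{2n+1}}\frac1{K_2^{2\nu-2n-3}} .$$ **Theorem.** Assume in addition that $$\varepsilon\le\frac{(Lr)^2}{K_2^{2\nu}},\qquad K_2^{2\nu-n-4}\ge 2^{13+n}n^n\,\frac{L\,e^{s/2}}{s^{n+1}} .$$ (i) There are a holomorphic symplectic (for $dy\wedge dx$), injective map $$\Psi_0:D^0_{r_0/2}\times\mathbb T^n_{s(1-1/K_1)^2}\to D^0_{r_0}\times\mathbb T^n_{s(1-1/K_1)}$$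 and holomorphic functions $g^{\rm o}$ on $D^0_{r_0/2}$ and $f^{\rm o}_{**}$ on $D^0_{r_0/2}\times\mathbb T^n_{s(1-1/K_1)^2}$ such that $$H\circ\Psi_0=h(y)+\varepsilon g^{\rm o}(y)+\varepsilon f^{\rm o}_{**}(y,x),\qquad\langle f^{\rm o}_{**}\rangle=0,$$ $$\sup_{D^0_{r_0/2}}|g^{\rm o}-\langle f\rangle|\le\bar\vartheta,\qquad |||f^{\rm o}_{**}|||_{D^0,\,r_0/2,\,s(1-1/K_1)/2}\le2\Big(\frac{2nK_1}{s}\Big)^ne^{-(K_1-3)s/2}.$$ (ii) $D^1=\bigcup_{k\in\mathcal G_{K_1}}D^{1,k}$, and for every $k\in\mathcal G_{K_1}$, with $s_*:=s(1-1/K_2)^2$, there are a holomorphic symplectic, injective map $$\Psi_k:D^{1,k}_{r_k/2}\times\mathbb T^n_{s_*}\to D^{1,k}_{r_k}\times\mathbb T^n_{s(1-1/K_2)}$$ and holomorphic functions $g^k,f^k_{**}$ on $D^{1,k}_{r_k/2}\times\mathbb T^n_{s_*}$ such that $$H\circ\Psi_k=h(y)+\varepsilon g^k(y,x)+\varepsilon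 f^k_{**}(y,x),\qquad g^k=P_{k\mathbb Z}\,g^k,\qquad P_{k\mathbb Z}f^k_{**}=0,$$ $$|||g^k-P_{k\mathbb Z}f|||_{D^{1,k},\,r_k/2,\,s_*}\le\vartheta,\qquad |||f^k_{**}|||_{D^{1,k},\,r_k/2,\,s(1-1/K_2)/2}<2\Big(\frac{2nK_2}{s}\Big)^ne^{-(K_2-3)s/2}.$$ The maps $\Psi_0,\Psi_k$ lift to the universal cover in the angles as maps commuting with the translations $x\mapsto x+2\pi m$, $m\in\mathbb Z^n$; and if $f$ is real on $D\times\mathbb T^n$, they take real points to real points. -/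

import Mathlib

open scoped BigOperators ENNReal

noncomputable section

namespace Averaging

/-! ### Real and complex phase space

`RVec n` and `CVec n` are `ℝⁿ` and `ℂⁿ` with the Euclidean norm.  The complex torus strip
`{x ∈ ℂⁿ : |Im x_j| < s} / 2πℤⁿ` is handled through its universal cover: functions on it are
`2πℤⁿ`-periodic functions on `strip n s`, and maps into it are maps commuting with the
translations by `2πℤⁿ`. -/

abbrev RVec (n : ℕ) := EuclideanSpace ℝ (Fin n)

abbrev CVec (n : ℕ) := EuclideanSpace ℂ (Fin n)

/-- The inclusion `ℝⁿ ⊂ ℂⁿ`. -/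
def toC {n : ℕ} (y : RVec n) : CVec n := WithLp.toLp 2 (fun j => ((y j : ℝ) : ℂ))

/-- An integer vector as a vector of `ℝⁿ`; `‖intVec k‖` is the Euclidean norm `|k|`. -/
def intVec {n : ℕ} (k : Fin n → ℤ) : RVec n := WithLp.toLp 2 (fun j => (k j : ℝ))

/-- The 1-norm `|k|₁ = ∑ |k_j|`. -/
def norm1 {n : ℕ} (k : Fin n → ℤ) : ℝ := ∑ j, |(k j : ℝ)|

/-- The complex neighbourhood `D_r` of a real set `D`. -/
def nbhd {n : ℕ} (D : Set (RVec n)) (r : ℝ) : Set (CVec n) :=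
  {z | ∃ y ∈ D, ‖z - toC y‖ < r}

/-- The (lifted) complex strip `𝕋ⁿ_s`. -/
def strip (n : ℕ) (s : ℝ) : Set (CVec n) := {x | ∀ j, |(x j).im| < s}

/-- The translation vector `2πm`, `m ∈ ℤⁿ`. -/
def period {n : ℕ} (m : Fin n → ℤ) : CVec n :=
  WithLp.toLp 2 (fun j => ((2 * Real.pi * (m j : ℝ) : ℝ) : ℂ))

/-- `f` is a holomorphic function on `U × 𝕋ⁿ_s`: holomorphic on `U × strip n s` and
`2π`-periodic in each angle. -/
structure HolomorphicOnTorus {n : ℕ} (f : CVec n → CVec n → ℂ) (U : Set (CVec n)) (s : ℝ) :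
    Prop where
  holomorphic : DifferentiableOn ℂ (fun z : CVec n × CVec n => f z.1 z.2) (U ×ˢ strip n s)
  periodic : ∀ y ∈ U, ∀ x ∈ strip n s, ∀ m : Fin n → ℤ, f y (x + period m) = f y x

/-! ### Fourier coefficients, projections and norms -/

/-- The Fourier coefficient
`f_k(y) = (2π)⁻ⁿ ∫_{[0,2π]ⁿ} f(y,θ) e^{-i k·θ} dθ`. -/
def fourierC {n : ℕ} (f : CVec n → CVec n → ℂ) (k : Fin n → ℤ) (y : CVec n) : ℂ :=
  ((2 * Real.pi : ℝ) : ℂ)⁻¹ ^ n *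
    ∫ θ in Set.Icc (0 : Fin n → ℝ) (fun _ => 2 * Real.pi),
      f y (WithLp.toLp 2 (fun j => ((θ j : ℝ) : ℂ))) *
        Complex.exp (-(Complex.I * ∑ j, (k j : ℂ) * ((θ j : ℝ) : ℂ)))

/-- The average `⟨f⟩` over the angles, as a function of `y`. -/
def mean {n : ℕ} (f : CVec n → CVec n → ℂ) (y : CVec n) : ℂ := fourierC f 0 y

/-- The projection on the Fourier modes in the sublattice `Λ`:
`(P_Λ f)(y,x) = ∑_{m ∈ Λ} f_m(y) e^{i m·x}`. -/
def proj {n : ℕ} (Λ : AddSubgroup (Fin n → ℤ)) (f : CVec n → CVec n → ℂ) (y x : CVec n) : ℂ :=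
  ∑' m : Λ, fourierC f (m : Fin n → ℤ) y *
    Complex.exp (Complex.I * ∑ j, ((m : Fin n → ℤ) j : ℂ) * x j)

/-- The `ℓ^∞`-Fourier norm
`‖f‖_{D,r,s} = sup_k sup_{y ∈ D_r} |f_k(y)| e^{|k|₁ s}`, with values in `[0,∞]`. -/
def supNorm {n : ℕ} (D : Set (RVec n)) (r s : ℝ) (f : CVec n → CVec n → ℂ) : ℝ≥0∞ :=
  ⨆ k : Fin n → ℤ, ⨆ y ∈ nbhd D r, ENNReal.ofReal (‖fourierC f k y‖ * Real.exp (norm1 k * s))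

/-- The `ℓ¹`-Fourier norm
`|||f|||_{D,r,s} = sup_{y ∈ D_r} ∑_k |f_k(y)| e^{|k|₁ s}`, with values in `[0,∞]`. -/
def sumNorm {n : ℕ} (D : Set (RVec n)) (r s : ℝ) (f : CVec n → CVec n → ℂ) : ℝ≥0∞ :=
  ⨆ y ∈ nbhd D r, ∑' k : Fin n → ℤ, ENNReal.ofReal (‖fourierC f k y‖ * Real.exp (norm1 k * s))

/-! ### The unperturbed Hamiltonian -/

/-- The frequency map `ω = ∂_y h` on the complex domain. -/
def freq {n : ℕ} (h : CVec n → ℂ) (y : CVec n) : CVec n :=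
  WithLp.toLp 2 (fun j => fderiv ℂ h y (EuclideanSpace.single j 1))

/-- The frequency map at real points.  For `h` real on the open real set `D`, the vector
`ω(y)`, `y ∈ D`, is real, so that taking real parts is only a change of type. -/
def realFreq {n : ℕ} (h : CVec n → ℂ) (y : RVec n) : RVec n :=
  WithLp.toLp 2 (fun j => (freq h (toC y) j).re)

/-- `M = sup_D |ω|`. -/
def freqSup {n : ℕ} (D : Set (RVec n)) (h : CVec n → ℂ) : ℝ :=
  sSup ((fun y => ‖realFreq h y‖) '' D)

/-- The standing assumption on `h`: it is real-analytic on the bounded domain `D ⊂ ℝⁿ`, `n ≥ 2`,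
with a holomorphic extension to `D_r`, and its frequency map is bi-Lipschitz (hence a
diffeomorphism of `D` onto `ω(D)`).  The upper Lipschitz constant `L` is the one of `ω` on the
complex domain `D_r`. -/
structure AssumptionA {n : ℕ} (D : Set (RVec n)) (r : ℝ) (h : CVec n → ℂ) (L Lbar : ℝ) :
    Prop where
  two_le : 2 ≤ n
  isOpen : IsOpen D
  isConnected : IsConnected D
  isBounded : Bornology.IsBounded D
  holomorphic : DifferentiableOn ℂ h (nbhd D r)
  real : ∀ y ∈ D, (h (toC y)).im = 0
  L_pos : 0 < L
  Lbar_pos : 0 < Lbar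
  lipschitz : ∀ y ∈ nbhd D r, ∀ y₀ ∈ nbhd D r, ‖freq h y - freq h y₀‖ ≤ L * ‖y - y₀‖
  expanding : ∀ y ∈ D, ∀ y₀ ∈ D, ‖y - y₀‖ * Lbar⁻¹ ≤ ‖realFreq h y - realFreq h y₀‖

/-! ### Geometry of resonances -/

/-- Generators `k` of one-dimensional maximal lattices with `|k|₁ ≤ K`: integer vectors with
first non-zero component positive and components with greatest common divisor `1`. -/
def generators (n : ℕ) (K : ℝ) : Set (Fin n → ℤ) :=
  {k | (∃ j, 0 < k j ∧ ∀ i < j, k i = 0) ∧ Finset.univ.gcd k = 1 ∧ norm1 k ≤ K}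

/-- The orthogonal projection on the subspace perpendicular to `k`. -/
def perp {n : ℕ} (k : Fin n → ℤ) (ω : RVec n) : RVec n :=
  ω - (inner ℝ ω (intVec k) / ‖intVec k‖ ^ 2) • intVec k

/-- The completely non-resonant zone in frequency space. -/
def Omega0 (n : ℕ) (M α K₁ : ℝ) : Set (RVec n) :=
  {ω | ‖ω‖ < M ∧ ∀ k ∈ generators n K₁, α / 2 < |inner ℝ ω (intVec k)|}

/-- The simply resonant zone in frequency space labelled by `k`. -/
def Omega1k {n : ℕ} (M α K₂ : ℝ) (k : Fin n → ℤ) : Set (RVec n) :=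
  {ω | |inner ℝ ω (intVec k)| < α ∧ ‖perp k ω‖ < M ∧
    ∀ l ∈ generators n K₂, l ∉ AddSubgroup.zmultiples k →
      3 * α * K₂ / ‖intVec k‖ < |inner ℝ (perp k ω) (intVec l)|}

/-- The simply resonant zone in frequency space. -/
def Omega1 (n : ℕ) (M α K₁ K₂ : ℝ) : Set (RVec n) :=
  ⋃ k ∈ generators n K₁, Omega1k M α K₂ k

/-- `D⁰`. -/
def D0 {n : ℕ} (D : Set (RVec n)) (h : CVec n → ℂ) (α K₁ : ℝ) : Set (RVec n) :=
  {y ∈ D | realFreq h y ∈ Omega0 n (freqSup D h) α K₁}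

/-- `D¹`. -/
def D1 {n : ℕ} (D : Set (RVec n)) (h : CVec n → ℂ) (α K₁ K₂ : ℝ) : Set (RVec n) :=
  {y ∈ D | realFreq h y ∈ Omega1 n (freqSup D h) α K₁ K₂}

/-- `D^{1,k}`. -/
def D1k {n : ℕ} (D : Set (RVec n)) (h : CVec n → ℂ) (α K₂ : ℝ) (k : Fin n → ℤ) :
    Set (RVec n) :=
  {y ∈ D | realFreq h y ∈ Omega1k (freqSup D h) α K₂ k}

/-! ### Symplectic changes of variables -/

/-- The standard symplectic form `dy ∧ dx` on `ℂⁿ × ℂⁿ`. -/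
def sympForm {n : ℕ} (a b : CVec n × CVec n) : ℂ :=
  ∑ j, (a.1 j * b.2 j - a.2 j * b.1 j)

/-- `Ψ` is (the lift of) a holomorphic symplectic change of variables
`U × 𝕋ⁿ_s → V × 𝕋ⁿ_t`.  Since `Ψ` commutes with the translations by `2πℤⁿ` in the angles,
injectivity of the lift is injectivity on `U × 𝕋ⁿ_s`. -/
structure SymplecticChange {n : ℕ} (Ψ : CVec n × CVec n → CVec n × CVec n)
    (U : Set (CVec n)) (s : ℝ) (V : Set (CVec n)) (t : ℝ) : Prop where
  mapsTo : Set.MapsTo Ψ (U ×ˢ strip n s) (V ×ˢ strip n t)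
  holomorphic : DifferentiableOn ℂ Ψ (U ×ˢ strip n s)
  equivariant : ∀ y ∈ U, ∀ x ∈ strip n s, ∀ m : Fin n → ℤ,
    Ψ (y, x + period m) = ((Ψ (y, x)).1, (Ψ (y, x)).2 + period m)
  injOn : Set.InjOn Ψ (U ×ˢ strip n s)
  symplectic : ∀ z ∈ U ×ˢ strip n s, ∀ a b : CVec n × CVec n,
    sympForm (fderiv ℂ Ψ z a) (fderiv ℂ Ψ z b) = sympForm a b

/-- All coordinates are real. -/
def IsRealVec {n : ℕ} (z : CVec n) : Prop := ∀ j, (z j).im = 0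

/-- `Ψ` takes real points of `U × 𝕋ⁿ` to real points. -/
def PreservesReal {n : ℕ} (Ψ : CVec n × CVec n → CVec n × CVec n) (U : Set (CVec n)) : Prop :=
  ∀ y ∈ U, IsRealVec y → ∀ x, IsRealVec x → IsRealVec (Ψ (y, x)).1 ∧ IsRealVec (Ψ (y, x)).2

/-- `f` is real on `D × 𝕋ⁿ`. -/
def RealOn {n : ℕ} (f : CVec n → CVec n → ℂ) (D : Set (RVec n)) : Prop :=
  ∀ y ∈ D, ∀ x : RVec n, (f (toC y) (toC x)).im = 0

/-- The Hamiltonian `H(y,x) = h(y) + ε f(y,x)`. -/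
def Ham {n : ℕ} (h : CVec n → ℂ) (ε : ℝ) (f : CVec n → CVec n → ℂ) (z : CVec n × CVec n) : ℂ :=
  h z.1 + (ε : ℂ) * f z.1 z.2

/-! ### Parameters -/

/-- `α = √ε K₂^ν`. -/
def alpha (ε K₂ ν : ℝ) : ℝ := Real.sqrt ε * K₂ ^ ν

/-- `r₀ = α / (4 L K₁)`. -/
def rad0 (ε K₁ K₂ ν L : ℝ) : ℝ := alpha ε K₂ ν / (4 * L * K₁)

/-- `r_k = α / (L |k|)`. -/
def radk {n : ℕ} (ε K₂ ν L : ℝ) (k : Fin n → ℤ) : ℝ := alpha ε K₂ ν / (L * ‖intVec k‖)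

/-- `2^14 n^{2n} L s^{-(2n+1)} K₂^{-(2ν-2n-3)}`. -/
def thetaBar (n : ℕ) (s L K₂ ν : ℝ) : ℝ :=
  2 ^ 14 * (n : ℝ) ^ (2 * n) * (L / s ^ (2 * n + 1)) * (1 / K₂ ^ (2 * ν - 2 * (n : ℝ) - 3))

/-- `2^{2n+10} n^{2n} L s^{-(2n+1)} K₂^{-(2ν-2n-3)}`. -/
def theta (n : ℕ) (s L K₂ ν : ℝ) : ℝ :=
  2 ^ (2 * n + 10) * (n : ℝ) ^ (2 * n) * (L / s ^ (2 * n + 1)) *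
    (1 / K₂ ^ (2 * ν - 2 * (n : ℝ) - 3))

/-- `2 (2nK/s)^n e^{-(K-3)s/2}`. -/
def remainderBound (n : ℕ) (s K : ℝ) : ℝ :=
  2 * (2 * (n : ℝ) * K / s) ^ n * Real.exp (-((K - 3) * s / 2))

end Averaging

end

/-! Both parts are instances of one quantitative normal form, `normal_form`, taken with Λ = 0 on D⁰
and with Λ = ℤk on D^{1,k}. On these sets the divisors ω·l with l ∉ Λ and |l|₁ ≤ K are bounded below
by a = α/4, respectively a = αK₂/|k|, and this persists on the complex neighbourhoods of radius r₀
and r_k because ω is L-Lipschitz there (`smallDivisor_D0`, `smallDivisor_D1k`).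

With such a bound the homological equation {h, χ} + W = 0, where W collects the modes outside Λ of
order at most K, is solved by division, and the time-one flow of the trigonometric polynomial χ
replaces W by terms of higher order (`averaging_step`). Functions are represented by their families
of Fourier coefficients in a weighted ℓ¹-norm; the bracket with χ is then a convolution, `lieFam`,
and Cauchy estimates bound its j-fold iterate by C q^j j! (`famBound_iterate`). So every Lie series
converges geometrically, and the same series give the flow, its holomorphy, its equivariance and
reality, its symplecticity and the new Hamiltonian (`hasSum_lieSeries`, `flow_symplectic`,
`exists_timeOneMap`).

The remainder becomes exponentially small for two reasons. Low non-resonant modes shrink by a factor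
of at least 8 in each of about Ks/4 steps, hence below e^{-Ks/2}. High modes are never removed, but
gain an exponential factor when the strip is halved (`FamBound.high`). The resonant part moves only
to second order in the non-resonant one, since the bracket of a resonant family with χ has no
resonant modes (`resPart_lieFam_resPart`). One long step precedes the many short ones
(`averaging_two_stage`), so that the number of steps does not enter this deviation.

Passing from the sup norm of f to the ℓ¹-norm on the strip of width s(1 - 1/K) costs the factor
(2nK/s)^n (`famBound_of_sup`). Since α² = ε K₂^{2ν}, the product of the divisor bound and the radius
is proportional to ε; hence ε cancels from the smallness condition and from the deviation, and what
remains is arithmetic of constants. -/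

noncomputable section

namespace Averaging

open Metric Set MeasureTheory Filter Topology

/-! ### Cauchy estimates; holomorphy of derivatives, series and parameter integrals. -/

section ComplexAnalysis

variable {E F P : Type*} [NormedAddCommGroup E] [NormedSpace ℂ E]
  [NormedAddCommGroup F] [NormedSpace ℂ F] [NormedAddCommGroup P] [NormedSpace ℂ P]

/-- Cauchy estimate for a directional derivative. -/
theorem norm_fderiv_apply_le {f : E → F} {U : Set E} (hU : IsOpen U)
    (hf : DifferentiableOn ℂ f U) {y : E} {δ C : ℝ} (hδ : 0 < δ)
    (hy : closedBall y δ ⊆ U) (hC : ∀ z ∈ closedBall y δ, ‖f z‖ ≤ C) (v : E) :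
    ‖fderiv ℂ f y v‖ ≤ C * ‖v‖ / δ := by
  rcases eq_or_ne v 0 with rfl | hv
  · simp
  have hv' : 0 < ‖v‖ := norm_pos_iff.2 hv
  have hR : 0 < δ / ‖v‖ := by positivity
  -- Reduction to one variable: on the complex line through y in direction v, the disc |t| ≤ δ/‖v‖
  -- stays in the ball.
  have hmem : ∀ t ∈ closedBall (0 : ℂ) (δ / ‖v‖), y + t • v ∈ closedBall y δ := by
    intro t ht
    rw [mem_closedBall_zero_iff] at ht
    rw [mem_closedBall, dist_eq_norm, add_sub_cancel_left, norm_smul]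
    calc ‖t‖ * ‖v‖ ≤ δ / ‖v‖ * ‖v‖ := by gcongr
      _ = δ := by field_simp
  have hline : ∀ t : ℂ, HasDerivAt (fun t : ℂ => y + t • v) v t := fun t => by
    simpa using ((hasDerivAt_id t).smul_const v).const_add y
  have hd : ∀ t ∈ closedBall (0 : ℂ) (δ / ‖v‖),
      HasDerivAt (fun t : ℂ => f (y + t • v)) (fderiv ℂ f (y + t • v) v) t := by
    intro t ht
    have h1 : DifferentiableAt ℂ f (y + t • v) :=
      hf.differentiableAt (hU.mem_nhds (hy (hmem t ht)))
    exact h1.hasFDerivAt.comp_hasDerivAt t (hline t)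
  have h0 := (hd 0 (mem_closedBall_self hR.le)).deriv
  simp only [zero_smul, add_zero] at h0
  rw [← h0]
  have := Complex.norm_deriv_le_of_forall_mem_sphere_norm_le (c := 0) (C := C)
    (f := fun t : ℂ => f (y + t • v)) hR
    (DifferentiableOn.diffContOnCl_ball (U := closedBall 0 (δ / ‖v‖))
      (fun t ht => (hd t ht).differentiableAt.differentiableWithinAt) subset_rfl)
    (fun z hz => hC _ (hmem z (sphere_subset_closedBall hz)))
  calc _ ≤ C / (δ / ‖v‖) := this
    _ = C * ‖v‖ / δ := by field_simp

theorem norm_fderiv_le {f : E → F} {U : Set E} (hU : IsOpen U)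
    (hf : DifferentiableOn ℂ f U) {y : E} {δ C : ℝ} (hδ : 0 < δ)
    (hy : closedBall y δ ⊆ U) (hC : ∀ z ∈ closedBall y δ, ‖f z‖ ≤ C) :
    ‖fderiv ℂ f y‖ ≤ C / δ := by
  have hC0 : 0 ≤ C := (norm_nonneg _).trans (hC y (mem_closedBall_self hδ.le))
  refine ContinuousLinearMap.opNorm_le_bound _ (by positivity) fun v => ?_
  calc _ ≤ C * ‖v‖ / δ := norm_fderiv_apply_le hU hf hδ hy hC v
    _ = _ := by ring

/-- A series of holomorphic functions dominated by a summable sequence is holomorphic, and may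
be differentiated term by term. -/
theorem hasFDerivAt_tsum_of_bounded [CompleteSpace F] {ι : Type*} {f : ι → E → F} {u : ι → ℝ}
    {U : Set E} (hU : IsOpen U) (hf : ∀ i, DifferentiableOn ℂ (f i) U) (hu : Summable u)
    (hfu : ∀ i, ∀ z ∈ U, ‖f i z‖ ≤ u i) {z : E} (hz : z ∈ U) :
    Summable (fun i => fderiv ℂ (f i) z) ∧
    HasFDerivAt (fun z => ∑' i, f i z) (∑' i, fderiv ℂ (f i) z) z := by
  obtain ⟨R, hR, hRU⟩ := Metric.isOpen_iff.1 hU z hz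
  have hsub : ∀ x ∈ ball z (R / 2), closedBall x (R / 4) ⊆ U := by
    intro x hx w hw
    apply hRU
    rw [mem_ball] at hx ⊢
    rw [mem_closedBall] at hw
    linarith [dist_triangle w x z]
  have hb : ∀ i, ∀ x ∈ ball z (R / 2), ‖fderiv ℂ (f i) x‖ ≤ u i / (R / 4) := fun i x hx =>
    norm_fderiv_le hU (hf i) (by positivity) (hsub x hx) fun w hw => hfu i w (hsub x hx hw)
  have hz' : z ∈ ball z (R / 2) := mem_ball_self (by positivity)
  have hu' : Summable fun i => u i / (R / 4) := hu.div_const _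
  refine ⟨Summable.of_norm_bounded hu' fun i => hb i z hz', ?_⟩
  refine hasFDerivAt_tsum_of_isPreconnected hu' isOpen_ball
    (convex_ball z (R / 2)).isPreconnected (fun i x hx => ?_) hb hz'
    (Summable.of_norm_bounded hu fun i => hfu i z hz) hz'
  have hxU : x ∈ U := hRU (ball_subset_ball (by linarith) hx)
  exact ((hf i).differentiableAt (hU.mem_nhds hxU)).hasFDerivAt

/-- Integrals over compact sets of holomorphic functions depending on parameters are
holomorphic. -/
theorem differentiableOn_integral [FiniteDimensional ℂ E] [FiniteDimensional ℂ P]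
    [FiniteDimensional ℂ F] [CompleteSpace F]
    {A : Type*} [TopologicalSpace A] [SecondCountableTopology A] [T2Space A]
    [MeasurableSpace A] [BorelSpace A]
    (μ : Measure A) [IsFiniteMeasureOnCompacts μ] {S : Set A} (hS : IsCompact S)
    {w : A → ℂ} (hw : Continuous w) {p : A → P} (hp : Continuous p)
    {U : Set (E × P)} (hU : IsOpen U) {g : E × P → F} (hg : DifferentiableOn ℂ g U)
    {V : Set E} (hV : IsOpen V) (hVU : ∀ y ∈ V, ∀ a ∈ S, (y, p a) ∈ U) :
    DifferentiableOn ℂ (fun y => ∫ a in S, w a • g (y, p a) ∂μ) V := by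
  intro y₀ hy₀
  have : ProperSpace E := FiniteDimensional.proper ℂ E
  have : ProperSpace P := FiniteDimensional.proper ℂ P
  let _ : MeasurableSpace (E × P) := borel _
  have : BorelSpace (E × P) := ⟨rfl⟩
  obtain ⟨R, hR, hRV⟩ := Metric.isOpen_iff.1 hV y₀ hy₀
  have hKV : closedBall y₀ (R / 2) ⊆ V := (closedBall_subset_ball (by linarith)).trans hRV
  have hsub : ∀ x ∈ ball y₀ (R / 4), closedBall x (R / 4) ⊆ closedBall y₀ (R / 2) := by
    intro x hx w hw
    rw [mem_ball] at hx
    rw [mem_closedBall] at hw ⊢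
    linarith [dist_triangle w x y₀]
  have hcomp : IsCompact (closedBall y₀ (R / 2) ×ˢ S) := (isCompact_closedBall _ _).prod hS
  have hcont : ContinuousOn (fun q : E × A => g (q.1, p q.2)) (V ×ˢ S) := by
    refine hg.continuousOn.comp (by fun_prop) ?_
    rintro ⟨y, a⟩ ⟨hy, ha⟩
    exact hVU y hy a ha
  obtain ⟨C, hC⟩ := hcomp.exists_bound_of_continuousOn
    (hcont.mono (prod_mono hKV subset_rfl))
  obtain ⟨W, hW⟩ := hS.exists_bound_of_continuousOn hw.continuousOn
  have hd : ∀ a ∈ S, ∀ x ∈ V, HasFDerivAt (fun y => g (y, p a))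
      ((fderiv ℂ g (x, p a)).comp (ContinuousLinearMap.inl ℂ E P)) x := by
    intro a ha x hx
    have h1 := (hg.differentiableAt (hU.mem_nhds (hVU x hx a ha))).hasFDerivAt
    exact h1.comp x (hasFDerivAt_prodMk_left x (p a))
  have hSm : MeasurableSet S := hS.measurableSet
  have hslice : ∀ x ∈ V, ContinuousOn (fun a => w a • g (x, p a)) S := by
    intro x hx
    refine hw.continuousOn.smul ?_
    exact hcont.comp (f := fun a => (x, a)) (by fun_prop) fun a ha => ⟨hx, ha⟩
  have hy₀V : y₀ ∈ V := hy₀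
  have : IsFiniteMeasure (μ.restrict S) := ⟨by simpa using hS.measure_lt_top⟩
  refine (hasFDerivAt_integral_of_dominated_of_fderiv_le (𝕜 := ℂ)
    (s := ball y₀ (R / 4)) (bound := fun _ => W * (C / (R / 4)))
    (F' := fun x a => w a • (fderiv ℂ g (x, p a)).comp (ContinuousLinearMap.inl ℂ E P))
    (ball_mem_nhds _ (by positivity)) ?_ ?_ ?_ ?_ (integrable_const _) ?_).differentiableAt
      |>.differentiableWithinAt
  · filter_upwards [hV.mem_nhds hy₀V] with x hx
    exact (hslice x hx).aestronglyMeasurable hSm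
  · exact (hslice y₀ hy₀V).integrableOn_compact hS
  · have h1 : Measurable fun a => fderiv ℂ g (y₀, p a) :=
      (measurable_fderiv ℂ g).comp (by fun_prop : Continuous fun a => (y₀, p a)).measurable
    have : ProperSpace (E × P →L[ℂ] F) := FiniteDimensional.proper ℂ _
    have h2 : AEStronglyMeasurable (fun a => fderiv ℂ g (y₀, p a)) (μ.restrict S) :=
      h1.aestronglyMeasurable
    refine hw.aestronglyMeasurable.smul ?_
    exact ((ContinuousLinearMap.compL ℂ E (E × P) F).flip
      (ContinuousLinearMap.inl ℂ E P)).continuous.comp_aestronglyMeasurable h2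
  · refine (ae_restrict_iff' hSm).2 (ae_of_all _ fun a ha x hx => ?_)
    have hxV : x ∈ V := hKV (hsub x hx (mem_closedBall_self (by positivity)))
    rw [norm_smul]
    have hW0 := hW a ha
    refine mul_le_mul hW0 ?_ (norm_nonneg _) ((norm_nonneg _).trans hW0)
    rw [← (hd a ha x hxV).fderiv]
    refine norm_fderiv_le hV (fun z hz => (hd a ha z hz).differentiableAt.differentiableWithinAt)
      (by positivity) ((hsub x hx).trans hKV) fun z hz => hC (z, a) ⟨hsub x hx hz, ha⟩
  · refine (ae_restrict_iff' hSm).2 (ae_of_all _ fun a ha x hx => ?_)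
    have hxV : x ∈ V := hKV (hsub x hx (mem_closedBall_self (by positivity)))
    exact (hd a ha x hxV).const_smul (w a)

/-- Directional derivatives of holomorphic functions of several variables are holomorphic. -/
theorem differentiableOn_fderiv_apply [FiniteDimensional ℂ E] [FiniteDimensional ℂ F]
    [CompleteSpace F] {f : E → F} {U : Set E} (hU : IsOpen U) (hf : DifferentiableOn ℂ f U)
    (v : E) : DifferentiableOn ℂ (fun y => fderiv ℂ f y v) U := by
  intro y₀ hy₀
  obtain ⟨R, hR, hRU⟩ := Metric.isOpen_iff.1 hU y₀ hy₀
  -- A circle of this radius in direction v moves a point by at most R/2; the summand 1 covers v =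
  -- 0.
  set r : ℝ := R / (2 * (‖v‖ + 1)) with hr
  have hv0 := norm_nonneg v
  have hr0 : 0 < r := by positivity
  have hmem : ∀ y ∈ ball y₀ (R / 2), ∀ t ∈ closedBall (0 : ℂ) r, y + t • v ∈ U := by
    intro y hy t ht
    apply hRU
    rw [mem_closedBall_zero_iff] at ht
    rw [mem_ball, dist_eq_norm] at hy ⊢
    have h1 : ‖t • v‖ ≤ R / 2 := by
      rw [norm_smul]
      calc ‖t‖ * ‖v‖ ≤ r * (‖v‖ + 1) := by gcongr; linarith
        _ = R / 2 := by rw [hr]; field_simp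
    calc ‖y + t • v - y₀‖ = ‖(y - y₀) + t • v‖ := by congr 1; abel
      _ ≤ ‖y - y₀‖ + ‖t • v‖ := norm_add_le _ _
      _ < R := by linarith
  have hUo : IsOpen {q : E × ℂ | q.1 + q.2 • v ∈ U} := hU.preimage (by fun_prop)
  -- Cauchy's formula writes the directional derivative as a circle integral of f against a kernel
  -- free of y, so its holomorphy is that of a parameter integral.
  have key := differentiableOn_integral (E := E) (P := ℂ) (F := F) (volume : Measure ℝ)
    (S := Icc 0 (2 * Real.pi)) isCompact_Icc
    (w := fun θ => deriv (circleMap 0 r) θ * ((circleMap 0 r θ) ^ 2)⁻¹)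
    (p := circleMap 0 r) (by
      have h0 : ∀ θ, circleMap 0 r θ ^ 2 ≠ 0 := fun θ => pow_ne_zero 2 (by
        simpa using circleMap_ne_center (c := 0) (θ := θ) hr0.ne')
      simp only [deriv_circleMap]
      exact ((continuous_circleMap 0 r).mul continuous_const).mul
        (((continuous_circleMap 0 r).pow 2).inv₀ h0))
    (continuous_circleMap 0 r) hUo
    (g := fun q => f (q.1 + q.2 • v))
    (hf.comp (f := fun q : E × ℂ => q.1 + q.2 • v) (by fun_prop) fun q hq => hq)
    (V := ball y₀ (R / 2)) isOpen_ball (fun y hy θ _ =>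
      hmem y hy _ (sphere_subset_closedBall (circleMap_mem_sphere 0 hr0.le θ)))
  have heq : ∀ y ∈ ball y₀ (R / 2), fderiv ℂ f y v = (2 * Real.pi * Complex.I : ℂ)⁻¹ •
      ∫ θ in Icc 0 (2 * Real.pi),
        (deriv (circleMap 0 r) θ * ((circleMap 0 r θ) ^ 2)⁻¹) • f (y + circleMap 0 r θ • v) := by
    intro y hy
    have hlo : IsOpen {t : ℂ | y + t • v ∈ U} := hU.preimage (by fun_prop)
    have h1 := Complex.two_pi_I_inv_smul_circleIntegral_sub_sq_inv_smul_of_differentiable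
      (U := {t : ℂ | y + t • v ∈ U}) (f := fun t : ℂ => f (y + t • v)) hlo
      (c := 0) (w₀ := 0) (R := r) (fun t ht => hmem y hy t ht)
      (hf.comp (f := fun t : ℂ => y + t • v) (by fun_prop) fun t ht => ht) (mem_ball_self hr0)
    have hyU : y ∈ U := by simpa using hmem y hy 0 (mem_closedBall_self hr0.le)
    have h2 : HasDerivAt (fun t : ℂ => f (y + t • v)) (fderiv ℂ f y v) 0 := by
      have hl : HasDerivAt (fun t : ℂ => y + t • v) v 0 := by
        simpa using ((hasDerivAt_id (0 : ℂ)).smul_const v).const_add y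
      have h3 : HasFDerivAt f (fderiv ℂ f y) (y + (0 : ℂ) • v) := by
        simpa using (hf.differentiableAt (hU.mem_nhds hyU)).hasFDerivAt
      exact h3.comp_hasDerivAt (0 : ℂ) hl
    rw [← h2.deriv, ← h1]
    congr 1
    rw [circleIntegral, intervalIntegral.integral_of_le (by positivity),
      integral_Icc_eq_integral_Ioc]
    simp only [sub_zero, smul_smul]
  have hmemy : y₀ ∈ ball y₀ (R / 2) := mem_ball_self (by positivity)
  have h3 : DifferentiableAt ℂ (fun y => (2 * Real.pi * Complex.I : ℂ)⁻¹ •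
      ∫ θ in Icc 0 (2 * Real.pi),
        (deriv (circleMap 0 r) θ * ((circleMap 0 r θ) ^ 2)⁻¹) • f (y + circleMap 0 r θ • v)) y₀ :=
    (key.differentiableAt (isOpen_ball.mem_nhds hmemy)).const_smul _
  refine (h3.congr_of_eventuallyEq ?_).differentiableWithinAt
  filter_upwards [isOpen_ball.mem_nhds hmemy] with y hy using heq y hy

/-- In coordinates on E a linear map is the tuple of its values on a basis, which reduces the claim
to directional derivatives. It supplies the second derivative of the generating function. -/
theorem differentiableOn_fderiv [FiniteDimensional ℂ E] [FiniteDimensional ℂ F]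
    [CompleteSpace F] {f : E → F} {U : Set E} (hU : IsOpen U) (hf : DifferentiableOn ℂ f U) :
    DifferentiableOn ℂ (fderiv ℂ f) U := by
  have hd : Module.finrank ℂ E = Module.finrank ℂ (Fin (Module.finrank ℂ E) → ℂ) := by simp
  let e₁ := ContinuousLinearEquiv.ofFinrankEq hd
  let e₂ := (e₁.arrowCongr (1 : F ≃L[ℂ] F)).trans
    (ContinuousLinearEquiv.piRing (Fin (Module.finrank ℂ E)))
  have h1 : DifferentiableOn ℂ (fun y => e₂ (fderiv ℂ f y)) U :=
    differentiableOn_pi.2 fun i => differentiableOn_fderiv_apply hU hf _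
  have h2 := e₂.symm.differentiable.comp_differentiableOn h1
  simpa [Function.comp_def] using h2

end ComplexAnalysis

end Averaging
end

noncomputable section

namespace Averaging

open Metric Set MeasureTheory Filter Topology

/-! ### Integral curves and Lie series. -/

section Flow

variable {E F : Type*} [NormedAddCommGroup E] [NormedSpace ℂ E]
  [NormedAddCommGroup F] [NormedSpace ℂ F]

theorem HasDerivWithinAt.comp_holomorphic {g : E → F} {U : Set E} (hU : IsOpen U)
    (hg : DifferentiableOn ℂ g U) {z : ℝ → E} {s : Set ℝ} {t : ℝ} {z' : E}
    (hz : HasDerivWithinAt z z' s t) (ht : z t ∈ U) :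
    HasDerivWithinAt (fun u => g (z u)) (fderiv ℂ g (z t) z') s t := by
  have h1 : HasFDerivAt g ((fderiv ℂ g (z t)).restrictScalars ℝ) (z t) :=
    (hg.differentiableAt (hU.mem_nhds ht)).hasFDerivAt.restrictScalars ℝ
  exact h1.comp_hasDerivWithinAt t hz

/-- Along an integral curve of `X`, a function is the sum of its Lie series. -/
theorem hasSum_lieSeries [CompleteSpace F] {X : E → E} {G : ℕ → E → F} {U : Set E} (hU : IsOpen U)
    (hG : ∀ j, DifferentiableOn ℂ (G j) U)
    (hstep : ∀ j, ∀ w ∈ U, fderiv ℂ (G j) w (X w) = G (j + 1) w)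
    {C q : ℝ} (hq0 : 0 ≤ q) (hq1 : q < 1)
    (hb : ∀ j, ∀ w ∈ U, ‖G (j + 1) w‖ ≤ C * q ^ (j + 1) * (j + 1).factorial)
    {z : ℝ → E} (hz : ∀ t ∈ Icc (0 : ℝ) 1, HasDerivWithinAt z (X (z t)) (Icc 0 1) t)
    (hzU : ∀ t ∈ Icc (0 : ℝ) 1, z t ∈ U) {t : ℝ} (ht : t ∈ Icc (0 : ℝ) 1) :
    HasSum (fun j : ℕ => (t ^ j / (j.factorial : ℝ)) • G j (z 0)) (G 0 (z t)) := by
  have h0 : (0 : ℝ) ∈ Icc (0 : ℝ) 1 := ⟨le_rfl, zero_le_one⟩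
  have hsub : Icc (0 : ℝ) t ⊆ Icc 0 1 := Icc_subset_Icc le_rfl ht.2
  have hGz : ∀ j, ∀ u ∈ Icc (0 : ℝ) t, HasDerivWithinAt (fun u => G j (z u))
      (G (j + 1) (z u)) (Icc 0 t) u := by
    intro j u hu
    have hu1 := hsub hu
    rw [← hstep j _ (hzU u hu1)]
    exact HasDerivWithinAt.comp_holomorphic hU (hG j) ((hz u hu1).mono hsub) (hzU u hu1)
  -- Taylor's formula with moving base point: each `G j` along the curve has derivative `G (j + 1)`,
  -- so differentiating the Taylor polynomial in the base time u telescopes to the last term. At u =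
  -- t the polynomial is `G 0 (z t)`, at u = 0 it is the partial sum of the series.
  have hder : ∀ J : ℕ, ∀ u ∈ Icc (0 : ℝ) t, HasDerivWithinAt
      (fun u => ∑ j ∈ Finset.range (J + 1), ((t - u) ^ j / (j.factorial : ℝ)) • G j (z u))
      (((t - u) ^ J / (J.factorial : ℝ)) • G (J + 1) (z u)) (Icc 0 t) u := by
    intro J
    induction J with
    | zero => intro u hu; simpa using hGz 0 u hu
    | succ J ih =>
      intro u hu
      have h1 : HasDerivWithinAt (fun u : ℝ => (t - u) ^ (J + 1) / ((J + 1).factorial : ℝ))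
          (-((t - u) ^ J / (J.factorial : ℝ))) (Icc 0 t) u := by
        have h2 := ((((hasDerivAt_id u).const_sub t).pow (J + 1)).div_const
          ((J + 1).factorial : ℝ)).hasDerivWithinAt (s := Icc 0 t)
        refine h2.congr_deriv ?_
        have : (J.factorial : ℝ) ≠ 0 := by positivity
        simp only [Nat.factorial_succ, id, Nat.add_sub_cancel]
        push_cast
        field_simp
      have h3 := (ih u hu).add (h1.smul (hGz (J + 1) u hu))
      simp only [Finset.sum_range_succ _ (J + 1)]
      refine h3.congr_deriv ?_
      rw [neg_smul]; abel
  have hC : 0 ≤ C * q := by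
    have := (norm_nonneg _).trans (hb 0 _ (hzU 0 h0))
    simpa using this
  -- The quotient (J+1)!/J! leaves a factor J + 1, harmless against q^J.
  have hbd : ∀ J : ℕ, ‖G 0 (z t) - ∑ j ∈ Finset.range (J + 1),
      (t ^ j / (j.factorial : ℝ)) • G j (z 0)‖ ≤ C * q * ((J + 1 : ℝ) * q ^ J) := by
    intro J
    have h1 : ∀ u ∈ Icc (0 : ℝ) t, ‖((t - u) ^ J / (J.factorial : ℝ)) • G (J + 1) (z u)‖ ≤
        C * q * ((J + 1 : ℝ) * q ^ J) := by
      intro u hu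
      rw [norm_smul, Real.norm_of_nonneg (by have := hu.2; have : 0 ≤ t - u := by linarith
                                             positivity)]
      have h2 : (t - u) ^ J ≤ 1 := pow_le_one₀ (by linarith [hu.2]) (by linarith [hu.1, ht.2])
      have h4 := hb J _ (hzU u (hsub hu))
      calc (t - u) ^ J / (J.factorial : ℝ) * ‖G (J + 1) (z u)‖
          ≤ 1 / (J.factorial : ℝ) * (C * q ^ (J + 1) * (J + 1).factorial) := by gcongr
        _ = _ := by
          have : (J.factorial : ℝ) ≠ 0 := by positivity
          simp only [Nat.factorial_succ]
          push_cast
          field_simp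
          ring
    have h5 := (convex_Icc (0 : ℝ) t).norm_image_sub_le_of_norm_hasDerivWithin_le
      (fun u hu => hder J u hu) h1 (left_mem_Icc.2 ht.1) (right_mem_Icc.2 ht.1)
    have h6 : ∑ j ∈ Finset.range (J + 1), ((t - t) ^ j / (j.factorial : ℝ)) • G j (z t) =
        G 0 (z t) := by
      rw [Finset.sum_eq_single 0]
      · simp
      · intro j _ hj; simp [hj]
      · simp
    rw [h6] at h5
    simp only [sub_zero] at h5
    refine h5.trans ?_
    rw [Real.norm_of_nonneg ht.1]
    exact mul_le_of_le_one_right (mul_nonneg hC (by positivity)) ht.2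
  have hsum : Summable (fun j : ℕ => (t ^ j / (j.factorial : ℝ)) • G j (z 0)) := by
    rw [← summable_nat_add_iff 1]
    refine Summable.of_norm_bounded (g := fun j => C * q * q ^ j)
      ((summable_geometric_of_lt_one hq0 hq1).mul_left _) fun j => ?_
    rw [norm_smul, Real.norm_of_nonneg (by have := ht.1; positivity)]
    have h2 : t ^ (j + 1) ≤ 1 := pow_le_one₀ ht.1 ht.2
    calc t ^ (j + 1) / ((j + 1).factorial : ℝ) * ‖G (j + 1) (z 0)‖
        ≤ 1 / ((j + 1).factorial : ℝ) * (C * q ^ (j + 1) * (j + 1).factorial) := by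
          gcongr; exact hb j _ (hzU 0 h0)
      _ = C * q * q ^ j := by
          have : ((j + 1).factorial : ℝ) ≠ 0 := by positivity
          field_simp
          ring
  have hlim : Tendsto (fun J : ℕ => C * q * ((J + 1 : ℝ) * q ^ J)) atTop (𝓝 0) := by
    have h1 := tendsto_self_mul_const_pow_of_lt_one hq0 hq1
    have h2 := tendsto_pow_atTop_nhds_zero_of_lt_one hq0 hq1
    have := (h1.add h2).const_mul (C * q)
    simpa [add_mul] using this
  have hlim2 : Tendsto (fun J : ℕ => ∑ j ∈ Finset.range (J + 1),
      (t ^ j / (j.factorial : ℝ)) • G j (z 0)) atTop (𝓝 (G 0 (z t))) := by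
    rw [tendsto_iff_norm_sub_tendsto_zero]
    refine squeeze_zero (fun _ => norm_nonneg _) (fun J => ?_) hlim
    rw [norm_sub_rev]; exact hbd J
  have hlim3 := (tendsto_add_atTop_iff_nat (f := fun J : ℕ => ∑ j ∈ Finset.range J,
      (t ^ j / (j.factorial : ℝ)) • G j (z 0)) 1).1 hlim2
  rw [← tendsto_nhds_unique hsum.hasSum.tendsto_sum_nat hlim3]
  exact hsum.hasSum

open ODE in
-- Speed 1/4 during unit time keeps the curve in the ball of radius 1/4, and a Cauchy estimate over
-- a further distance 1/4 turns the bound 1/4 into the Lipschitz constant 1, so Picard iteration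
-- reaches time 1.
theorem exists_flow_unitBall [CompleteSpace E] {X : E → E} {z₀ : E}
    (hX : DifferentiableOn ℂ X (ball z₀ 1)) (hb : ∀ w ∈ ball z₀ 1, ‖X w‖ ≤ 1 / 4) :
    ∃ z : ℝ → E, z 0 = z₀ ∧
      (∀ t ∈ Icc (0 : ℝ) 1, HasDerivWithinAt z (X (z t)) (Icc 0 1) t) ∧
      ∀ t ∈ Icc (0 : ℝ) 1, z t ∈ closedBall z₀ (1 / 4) := by
  have hsub : ∀ w ∈ closedBall z₀ (1 / 4), closedBall w (1 / 4) ⊆ ball z₀ 1 := by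
    intro w hw v hv
    rw [mem_closedBall] at hw hv
    rw [mem_ball]
    linarith [dist_triangle v w z₀]
  have hsub1 : closedBall z₀ (1 / 4) ⊆ ball z₀ 1 := closedBall_subset_ball (by norm_num)
  have hlip : LipschitzOnWith 1 X (closedBall z₀ (1 / 4)) := by
    refine (convex_closedBall z₀ (1 / 4)).lipschitzOnWith_of_nnnorm_fderiv_le (𝕜 := ℂ)
      (fun w hw => hX.differentiableAt (isOpen_ball.mem_nhds (hsub1 hw))) fun w hw => ?_
    have := norm_fderiv_le isOpen_ball hX (by norm_num : (0 : ℝ) < 1 / 4) (hsub w hw)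
      fun v hv => hb v (hsub w hw hv)
    rw [← NNReal.coe_le_coe, coe_nnnorm]
    simpa using this
  have hPL : IsPicardLindelof (fun _ : ℝ => X) (tmin := 0) (tmax := 1) ⟨0, by simp⟩ z₀
      (1 / 4) 0 (1 / 4) 1 := by
    refine ⟨fun t _ => ?_, fun x _ => continuousOn_const, fun t _ x hx => ?_, ?_⟩
    · simpa using hlip
    · simpa using hb x (hsub1 (by simpa using hx))
    · simp
  -- The curve is taken as the fixed point of the Picard operator itself, because membership in the
  -- function space also records that it stays in the small ball.
  obtain ⟨α, hα⟩ := FunSpace.exists_isFixedPt_next hPL (mem_closedBall_self le_rfl)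
  have hmem : ∀ t, α.compProj t ∈ closedBall z₀ (1 / 4) := fun t => by
    simpa using FunSpace.compProj_mem_closedBall α hPL.mul_max_le (t := t)
  refine ⟨α.compProj, ?_, fun t ht => ?_, fun t _ => hmem t⟩
  · have := FunSpace.compProj_val (α := α) (t := ⟨0, by simp⟩)
    simp only at this
    rw [this, ← hα, FunSpace.next_apply₀]
  · apply hasDerivWithinAt_picard_Icc (⟨0, by simp⟩ : Icc (0 : ℝ) 1).2 hPL.continuousOn_uncurry
      α.continuous_compProj.continuousOn
      (fun _ ht' ↦ α.compProj_mem_closedBall hPL.mul_max_le) z₀ ht |>.congr_of_mem _ ht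
    intro t' ht'
    nth_rw 1 [← hα]
    rw [FunSpace.compProj_of_mem ht', FunSpace.next_apply]

end Flow

/-! ### Flows in products of two balls. -/

section Box

/-- The product of two balls, with different radii in the two factors. -/
def box {E₁ E₂ : Type*} [NormedAddCommGroup E₁] [NormedAddCommGroup E₂]
    (z : E₁ × E₂) (δ τ : ℝ) : Set (E₁ × E₂) := ball z.1 δ ×ˢ ball z.2 τ

theorem isOpen_box {E₁ E₂ : Type*} [NormedAddCommGroup E₁] [NormedAddCommGroup E₂]
    (z : E₁ × E₂) (δ τ : ℝ) : IsOpen (box z δ τ) := isOpen_ball.prod isOpen_ball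

theorem mem_box {E₁ E₂ : Type*} [NormedAddCommGroup E₁] [NormedAddCommGroup E₂]
    {z w : E₁ × E₂} {δ τ : ℝ} : w ∈ box z δ τ ↔ ‖w.1 - z.1‖ < δ ∧ ‖w.2 - z.2‖ < τ := by
  simp [box, mem_ball, dist_eq_norm]

variable {E₁ E₂ : Type*} [NormedAddCommGroup E₁] [NormedSpace ℂ E₁]
  [NormedAddCommGroup E₂] [NormedSpace ℂ E₂]

/-- Rescaling the factors by δ and τ turns the box into a unit ball of the maximum norm. The two
radii are kept apart because actions and angles have independent analyticity widths. -/
theorem exists_flow_box [CompleteSpace E₁] [CompleteSpace E₂] {X : E₁ × E₂ → E₁ × E₂}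
    {z₀ : E₁ × E₂} {δ τ : ℝ} (hδ : 0 < δ) (hτ : 0 < τ)
    (hX : DifferentiableOn ℂ X (box z₀ δ τ))
    (hb₁ : ∀ w ∈ box z₀ δ τ, ‖(X w).1‖ ≤ δ / 4) (hb₂ : ∀ w ∈ box z₀ δ τ, ‖(X w).2‖ ≤ τ / 4) :
    ∃ z : ℝ → E₁ × E₂, z 0 = z₀ ∧
      (∀ t ∈ Icc (0 : ℝ) 1, HasDerivWithinAt z (X (z t)) (Icc 0 1) t) ∧
      ∀ t ∈ Icc (0 : ℝ) 1, ‖(z t).1 - z₀.1‖ ≤ δ / 4 ∧ ‖(z t).2 - z₀.2‖ ≤ τ / 4 := by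
  let A : E₁ × E₂ →L[ℂ] E₁ × E₂ :=
    ((δ : ℂ) • ContinuousLinearMap.id ℂ E₁).prodMap ((τ : ℂ) • ContinuousLinearMap.id ℂ E₂)
  let B : E₁ × E₂ →L[ℂ] E₁ × E₂ :=
    ((δ⁻¹ : ℂ) • ContinuousLinearMap.id ℂ E₁).prodMap ((τ⁻¹ : ℂ) • ContinuousLinearMap.id ℂ E₂)
  have hδ' : (δ : ℂ) ≠ 0 := by exact_mod_cast hδ.ne'
  have hτ' : (τ : ℂ) ≠ 0 := by exact_mod_cast hτ.ne'
  have hA : ∀ p, A p = ((δ : ℂ) • p.1, (τ : ℂ) • p.2) := fun p => rfl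
  have hB : ∀ p, B p = ((δ⁻¹ : ℂ) • p.1, (τ⁻¹ : ℂ) • p.2) := fun p => rfl
  have hAB : ∀ p, A (B p) = p := fun p => by
    rw [hB, hA]; ext <;> simp [smul_smul, hδ', hτ']
  have hmem : ∀ p ∈ ball (B z₀) 1, A p ∈ box z₀ δ τ := by
    intro p hp
    rw [mem_ball, dist_eq_norm, Prod.norm_def, max_lt_iff] at hp
    rw [mem_box, hA]
    rw [hB] at hp
    simp only [Prod.fst_sub, Prod.snd_sub] at hp
    have h1 : (δ : ℂ) • p.1 - z₀.1 = (δ : ℂ) • (p.1 - (δ⁻¹ : ℂ) • z₀.1) := by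
      rw [smul_sub, smul_smul, mul_inv_cancel₀ hδ', one_smul]
    have h2 : (τ : ℂ) • p.2 - z₀.2 = (τ : ℂ) • (p.2 - (τ⁻¹ : ℂ) • z₀.2) := by
      rw [smul_sub, smul_smul, mul_inv_cancel₀ hτ', one_smul]
    simp only [h1, h2, norm_smul, Complex.norm_real, Real.norm_of_nonneg hδ.le,
      Real.norm_of_nonneg hτ.le]
    exact ⟨mul_lt_of_lt_one_right hδ hp.1, mul_lt_of_lt_one_right hτ hp.2⟩
  obtain ⟨u, hu0, hu1, hu2⟩ := exists_flow_unitBall (X := fun p => B (X (A p))) (z₀ := B z₀)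
    (B.differentiable.comp_differentiableOn (hX.comp A.differentiable.differentiableOn hmem))
    (by
      intro p hp
      have h1 := hb₁ _ (hmem p hp)
      have h2 := hb₂ _ (hmem p hp)
      simp only [hB, Prod.norm_def, norm_smul, norm_inv, Complex.norm_real,
        Real.norm_of_nonneg hδ.le, Real.norm_of_nonneg hτ.le]
      refine max_le ?_ ?_
      · rw [inv_mul_le_iff₀ hδ]; linarith
      · rw [inv_mul_le_iff₀ hτ]; linarith)
  refine ⟨fun t => A (u t), by simp only [hu0, hAB], fun t ht => ?_, fun t ht => ?_⟩
  · have h1 := ((A.restrictScalars ℝ).hasFDerivAt (x := u t)).comp_hasDerivWithinAt t (hu1 t ht)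
    refine h1.congr_deriv ?_
    simp [hAB]
  · have hp := hu2 t ht
    rw [mem_closedBall, dist_eq_norm, Prod.norm_def, max_le_iff] at hp
    rw [hB] at hp
    simp only [Prod.fst_sub, Prod.snd_sub] at hp
    have h1 : (δ : ℂ) • (u t).1 - z₀.1 = (δ : ℂ) • ((u t).1 - (δ⁻¹ : ℂ) • z₀.1) := by
      rw [smul_sub, smul_smul, mul_inv_cancel₀ hδ', one_smul]
    have h2 : (τ : ℂ) • (u t).2 - z₀.2 = (τ : ℂ) • ((u t).2 - (τ⁻¹ : ℂ) • z₀.2) := by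
      rw [smul_sub, smul_smul, mul_inv_cancel₀ hτ', one_smul]
    simp only [hA, h1, h2, norm_smul, Complex.norm_real, Real.norm_of_nonneg hδ.le,
      Real.norm_of_nonneg hτ.le]
    constructor
    · have := mul_le_mul_of_nonneg_left hp.1 hδ.le; linarith
    · have := mul_le_mul_of_nonneg_left hp.2 hτ.le; linarith

/-- Integral curves with the same end point which stay close to their starting point coincide. -/
theorem flow_injective {X : E₁ × E₂ → E₁ × E₂} {δ τ C : ℝ} (hδ : 0 < δ) (hτ : 0 < τ)
    {z w : ℝ → E₁ × E₂}
    (hX : DifferentiableOn ℂ X (box (z 0) δ τ)) (hC : ∀ p ∈ box (z 0) δ τ, ‖X p‖ ≤ C)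
    (hz : ∀ t ∈ Icc (0 : ℝ) 1, HasDerivWithinAt z (X (z t)) (Icc 0 1) t)
    (hw : ∀ t ∈ Icc (0 : ℝ) 1, HasDerivWithinAt w (X (w t)) (Icc 0 1) t)
    (hz' : ∀ t ∈ Icc (0 : ℝ) 1, ‖(z t).1 - (z 0).1‖ ≤ δ / 4 ∧ ‖(z t).2 - (z 0).2‖ ≤ τ / 4)
    (hw' : ∀ t ∈ Icc (0 : ℝ) 1, ‖(w t).1 - (w 0).1‖ ≤ δ / 4 ∧ ‖(w t).2 - (w 0).2‖ ≤ τ / 4)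
    (h1 : z 1 = w 1) : z 0 = w 0 := by
  -- Uniqueness is run backwards from the common end point. Nothing is known a priori about the
  -- distance from `w 0` to `z 0`, so the convex set is centred at `z 1`: both curves stay within
  -- δ/4 + δ/4 of it, and likewise for τ.
  set K : Set (E₁ × E₂) := closedBall (z 1).1 (δ / 2) ×ˢ closedBall (z 1).2 (τ / 2) with hK
  have hI1 : (1 : ℝ) ∈ Icc (0 : ℝ) 1 := by simp
  have hclose : ∀ v : ℝ → E₁ × E₂, v 1 = z 1 →
      (∀ t ∈ Icc (0 : ℝ) 1, ‖(v t).1 - (v 0).1‖ ≤ δ / 4 ∧ ‖(v t).2 - (v 0).2‖ ≤ τ / 4) →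
      ∀ t ∈ Icc (0 : ℝ) 1, v t ∈ K := by
    intro v hv1 hv t ht
    have ha := hv t ht
    have hb := hv 1 hI1
    rw [hK, mem_prod, mem_closedBall, mem_closedBall, dist_eq_norm, dist_eq_norm, ← hv1]
    constructor
    · have := norm_sub_le_norm_sub_add_norm_sub (v t).1 (v 0).1 (v 1).1
      rw [norm_sub_rev (v 0).1] at this
      linarith
    · have := norm_sub_le_norm_sub_add_norm_sub (v t).2 (v 0).2 (v 1).2
      rw [norm_sub_rev (v 0).2] at this
      linarith
  -- Room for a Cauchy estimate on K inside the box about `z 0`: δ/8 + δ/2 + δ/4 < δ.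
  set μ := min δ τ / 8 with hμ
  have hμ0 : 0 < μ := by have := lt_min hδ hτ; positivity
  have hμδ : μ ≤ δ / 8 := by rw [hμ]; gcongr; exact min_le_left _ _
  have hμτ : μ ≤ τ / 8 := by rw [hμ]; gcongr; exact min_le_right _ _
  have hKU : ∀ p ∈ K, closedBall p μ ⊆ box (z 0) δ τ := by
    rintro p ⟨hp1, hp2⟩ v hv
    have hz1 := hz' 1 hI1
    rw [mem_closedBall, dist_eq_norm] at hp1 hp2 hv
    rw [Prod.norm_def, max_le_iff] at hv
    rw [mem_box]
    have a1 := norm_sub_le_norm_sub_add_norm_sub v.1 p.1 (z 0).1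
    have a2 := norm_sub_le_norm_sub_add_norm_sub p.1 (z 1).1 (z 0).1
    have b1 := norm_sub_le_norm_sub_add_norm_sub v.2 p.2 (z 0).2
    have b2 := norm_sub_le_norm_sub_add_norm_sub p.2 (z 1).2 (z 0).2
    simp only [Prod.fst_sub, Prod.snd_sub] at hv
    constructor <;> linarith
  have hconv : Convex ℝ K := (convex_closedBall _ _).prod (convex_closedBall _ _)
  have hlip : LipschitzOnWith (Real.toNNReal (C / μ)) X K := by
    refine hconv.lipschitzOnWith_of_nnnorm_fderiv_le (𝕜 := ℂ)
      (fun p hp => hX.differentiableAt ((isOpen_box _ _ _).mem_nhds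
        (hKU p hp (mem_closedBall_self hμ0.le)))) fun p hp => ?_
    have := norm_fderiv_le (isOpen_box _ _ _) hX hμ0 (hKU p hp)
      fun v hv => hC v (hKU p hp hv)
    rw [← NNReal.coe_le_coe, coe_nnnorm]
    exact this.trans (Real.le_coe_toNNReal _)
  have hder : ∀ v : ℝ → E₁ × E₂,
      (∀ t ∈ Icc (0 : ℝ) 1, HasDerivWithinAt v (X (v t)) (Icc 0 1) t) →
      ∀ t ∈ Ioc (0 : ℝ) 1, HasDerivWithinAt v (X (v t)) (Iic t) t := by
    intro v hv t ht
    exact ((hv t ⟨ht.1.le, ht.2⟩).mono (Icc_subset_Icc_right ht.2)).mono_of_mem_nhdsWithin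
      (Icc_mem_nhdsLE ht.1)
  have := ODE_solution_unique_of_mem_Icc_left (v := fun _ => X) (s := fun _ => K)
    (f := z) (g := w) (a := 0) (b := 1) (fun t _ => hlip)
    (fun t ht => (hz t ht).continuousWithinAt) (hder z hz)
    (fun t ht => hclose z rfl hz' t ⟨ht.1.le, ht.2⟩)
    (fun t ht => (hw t ht).continuousWithinAt) (hder w hw)
    (fun t ht => hclose w h1.symm hw' t ⟨ht.1.le, ht.2⟩) h1
  exact this ⟨le_rfl, zero_le_one⟩

end Box


end Averaging
end

noncomputable section

namespace Averaging

open Metric Set MeasureTheory Filter Topology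

/-! ### Holomorphy and symplecticity of the time-one flow. -/

section SymplecticFlow

variable {E : Type*} [NormedAddCommGroup E] [NormedSpace ℂ E] [CompleteSpace E]

/-- An exponential series may be differentiated in the time variable. -/
theorem hasDerivAt_exponentialSeries {V : Type*} [NormedAddCommGroup V] [NormedSpace ℝ V]
    [CompleteSpace V] {D : ℕ → V} {C q : ℝ} (hq0 : 0 ≤ q) (hq : q ≤ 1 / 8)
    (hD : ∀ j, ‖D j‖ ≤ C * q ^ j * j.factorial) {t : ℝ} (ht : t ∈ Ioo (-2 : ℝ) 2) :
    HasDerivAt (fun t : ℝ => ∑' j : ℕ, (t ^ j / (j.factorial : ℝ)) • D j)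
      (∑' j : ℕ, (t ^ j / (j.factorial : ℝ)) • D (j + 1)) t := by
  have hC : 0 ≤ C := by simpa using (norm_nonneg _).trans (hD 0)
  have hu : Summable fun j : ℕ => C * (1 / 2 : ℝ) ^ j := summable_geometric_two.mul_left C
  -- The value 1/8 leaves ratio 1/2 after paying 2^j for the factor j and 2^j for |t| < 2; the open
  -- interval (-2, 2) makes two-sided derivatives available at the ends of [0, 1].
  have hq' : ∀ j : ℕ, (j : ℝ) * 2 ^ (j - 1) * q ^ j ≤ (1 / 2 : ℝ) ^ j := by
    intro j
    have h1 : (j : ℝ) ≤ 2 ^ j := by exact_mod_cast Nat.lt_two_pow_self.le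
    have h2 : (2 : ℝ) ^ (j - 1) ≤ 2 ^ j := pow_le_pow_right₀ (by norm_num) (Nat.sub_le _ _)
    calc (j : ℝ) * 2 ^ (j - 1) * q ^ j ≤ 2 ^ j * 2 ^ j * (1 / 8) ^ j := by gcongr
      _ = (1 / 2 : ℝ) ^ j := by rw [← mul_pow, ← mul_pow]; norm_num
  have key := hasDerivAt_tsum_of_isPreconnected (𝕜 := ℝ) (F := V)
    (g := fun (j : ℕ) (t : ℝ) => (t ^ j / (j.factorial : ℝ)) • D j)
    (g' := fun (j : ℕ) (t : ℝ) => ((j : ℝ) * t ^ (j - 1) / (j.factorial : ℝ)) • D j)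
    (t := Ioo (-2 : ℝ) 2) hu isOpen_Ioo isPreconnected_Ioo
    (fun j t _ => by
      exact ((hasDerivAt_pow j t).div_const _).smul_const (D j))
    (fun j t ht => by
      rw [norm_smul, norm_div, norm_mul, norm_pow, Real.norm_natCast, Real.norm_natCast]
      have h1 : ‖t‖ ≤ 2 := by rw [Real.norm_eq_abs, abs_le]; exact ⟨ht.1.le, ht.2.le⟩
      calc (j : ℝ) * ‖t‖ ^ (j - 1) / j.factorial * ‖D j‖
          ≤ (j : ℝ) * 2 ^ (j - 1) / j.factorial * (C * q ^ j * j.factorial) := by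
            gcongr; exact hD j
        _ = C * (j * 2 ^ (j - 1) * q ^ j) := by
            have : (j.factorial : ℝ) ≠ 0 := by positivity
            field_simp
        _ ≤ C * (1 / 2) ^ j := by gcongr; exact hq' j)
    (y₀ := 0) (by simp)
    (summable_of_ne_finset_zero (s := {0}) fun j hj => by
      have : j ≠ 0 := by simpa using hj
      simp [this]) ht
  refine key.congr_deriv ?_
  have hs : Summable fun j : ℕ => ((j : ℝ) * t ^ (j - 1) / (j.factorial : ℝ)) • D j := by
    refine Summable.of_norm_bounded hu fun j => ?_
    rw [norm_smul, norm_div, norm_mul, norm_pow, Real.norm_natCast, Real.norm_natCast]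
    have h1 : ‖t‖ ≤ 2 := by rw [Real.norm_eq_abs, abs_le]; exact ⟨ht.1.le, ht.2.le⟩
    calc (j : ℝ) * ‖t‖ ^ (j - 1) / j.factorial * ‖D j‖
        ≤ (j : ℝ) * 2 ^ (j - 1) / j.factorial * (C * q ^ j * j.factorial) := by
          gcongr; exact hD j
      _ = C * (j * 2 ^ (j - 1) * q ^ j) := by
          have : (j.factorial : ℝ) ≠ 0 := by positivity
          field_simp
      _ ≤ C * (1 / 2) ^ j := by gcongr; exact hq' j
  rw [hs.tsum_eq_zero_add]
  simp only [Nat.cast_zero, zero_mul, zero_div, zero_smul, zero_add, Nat.add_sub_cancel]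
  refine tsum_congr fun j => ?_
  congr 1
  rw [Nat.factorial_succ]
  push_cast
  have : (j.factorial : ℝ) ≠ 0 := by positivity
  field_simp

/-- The flow of a vector field whose linearization is skew for a bilinear form preserves this
form, and it is holomorphic in the initial point. -/
theorem flow_symplectic {X : E → E} {G : ℕ → E → E} {U V : Set E}
    (hU : IsOpen U) (hV : IsOpen V) (hVU : V ⊆ U)
    (hG : ∀ j, DifferentiableOn ℂ (G j) U) (hG0 : ∀ w, G 0 w = w) (hG1 : ∀ w ∈ U, G 1 w = X w)
    (hstep : ∀ j, ∀ w ∈ U, fderiv ℂ (G j) w (X w) = G (j + 1) w)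
    {C q : ℝ} (hq0 : 0 ≤ q) (hq : q ≤ 1 / 8)
    (hb : ∀ j, ∀ w ∈ U, ‖G (j + 1) w‖ ≤ C * q ^ (j + 1) * (j + 1).factorial)
    {γ : E → ℝ → E} (hγ0 : ∀ z ∈ V, γ z 0 = z)
    (hγ : ∀ z ∈ V, ∀ t ∈ Icc (0 : ℝ) 1, HasDerivWithinAt (γ z) (X (γ z t)) (Icc 0 1) t)
    (hγU : ∀ z ∈ V, ∀ t ∈ Icc (0 : ℝ) 1, γ z t ∈ U)
    (B : E →L[ℂ] E →L[ℂ] ℂ)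
    (hB : ∀ w ∈ U, ∀ a b, B (fderiv ℂ X w a) b + B a (fderiv ℂ X w b) = 0) :
    DifferentiableOn ℂ (fun z => γ z 1) V ∧
    ∀ z ∈ V, ∀ a b, B (fderiv ℂ (fun z => γ z 1) z a) (fderiv ℂ (fun z => γ z 1) z b) =
      B a b := by
  have hX : DifferentiableOn ℂ X U := (hG 1).congr fun w hw => (hG1 w hw).symm
  -- Both the flow and the field along the flow are Lie series in the initial point, so they are
  -- differentiated term by term, with coefficients `G j` and `G (j + 1)`.
  have main : ∀ z ∈ V, (∀ t ∈ Icc (0 : ℝ) 1, HasFDerivAt (fun w => γ w t)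
      (∑' j : ℕ, (t ^ j / (j.factorial : ℝ)) • fderiv ℂ (G j) z) z) ∧
      (∀ t ∈ Icc (0 : ℝ) 1, HasFDerivAt (fun w => X (γ w t))
        (∑' j : ℕ, (t ^ j / (j.factorial : ℝ)) • fderiv ℂ (G (j + 1)) z) z) ∧
      ∃ C', ∀ j, ‖fderiv ℂ (G j) z‖ ≤ C' * q ^ j * j.factorial := by
    intro z hz
    obtain ⟨r, hr, hrV⟩ := Metric.isOpen_iff.1 hV z hz
    have hrU : ball z r ⊆ U := hrV.trans hVU
    -- `G 0` is the identity and is not covered by the uniform bound; near z it is bounded by ‖z‖ +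
    -- r.
    set C' := max C (‖z‖ + r) with hC'
    have hC'0 : 0 ≤ C' := le_max_of_le_right (by positivity)
    have hb' : ∀ j, ∀ w ∈ ball z r, ‖G j w‖ ≤ C' * q ^ j * j.factorial := by
      intro j w hw
      cases j with
      | zero =>
        simp only [pow_zero, Nat.factorial_zero, Nat.cast_one, mul_one, hG0]
        rw [mem_ball, dist_eq_norm] at hw
        have := norm_le_norm_add_norm_sub' w z
        exact le_max_of_le_right (by linarith)
      | succ j =>
        refine (hb j w (hrU hw)).trans ?_
        gcongr
        exact le_max_left _ _
    have hq1 : q < 1 := by linarith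
    have hfac : ∀ j : ℕ, (j.factorial : ℝ) ≠ 0 := fun j => by positivity
    have hd : ∀ (k j : ℕ) (t : ℝ), DifferentiableOn ℂ
        (fun w => (t ^ j / (j.factorial : ℝ)) • G (j + k) w) (ball z r) :=
      fun k j t => ((hG (j + k)).mono hrU).const_smul _
    have hfd : ∀ (k j : ℕ) (t : ℝ), fderiv ℂ
        (fun w => (t ^ j / (j.factorial : ℝ)) • G (j + k) w) z =
        (t ^ j / (j.factorial : ℝ)) • fderiv ℂ (G (j + k)) z := by
      intro k j t
      exact fderiv_fun_const_smul (((hG (j + k)).differentiableAt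
        (hU.mem_nhds (hVU hz)))) (t ^ j / (j.factorial : ℝ))
    have hzr : z ∈ ball z r := mem_ball_self hr
    refine ⟨fun t ht => ?_, fun t ht => ?_, ?_⟩
    · have h1 := (hasFDerivAt_tsum_of_bounded isOpen_ball (fun j => hd 0 j t)
        ((summable_geometric_of_lt_one hq0 hq1).mul_left C') (fun j w hw => by
          rw [norm_smul, Real.norm_of_nonneg (by have := ht.1; positivity)]
          have h2 : t ^ j ≤ 1 := pow_le_one₀ ht.1 ht.2
          calc t ^ j / (j.factorial : ℝ) * ‖G (j + 0) w‖
              ≤ 1 / (j.factorial : ℝ) * (C' * q ^ j * j.factorial) := by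
                gcongr; exact hb' j w hw
            _ = C' * q ^ j := by field_simp [hfac j]) hzr).2
      simp only [hfd] at h1
      simp only [add_zero] at h1
      refine h1.congr_of_eventuallyEq ?_
      filter_upwards [isOpen_ball.mem_nhds hzr] with w hw
      have h2 := hasSum_lieSeries hU hG hstep hq0 hq1 hb (hγ w (hrV hw)) (hγU w (hrV hw)) ht
      rw [hγ0 w (hrV hw), hG0] at h2
      exact h2.tsum_eq.symm
    · have h2q : 2 * q < 1 := by linarith
      -- Shifting the index by one costs (j+1)!/j! = j + 1 ≤ 2^j, absorbed by enlarging the ratio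
      -- from q to 2q.
      have hjq : ∀ j : ℕ, q ^ (j + 1) * ((j + 1 : ℕ) : ℝ) ≤ q * (2 * q) ^ j := by
        intro j
        have : ((j + 1 : ℕ) : ℝ) ≤ 2 ^ j := by
          exact_mod_cast Nat.lt_two_pow_self
        calc q ^ (j + 1) * ((j + 1 : ℕ) : ℝ) ≤ q ^ (j + 1) * 2 ^ j := by gcongr
          _ = q * (2 * q) ^ j := by ring
      have h1 := (hasFDerivAt_tsum_of_bounded isOpen_ball (fun j => hd 1 j t)
        ((summable_geometric_of_lt_one (by positivity) h2q).mul_left (C' * q))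
        (fun j w hw => by
          rw [norm_smul, Real.norm_of_nonneg (by have := ht.1; positivity)]
          have h2 : t ^ j ≤ 1 := pow_le_one₀ ht.1 ht.2
          calc t ^ j / (j.factorial : ℝ) * ‖G (j + 1) w‖
              ≤ 1 / (j.factorial : ℝ) * (C' * q ^ (j + 1) * (j + 1).factorial) := by
                gcongr; exact hb' _ w hw
            _ = C' * (q ^ (j + 1) * ((j + 1 : ℕ) : ℝ)) := by
                rw [Nat.factorial_succ]; push_cast; field_simp [hfac j]
            _ ≤ C' * (q * (2 * q) ^ j) := by gcongr C' * ?_; exact hjq j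
            _ = C' * q * (2 * q) ^ j := by ring) hzr).2
      simp only [hfd] at h1
      refine h1.congr_of_eventuallyEq ?_
      filter_upwards [isOpen_ball.mem_nhds hzr] with w hw
      have hC0 : 0 ≤ C * q := by
        simpa using (norm_nonneg _).trans (hb 0 w (hrU hw))
      have h2 := hasSum_lieSeries (G := fun j => G (j + 1)) (C := C * q) hU (fun j => hG (j + 1))
        (fun j => hstep (j + 1)) (by positivity : 0 ≤ 2 * q) h2q (fun j v hv => by
          refine (hb (j + 1) v hv).trans ?_
          have h3 := hjq (j + 1)
          calc C * q ^ (j + 1 + 1) * ((j + 1 + 1).factorial : ℝ)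
              = C * q * (q ^ (j + 1) * ((j + 1 + 1 : ℕ) : ℝ)) * (j + 1).factorial := by
                rw [Nat.factorial_succ (j + 1)]; push_cast; ring
            _ ≤ C * q * (2 * q) ^ (j + 1) * (j + 1).factorial := by
                gcongr
                rw [mul_pow, mul_comm]
                gcongr
                exact_mod_cast Nat.lt_two_pow_self)
        (hγ w (hrV hw)) (hγU w (hrV hw)) ht
      rw [hγ0 w (hrV hw)] at h2
      simp only [zero_add] at h2
      rw [hG1 _ (hγU w (hrV hw) t ht)] at h2
      exact h2.tsum_eq.symm
    · refine ⟨C' / (r / 2), fun j => ?_⟩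
      have hsub : closedBall z (r / 2) ⊆ ball z r := closedBall_subset_ball (by linarith)
      have := norm_fderiv_le hU (hG j) (half_pos hr) (hsub.trans hrU)
        fun w hw => hb' j w (hsub hw)
      refine this.trans (le_of_eq ?_)
      ring
  refine ⟨fun z hz => ((main z hz).1 1 (by simp)).differentiableAt.differentiableWithinAt, ?_⟩
  intro z hz a b
  obtain ⟨h1, h2, C', hC'⟩ := main z hz
  set M : ℝ → E →L[ℂ] E := fun t => ∑' j : ℕ, (t ^ j / (j.factorial : ℝ)) • fderiv ℂ (G j) z
    with hM
  -- The variational equation. Differentiating the series of M in t gives the series of the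
  -- derivative of the field along the flow, which the chain rule identifies as DX composed with M.
  have hMd : ∀ t ∈ Icc (0 : ℝ) 1, HasDerivAt M ((fderiv ℂ X (γ z t)).comp (M t)) t := by
    intro t ht
    have h3 := hasDerivAt_exponentialSeries (D := fun j => fderiv ℂ (G j) z) hq0 hq hC'
      (t := t) ⟨by linarith [ht.1], by linarith [ht.2]⟩
    refine h3.congr_deriv ?_
    have h4 : HasFDerivAt X (fderiv ℂ X (γ z t)) (γ z t) :=
      (hX.differentiableAt (hU.mem_nhds (hγU z hz t ht))).hasFDerivAt
    exact (h2 t ht).unique (h4.comp z (h1 t ht))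
  have hM0 : M 0 = ContinuousLinearMap.id ℂ E := by
    have h5 : HasFDerivAt (fun w => γ w 0) (ContinuousLinearMap.id ℂ E) z := by
      refine (hasFDerivAt_id z).congr_of_eventuallyEq ?_
      filter_upwards [hV.mem_nhds hz] with w hw using hγ0 w hw
    exact (h1 0 (by simp)).unique h5
  have happ : ∀ v, ∀ t ∈ Icc (0 : ℝ) 1, HasDerivAt (fun t => M t v)
      (fderiv ℂ X (γ z t) (M t v)) t := by
    intro v t ht
    have := ((ContinuousLinearMap.apply ℂ E v).restrictScalars ℝ).hasFDerivAt.comp_hasDerivAt t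
      (hMd t ht)
    exact this
  have hconst : ∀ t ∈ Icc (0 : ℝ) 1, B (M t a) (M t b) = B (M 0 a) (M 0 b) := by
    have hd : ∀ t ∈ Icc (0 : ℝ) 1, HasDerivAt (fun t => B (M t a) (M t b)) 0 t := by
      intro t ht
      have h6 : HasDerivAt (fun t => B (M t a)) (B (fderiv ℂ X (γ z t) (M t a))) t :=
        (B.restrictScalars ℝ).hasFDerivAt.comp_hasDerivAt t (happ a t ht)
      have h7 := HasDerivAt.clm_apply
        (c := fun t => (B (M t a)).restrictScalars ℝ)
        (c' := (B (fderiv ℂ X (γ z t) (M t a))).restrictScalars ℝ)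
        (((ContinuousLinearMap.restrictScalarsL ℂ E ℂ ℝ ℝ)).hasFDerivAt.comp_hasDerivAt t h6)
        (happ b t ht)
      refine h7.congr_deriv ?_
      simpa using hB (γ z t) (hγU z hz t ht) (M t a) (M t b)
    exact constant_of_has_deriv_right_zero
      (fun t ht => (hd t ht).continuousAt.continuousWithinAt)
      (fun t ht => (hd t ⟨ht.1, ht.2.le⟩).hasDerivWithinAt)
  have h8 := hconst 1 (by simp)
  rw [hM0] at h8
  rw [(h1 1 (by simp)).fderiv]
  exact h8

end SymplecticFlow

end Averaging
end

noncomputable section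

namespace Averaging

open Metric Set Filter Topology

/-! ### Families of Fourier coefficients -/

section Families

variable {n : ℕ} {F : Type*} [NormedAddCommGroup F]

/-- An integer vector as a vector of `ℂⁿ`. -/
def ivec (k : Fin n → ℤ) : CVec n := WithLp.toLp 2 (fun j => (k j : ℂ))

@[simp] theorem ivec_apply (k : Fin n → ℤ) (j : Fin n) : ivec k j = (k j : ℂ) := rfl

theorem ivec_neg (k : Fin n → ℤ) : ivec (-k) = -ivec k := by
  ext j; simp

theorem norm1_nonneg (k : Fin n → ℤ) : 0 ≤ norm1 k := Finset.sum_nonneg fun _ _ => abs_nonneg _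

theorem norm1_add_le (k l : Fin n → ℤ) : norm1 (k + l) ≤ norm1 k + norm1 l := by
  rw [norm1, norm1, norm1, ← Finset.sum_add_distrib]
  refine Finset.sum_le_sum fun j _ => ?_
  push_cast [Pi.add_apply]
  exact abs_add_le _ _

theorem norm1_neg (k : Fin n → ℤ) : norm1 (-k) = norm1 k := by
  simp [norm1]

theorem norm1_zero : norm1 (0 : Fin n → ℤ) = 0 := by simp [norm1]

theorem norm_ivec_le (k : Fin n → ℤ) : ‖ivec k‖ ≤ norm1 k := by
  have : ivec k = ∑ j, EuclideanSpace.single j (k j : ℂ) := by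
    ext i; simp
  rw [this]
  refine (norm_sum_le _ _).trans (le_of_eq ?_)
  simp [norm1]

/-- The family `c` is bounded by `C` in the weighted `ℓ¹`-norm, uniformly on `U`. -/
def FamBound (c : (Fin n → ℤ) → CVec n → F) (U : Set (CVec n)) (σ C : ℝ) : Prop :=
  ∀ y ∈ U, ∀ s : Finset (Fin n → ℤ), ∑ k ∈ s, ‖c k y‖ * Real.exp (norm1 k * σ) ≤ C

theorem FamBound.mono {c : (Fin n → ℤ) → CVec n → F} {U V : Set (CVec n)} {σ σ' C C' : ℝ}
    (h : FamBound c U σ C) (hVU : V ⊆ U) (hσ : σ' ≤ σ) (hC : C ≤ C') : FamBound c V σ' C' := by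
  intro y hy s
  refine le_trans (Finset.sum_le_sum fun k _ => ?_) ((h y (hVU hy) s).trans hC)
  have := norm1_nonneg k
  gcongr

theorem FamBound.of_le {F' : Type*} [NormedAddCommGroup F']
    {c : (Fin n → ℤ) → CVec n → F} {d : (Fin n → ℤ) → CVec n → F'}
    {U : Set (CVec n)} {σ C : ℝ} (h : FamBound c U σ C)
    (hd : ∀ k, ∀ y ∈ U, ‖d k y‖ ≤ ‖c k y‖) : FamBound d U σ C := by
  intro y hy s
  refine le_trans (Finset.sum_le_sum fun k _ => ?_) (h y hy s)
  gcongr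
  exact hd k y hy

theorem FamBound.add {c d : (Fin n → ℤ) → CVec n → F} {U : Set (CVec n)} {σ C C' : ℝ}
    (hc : FamBound c U σ C) (hd : FamBound d U σ C') :
    FamBound (fun k y => c k y + d k y) U σ (C + C') := by
  intro y hy s
  refine le_trans ?_ (add_le_add (hc y hy s) (hd y hy s))
  rw [← Finset.sum_add_distrib]
  refine Finset.sum_le_sum fun k _ => ?_
  rw [← add_mul]
  gcongr
  exact norm_add_le _ _

theorem FamBound.nonneg {c : (Fin n → ℤ) → CVec n → F} {U : Set (CVec n)} {σ C : ℝ}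
    (h : FamBound c U σ C) {y : CVec n} (hy : y ∈ U) : 0 ≤ C := by simpa using h y hy ∅

theorem FamBound.single {c : (Fin n → ℤ) → CVec n → F} {U : Set (CVec n)} {σ C : ℝ}
    (h : FamBound c U σ C) {y : CVec n} (hy : y ∈ U) (k : Fin n → ℤ) :
    ‖c k y‖ * Real.exp (norm1 k * σ) ≤ C := by simpa using h y hy {k}

theorem FamBound.summable {c : (Fin n → ℤ) → CVec n → F} {U : Set (CVec n)} {σ C : ℝ}
    (h : FamBound c U σ C) {y : CVec n} (hy : y ∈ U) :
    Summable fun k => ‖c k y‖ * Real.exp (norm1 k * σ) :=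
  summable_of_sum_le (fun _ => by positivity) (h y hy)

/-- This is 1 + u ≤ e^u at u = aτ - 1; the maximum in a is attained at 1/τ. -/
theorem mul_exp_neg_le {a τ : ℝ} (hτ : 0 < τ) :
    a * Real.exp (-(a * τ)) ≤ 1 / (Real.exp 1 * τ) := by
  have h1 := Real.add_one_le_exp (a * τ - 1)
  rw [le_div_iff₀ (by positivity)]
  have h2 : Real.exp (a * τ - 1) * (Real.exp (-(a * τ)) * Real.exp 1) = 1 := by
    rw [← Real.exp_add, ← Real.exp_add]; simp
  calc a * Real.exp (-(a * τ)) * (Real.exp 1 * τ)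
      = (a * τ) * (Real.exp (-(a * τ)) * Real.exp 1) := by ring
    _ ≤ Real.exp (a * τ - 1) * (Real.exp (-(a * τ)) * Real.exp 1) := by
        gcongr; linarith
    _ = 1 := h2

/-- Loss of analyticity in the angles. -/
theorem FamBound.weighted {c : (Fin n → ℤ) → CVec n → F} {U : Set (CVec n)} {σ σ' τ C : ℝ}
    (h : FamBound c U σ C) (hτ : 0 < τ) (hσ : σ' + τ ≤ σ) {y : CVec n} (hy : y ∈ U)
    (s : Finset (Fin n → ℤ)) :
    ∑ k ∈ s, norm1 k * (‖c k y‖ * Real.exp (norm1 k * σ')) ≤ C / (Real.exp 1 * τ) := by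
  have h1 : ∀ k ∈ s, norm1 k * (‖c k y‖ * Real.exp (norm1 k * σ')) ≤
      (‖c k y‖ * Real.exp (norm1 k * σ)) * (1 / (Real.exp 1 * τ)) := by
    intro k _
    have h2 := mul_exp_neg_le (a := norm1 k) hτ
    have hk := norm1_nonneg k
    have h3 : Real.exp (norm1 k * σ') ≤ Real.exp (norm1 k * σ) * Real.exp (-(norm1 k * τ)) := by
      rw [← Real.exp_add]
      gcongr
      nlinarith
    calc norm1 k * (‖c k y‖ * Real.exp (norm1 k * σ'))
        ≤ norm1 k * (‖c k y‖ * (Real.exp (norm1 k * σ) * Real.exp (-(norm1 k * τ)))) := by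
          gcongr
      _ = (‖c k y‖ * Real.exp (norm1 k * σ)) * (norm1 k * Real.exp (-(norm1 k * τ))) := by ring
      _ ≤ _ := by gcongr
  refine (Finset.sum_le_sum h1).trans ?_
  rw [← Finset.sum_mul, div_eq_mul_one_div C]
  gcongr
  exact h y hy s

variable [NormedSpace ℂ F]

/-- All members of the family are holomorphic on `U`. -/
def FamHol (c : (Fin n → ℤ) → CVec n → F) (U : Set (CVec n)) : Prop :=
  ∀ k, DifferentiableOn ℂ (c k) U

theorem FamHol.mono {c : (Fin n → ℤ) → CVec n → F} {U V : Set (CVec n)} (h : FamHol c U)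
    (hVU : V ⊆ U) : FamHol c V := fun k => (h k).mono hVU

/-- Cauchy estimate for families, in the `ℓ¹`-norm. -/
theorem FamBound.norm_fderiv {c : (Fin n → ℤ) → CVec n → F} {U : Set (CVec n)} {σ C δ : ℝ}
    (h : FamBound c U σ C) (hU : IsOpen U) (hc : FamHol c U) (hδ : 0 < δ) {y : CVec n}
    (hy : closedBall y δ ⊆ U) (v : CVec n) (s : Finset (Fin n → ℤ)) :
    ∑ k ∈ s, ‖fderiv ℂ (c k) y v‖ * Real.exp (norm1 k * σ) ≤ C * ‖v‖ / δ := by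
  -- The weighted finite family is one holomorphic map into an ℓ¹-space, so a single Cauchy estimate
  -- controls the whole sum, with no loss in the number of modes.
  let g : CVec n → PiLp 1 (fun _ : s => F) := fun z =>
    WithLp.toLp 1 (fun k : s => ((Real.exp (norm1 (k : Fin n → ℤ) * σ) : ℝ) : ℂ) • c k z)
  have hg : DifferentiableOn ℂ g U := by
    rw [differentiableOn_piLp]
    intro k
    exact (hc k).const_smul _
  have hnorm : ∀ z, ‖g z‖ = ∑ k ∈ s, ‖c k z‖ * Real.exp (norm1 k * σ) := by
    intro z
    rw [PiLp.norm_eq_of_L1, ← Finset.sum_coe_sort s (fun k => ‖c k z‖ * Real.exp (norm1 k * σ))]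
    refine Finset.sum_congr rfl fun k _ => ?_
    simp only [g, norm_smul, Complex.norm_real, Real.norm_of_nonneg (Real.exp_pos _).le]
    ring
  have hyU : y ∈ U := hy (mem_closedBall_self hδ.le)
  have hcomp : ∀ k : s, (fderiv ℂ g y v) k =
      ((Real.exp (norm1 (k : Fin n → ℤ) * σ) : ℝ) : ℂ) • fderiv ℂ (c k) y v := by
    intro k
    have h1 := (hg.differentiableAt (hU.mem_nhds hyU)).hasFDerivAt
    have h2 : HasFDerivAt (fun z => g z k) ((PiLp.proj (𝕜 := ℂ) 1 (fun _ : s => F) k) ∘L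
        fderiv ℂ g y) y :=
      (PiLp.proj (𝕜 := ℂ) 1 (fun _ : s => F) k).hasFDerivAt.comp y h1
    have h3 : HasFDerivAt (fun z => g z k)
        (((Real.exp (norm1 (k : Fin n → ℤ) * σ) : ℝ) : ℂ) • fderiv ℂ (c k) y) y :=
      ((hc k).differentiableAt (hU.mem_nhds hyU)).hasFDerivAt.const_smul _
    have := congrArg (fun L => L v) (h2.unique h3)
    simpa using this
  have key := norm_fderiv_apply_le hU hg hδ hy (C := C)
    (fun z hz => by rw [hnorm]; exact h z (hy hz) s) v
  rw [PiLp.norm_eq_of_L1] at key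
  rw [← Finset.sum_coe_sort s (fun k => ‖fderiv ℂ (c k) y v‖ * Real.exp (norm1 k * σ))]
  refine le_trans (le_of_eq (Finset.sum_congr rfl fun k _ => ?_)) key
  rw [hcomp, norm_smul, Complex.norm_real, Real.norm_of_nonneg (Real.exp_pos _).le, mul_comm]

/-- The Poisson bracket `{c, χ}` at the level of Fourier coefficients, for `χ` with modes in the
finite set `B`. -/
def lieFam (B : Finset (Fin n → ℤ)) (χ : (Fin n → ℤ) → CVec n → ℂ)
    (c : (Fin n → ℤ) → CVec n → F) : (Fin n → ℤ) → CVec n → F := fun m y =>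
  ∑ l ∈ B, Complex.I • (fderiv ℂ (χ l) y (ivec (m - l)) • c (m - l) y -
    χ l y • fderiv ℂ (c (m - l)) y (ivec l))

theorem famHol_lieFam [FiniteDimensional ℂ F] [CompleteSpace F] {B : Finset (Fin n → ℤ)}
    {χ : (Fin n → ℤ) → CVec n → ℂ} {c : (Fin n → ℤ) → CVec n → F} {U : Set (CVec n)}
    (hU : IsOpen U) (hχ : FamHol χ U) (hc : FamHol c U) : FamHol (lieFam B χ c) U := by
  intro m
  refine DifferentiableOn.fun_sum fun l _ => DifferentiableOn.const_smul (DifferentiableOn.sub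
    (DifferentiableOn.smul ?_ (hc _)) (DifferentiableOn.smul (hχ l) ?_)) _
  · exact differentiableOn_fderiv_apply hU (hχ l) _
  · exact differentiableOn_fderiv_apply hU (hc _) _

/-- The enlarged index set does not depend on l. This decouples the two sums of the convolution in
`famBound_lieFam`. -/
theorem sum_sub_le {G : Type*} [AddGroup G] [DecidableEq G] {s B : Finset G} {l : G}
    (hl : l ∈ B) {g : G → ℝ} (hg : ∀ k, 0 ≤ g k) :
    ∑ m ∈ s, g (m - l) ≤ ∑ k ∈ (s ×ˢ B).image (fun p => p.1 - p.2), g k := by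
  rw [← Finset.sum_image (s := s) (g := fun m => m - l) (f := g)
    (fun a _ b _ hab => sub_left_injective hab)]
  refine Finset.sum_le_sum_of_subset_of_nonneg ?_ fun k _ _ => hg k
  intro k hk
  obtain ⟨m, hm, rfl⟩ := Finset.mem_image.1 hk
  exact Finset.mem_image.2 ⟨(m, l), Finset.mk_mem_product hm hl, rfl⟩

/-- Estimate of the Poisson bracket. -/
theorem famBound_lieFam {B : Finset (Fin n → ℤ)}
    {χ : (Fin n → ℤ) → CVec n → ℂ} {c : (Fin n → ℤ) → CVec n → F} {U V W : Set (CVec n)}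
    {σ σ₂ σ' C M δ δ' τ τ' : ℝ} (hc : FamBound c U σ C) (hχ : FamBound χ V σ₂ M)
    (hU : IsOpen U) (hV : IsOpen V) (hcU : FamHol c U) (hχV : FamHol χ V)
    (hδ : 0 < δ) (hδ' : 0 < δ') (hτ : 0 < τ) (hτ' : 0 < τ') (hσ0 : 0 ≤ σ')
    (hWU : ∀ y ∈ W, closedBall y δ ⊆ U) (hWV : ∀ y ∈ W, closedBall y δ' ⊆ V)
    (hσ : σ' + τ ≤ σ) (hσ₂ : σ' + τ' ≤ σ₂) :
    FamBound (lieFam B χ c) W σ'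
      (C * M * (1 / (Real.exp 1 * τ * δ') + 1 / (Real.exp 1 * τ' * δ))) := by
  classical
  intro y hy s
  have hyU : y ∈ U := hWU y hy (mem_closedBall_self hδ.le)
  have hyV : y ∈ V := hWV y hy (mem_closedBall_self hδ'.le)
  have hC0 := hc.nonneg hyU
  have hM0 := hχ.nonneg hyV
  set T := (s ×ˢ B).image (fun p => p.1 - p.2) with hT
  have hc' : FamBound c U σ' C := hc.mono subset_rfl (by linarith) le_rfl
  have hχ' : FamBound χ V σ' M := hχ.mono subset_rfl (by linarith) le_rfl
  set e : (Fin n → ℤ) → ℝ := fun k => Real.exp (norm1 k * σ') with he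
  have he0 : ∀ k, 0 < e k := fun k => Real.exp_pos _
  -- Majorant of the contribution of modes l and k = m - l; the weight of m is at most the product
  -- of their weights, as |m|₁ ≤ |l|₁ + |k|₁.
  set g : (Fin n → ℤ) → (Fin n → ℤ) → ℝ := fun l k =>
    (‖fderiv ℂ (χ l) y (ivec k)‖ * e l) * (‖c k y‖ * e k) +
      (‖χ l y‖ * e l) * (‖fderiv ℂ (c k) y (ivec l)‖ * e k) with hg
  have hg0 : ∀ l k, 0 ≤ g l k := fun l k => by
    have := (he0 l).le; have := (he0 k).le; positivity
  have hpt : ∀ m, ‖lieFam B χ c m y‖ * e m ≤ ∑ l ∈ B, g l (m - l) := by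
    intro m
    rw [lieFam]
    refine (mul_le_mul_of_nonneg_right (norm_sum_le _ _) (he0 m).le).trans ?_
    rw [Finset.sum_mul]
    refine Finset.sum_le_sum fun l _ => ?_
    have h1 : e m ≤ e l * e (m - l) := by
      simp only [he, ← Real.exp_add]
      gcongr
      have := norm1_add_le l (m - l)
      rw [add_sub_cancel] at this
      nlinarith
    rw [norm_smul, Complex.norm_I, one_mul]
    calc _ ≤ (‖fderiv ℂ (χ l) y (ivec (m - l))‖ * ‖c (m - l) y‖ +
          ‖χ l y‖ * ‖fderiv ℂ (c (m - l)) y (ivec l)‖) * (e l * e (m - l)) := by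
          gcongr
          refine (norm_sub_le _ _).trans ?_
          rw [norm_smul, norm_smul]
      _ = g l (m - l) := by rw [hg]; ring
  calc ∑ m ∈ s, ‖lieFam B χ c m y‖ * e m ≤ ∑ m ∈ s, ∑ l ∈ B, g l (m - l) :=
        Finset.sum_le_sum fun m _ => hpt m
    _ = ∑ l ∈ B, ∑ m ∈ s, g l (m - l) := Finset.sum_comm
    _ ≤ ∑ l ∈ B, ∑ k ∈ T, g l k := Finset.sum_le_sum fun l hl => sum_sub_le hl (hg0 l)
    _ = ∑ k ∈ T, (∑ l ∈ B, ‖fderiv ℂ (χ l) y (ivec k)‖ * e l) * (‖c k y‖ * e k) +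
        ∑ l ∈ B, (‖χ l y‖ * e l) * ∑ k ∈ T, ‖fderiv ℂ (c k) y (ivec l)‖ * e k := by
        simp only [hg, Finset.sum_add_distrib, Finset.sum_mul, Finset.mul_sum]
        rw [Finset.sum_comm]
    -- Each y-derivative is estimated by Cauchy on a full ℓ¹-sum and leaves a factor |k|₁ or |l|₁,
    -- which the next step pays with the loss τ or τ' of the strip.
    _ ≤ ∑ k ∈ T, (M / δ') * (norm1 k * (‖c k y‖ * e k)) +
        ∑ l ∈ B, (C / δ) * (norm1 l * (‖χ l y‖ * e l)) := by
        refine add_le_add (Finset.sum_le_sum fun k _ => ?_) (Finset.sum_le_sum fun l _ => ?_)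
        · have h1 := hχ'.norm_fderiv hV hχV hδ' (hWV y hy) (ivec k) B
          have h2 := norm_ivec_le k
          have := (he0 k).le
          calc _ ≤ (M * ‖ivec k‖ / δ') * (‖c k y‖ * e k) := by gcongr
            _ ≤ (M * norm1 k / δ') * (‖c k y‖ * e k) := by gcongr
            _ = _ := by ring
        · have h1 := hc'.norm_fderiv hU hcU hδ (hWU y hy) (ivec l) T
          have h2 := norm_ivec_le l
          have := (he0 l).le
          calc _ ≤ (‖χ l y‖ * e l) * (C * ‖ivec l‖ / δ) := by gcongr
            _ ≤ (‖χ l y‖ * e l) * (C * norm1 l / δ) := by gcongr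
            _ = _ := by ring
    _ ≤ (M / δ') * (C / (Real.exp 1 * τ)) + (C / δ) * (M / (Real.exp 1 * τ')) := by
        rw [← Finset.mul_sum, ← Finset.mul_sum]
        gcongr
        · exact hc.weighted hτ hσ hyU T
        · exact hχ.weighted hτ' hσ₂ hyV B
    _ = _ := by field_simp

theorem isOpen_nbhd (D : Set (RVec n)) (r : ℝ) : IsOpen (nbhd D r) := by
  have : nbhd D r = ⋃ y ∈ D, ball (toC y) r := by
    ext z; simp [nbhd, dist_eq_norm]
  rw [this]
  exact isOpen_biUnion fun _ _ => isOpen_ball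

theorem closedBall_subset_nbhd {D : Set (RVec n)} {r r' δ : ℝ} (h : r' + δ ≤ r) {y : CVec n}
    (hy : y ∈ nbhd D r') : closedBall y δ ⊆ nbhd D r := by
  obtain ⟨y₀, hy₀, h1⟩ := hy
  intro z hz
  rw [mem_closedBall, dist_eq_norm] at hz
  refine ⟨y₀, hy₀, ?_⟩
  have := norm_sub_le_norm_sub_add_norm_sub z y (toC y₀)
  linarith

theorem nbhd_mono {D : Set (RVec n)} {r r' : ℝ} (h : r' ≤ r) : nbhd D r' ⊆ nbhd D r :=
  fun _ ⟨y₀, hy₀, h1⟩ => ⟨y₀, hy₀, h1.trans_le h⟩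

/-- One term of the exponential series of e^j. It converts the cost j^j/e^j of splitting the
analyticity loss into j parts into the j! cancelled by the Lie series. -/
theorem pow_le_exp_pow_mul_factorial (j : ℕ) : (j : ℝ) ^ j ≤ Real.exp 1 ^ j * j.factorial := by
  have := Real.pow_div_factorial_le_exp (j : ℝ) (Nat.cast_nonneg j) j
  rw [div_le_iff₀ (by positivity)] at this
  rwa [← Real.exp_nat_mul, mul_one]

theorem famHol_iterate [FiniteDimensional ℂ F] [CompleteSpace F] {B : Finset (Fin n → ℤ)}
    {χ : (Fin n → ℤ) → CVec n → ℂ} {c : (Fin n → ℤ) → CVec n → F} {U : Set (CVec n)}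
    (hU : IsOpen U) (hχ : FamHol χ U) (hc : FamHol c U) (j : ℕ) :
    FamHol ((lieFam B χ)^[j] c) U := by
  induction j with
  | zero => exact hc
  | succ j ih => rw [Function.iterate_succ_apply']; exact famHol_lieFam hU hχ ih

/-- Estimate of the iterated Poisson brackets. -/
theorem famBound_iterate [FiniteDimensional ℂ F] [CompleteSpace F] {B : Finset (Fin n → ℤ)}
    {χ : (Fin n → ℤ) → CVec n → ℂ} {c : (Fin n → ℤ) → CVec n → F} {D : Set (RVec n)}
    {ρ σ δ τ C M q : ℝ} (hδ : 0 < δ) (hτ : 0 < τ) (hσ : 2 * τ ≤ σ)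
    (hχ : FamBound χ (nbhd D ρ) σ M) (hχ' : FamHol χ (nbhd D ρ))
    (hc : FamBound c (nbhd D (ρ - δ)) (σ - τ) C) (hc' : FamHol c (nbhd D (ρ - δ)))
    (hM0 : 0 ≤ M) (hq : 2 * M / (δ * τ) ≤ q) (j : ℕ) :
    FamBound ((lieFam B χ)^[j] c) (nbhd D (ρ - 2 * δ)) (σ - 2 * τ)
      (C * q ^ j * j.factorial) := by
  by_cases hne : (nbhd D (ρ - 2 * δ)).Nonempty
  swap
  · intro y hy; exact absurd ⟨y, hy⟩ hne
  have hC0 : 0 ≤ C := by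
    obtain ⟨y, hy⟩ := hne
    exact hc.nonneg (nbhd_mono (by linarith) hy)
  rcases Nat.eq_zero_or_pos j with rfl | hj
  · simpa using hc.mono (nbhd_mono (by linarith)) (by linarith) le_rfl
  have hjr : (0 : ℝ) < j := by exact_mod_cast hj
  have hsub : nbhd D (ρ - δ) ⊆ nbhd D ρ := nbhd_mono (by linarith)
  have hhol := fun i => famHol_iterate (B := B) (isOpen_nbhd D (ρ - δ)) (hχ'.mono hsub) hc' i
  -- The losses δ and τ are divided equally among the j brackets. Since c starts at distance δ, τ
  -- inside the domain of χ, the estimates of χ always have the full δ, τ at their disposal, and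
  -- each bracket costs 2jM/(eδτ).
  have key : ∀ i : ℕ, i ≤ j → FamBound ((lieFam B χ)^[i] c)
      (nbhd D (ρ - δ - i * (δ / j))) (σ - τ - i * (τ / j))
      (C * (2 * j * M / (Real.exp 1 * (δ * τ))) ^ i) := by
    intro i
    induction i with
    | zero => intro _; simpa using hc
    | succ i ih =>
      intro hi
      have ih' := ih (by omega)
      rw [Function.iterate_succ_apply']
      have hij : ((i : ℝ) + 1) / j ≤ 1 := by
        rw [div_le_one hjr]; exact_mod_cast hi
      have h1 : ((i + 1 : ℕ) : ℝ) * (τ / j) ≤ τ := by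
        push_cast
        calc ((i : ℝ) + 1) * (τ / j) = ((i : ℝ) + 1) / j * τ := by ring
          _ ≤ 1 * τ := by gcongr
          _ = τ := one_mul τ
      have h2 : (0 : ℝ) ≤ ((i + 1 : ℕ) : ℝ) * (δ / j) := by positivity
      have h2' : (0 : ℝ) ≤ (i : ℝ) * (δ / j) := by positivity
      have h3 : (0 : ℝ) ≤ ((i + 1 : ℕ) : ℝ) * (τ / j) := by positivity
      have := famBound_lieFam (B := B) (W := nbhd D (ρ - δ - ((i + 1 : ℕ) : ℝ) * (δ / j)))
        (σ' := σ - τ - ((i + 1 : ℕ) : ℝ) * (τ / j)) ih' hχ (isOpen_nbhd _ _) (isOpen_nbhd _ _)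
        ((hhol i).mono (nbhd_mono (by linarith))) hχ'
        (δ := δ / j) (δ' := δ) (τ := τ / j) (τ' := τ)
        (by positivity) hδ (by positivity) hτ (by linarith)
        (fun y hy => closedBall_subset_nbhd (by push_cast; linarith) hy)
        (fun y hy => closedBall_subset_nbhd (by linarith) hy) (by push_cast; linarith)
        (by linarith)
      refine this.mono subset_rfl le_rfl (le_of_eq ?_)
      rw [pow_succ]
      field_simp
      ring
  have h1 := key j le_rfl
  refine h1.mono (nbhd_mono (by field_simp; linarith)) (by field_simp; linarith) ?_
  rw [mul_assoc C]
  refine mul_le_mul_of_nonneg_left ?_ hC0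
  have h2 := pow_le_exp_pow_mul_factorial j
  have h3 : (2 * M / (δ * τ)) ^ j ≤ q ^ j := by gcongr
  calc (2 * j * M / (Real.exp 1 * (δ * τ))) ^ j
      = (2 * M / (δ * τ)) ^ j * ((j : ℝ) ^ j / Real.exp 1 ^ j) := by
        rw [← div_pow, ← mul_pow]; congr 1; field_simp
    _ ≤ q ^ j * j.factorial := by
        refine mul_le_mul h3 ?_ (by positivity) (by have : 0 ≤ q := le_trans (by positivity) hq
                                                    positivity)
        rw [div_le_iff₀ (by positivity), mul_comm]
        exact h2

end Families

end Averaging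
end

noncomputable section

namespace Averaging

open Metric Set Filter Topology

/-! ### Exponential sums over `ℤⁿ` -/

section ExpSums

variable {n : ℕ}

theorem summable_exp_abs {t : ℝ} (ht : 0 < t) :
    Summable fun k : ℤ => Real.exp (-(|(k : ℝ)| * t)) := by
  have h : Summable fun m : ℕ => Real.exp (-((m : ℝ) * t)) := by
    refine (Real.summable_exp_nat_mul_iff.2 (neg_lt_zero.2 ht)).congr fun m => ?_
    congr 1; ring
  refine Summable.of_nat_of_neg ?_ ?_ <;> simpa using h

theorem exp_norm1_eq_prod (k : Fin n → ℤ) (t : ℝ) :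
    Real.exp (-(norm1 k * t)) = ∏ j, Real.exp (-(|(k j : ℝ)| * t)) := by
  rw [← Real.exp_sum, norm1, Finset.sum_mul, Finset.sum_neg_distrib]

/-- A finite set lies in a product of finite sets of integers, over which the exponential of |k|₁
factorizes into n one-dimensional sums. -/
theorem sum_exp_norm1_le {t : ℝ} (ht : 0 < t) (s : Finset (Fin n → ℤ)) :
    ∑ k ∈ s, Real.exp (-(norm1 k * t)) ≤ (∑' k : ℤ, Real.exp (-(|(k : ℝ)| * t))) ^ n := by
  classical
  have hs : s ⊆ Fintype.piFinset fun j => s.image fun k : Fin n → ℤ => k j := by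
    intro k hk
    rw [Fintype.mem_piFinset]
    exact fun j => Finset.mem_image_of_mem _ hk
  calc ∑ k ∈ s, Real.exp (-(norm1 k * t))
      ≤ ∑ k ∈ Fintype.piFinset fun j => s.image fun k : Fin n → ℤ => k j,
          ∏ j, Real.exp (-(|(k j : ℝ)| * t)) := by
        simp only [exp_norm1_eq_prod]
        exact Finset.sum_le_sum_of_subset_of_nonneg hs fun _ _ _ => by positivity
    _ = ∏ j : Fin n, ∑ m ∈ s.image (fun k : Fin n → ℤ => k j), Real.exp (-(|(m : ℝ)| * t)) :=
        (Finset.prod_univ_sum (fun j => s.image fun k : Fin n → ℤ => k j)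
          (fun _ m => Real.exp (-(|(m : ℝ)| * t)))).symm
    _ ≤ ∏ _j : Fin n, ∑' k : ℤ, Real.exp (-(|(k : ℝ)| * t)) := by
        refine Finset.prod_le_prod (fun _ _ => by positivity) fun j _ => ?_
        exact (summable_exp_abs ht).sum_le_tsum _ fun _ _ => by positivity
    _ = _ := by simp

theorem summable_exp_norm1 {t : ℝ} (ht : 0 < t) :
    Summable fun k : Fin n → ℤ => Real.exp (-(norm1 k * t)) :=
  summable_of_sum_le (fun _ => (Real.exp_pos _).le) (sum_exp_norm1_le ht)

end ExpSums

/-! ### Functions defined by families of Fourier coefficients -/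

section EvalFam

variable {n : ℕ} {F : Type*} [NormedAddCommGroup F] [NormedSpace ℂ F]

/-- The character `e^{i k·x}`. -/
def expK (k : Fin n → ℤ) (x : CVec n) : ℂ := Complex.exp (Complex.I * ∑ j, (k j : ℂ) * x j)

/-- The linear form `x ↦ k·x`. -/
def kdot (k : Fin n → ℤ) : CVec n →L[ℂ] ℂ :=
  ∑ j, (k j : ℂ) • (EuclideanSpace.proj j : CVec n →L[ℂ] ℂ)

theorem kdot_apply (k : Fin n → ℤ) (x : CVec n) : kdot k x = ∑ j, (k j : ℂ) * x j := by
  simp [kdot]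

theorem expK_eq (k : Fin n → ℤ) (x : CVec n) : expK k x = Complex.exp (Complex.I * kdot k x) := by
  rw [expK, kdot_apply]

theorem expK_add (k l : Fin n → ℤ) (x : CVec n) : expK (k + l) x = expK k x * expK l x := by
  simp only [expK, ← Complex.exp_add, ← mul_add, ← Finset.sum_add_distrib, Pi.add_apply,
    Int.cast_add, add_mul]

theorem expK_zero (x : CVec n) : expK 0 x = 1 := by simp [expK]

theorem expK_add_period (k : Fin n → ℤ) (x : CVec n) (m : Fin n → ℤ) :
    expK k (x + period m) = expK k x := by
  have : Complex.I * ∑ j, (k j : ℂ) * (x + period m) j =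
      Complex.I * ∑ j, (k j : ℂ) * x j +
        ((∑ j, k j * m j : ℤ) : ℂ) * (2 * Real.pi * Complex.I) := by
    simp only [period, PiLp.add_apply, mul_add, Finset.sum_add_distrib, Int.cast_sum,
      Finset.sum_mul, Finset.mul_sum]
    congr 1
    refine Finset.sum_congr rfl fun j _ => ?_
    push_cast; ring
  rw [expK, expK, this, Complex.exp_add, Complex.exp_int_mul_two_pi_mul_I, mul_one]

theorem norm_expK (k : Fin n → ℤ) (x : CVec n) :
    ‖expK k x‖ = Real.exp (-∑ j, (k j : ℝ) * (x j).im) := by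
  rw [expK, Complex.norm_exp]
  simp [Complex.mul_re, Complex.mul_im]

theorem norm_expK_le {k : Fin n → ℤ} {x : CVec n} {σ : ℝ} (hx : ∀ j, |(x j).im| ≤ σ) :
    ‖expK k x‖ ≤ Real.exp (norm1 k * σ) := by
  rw [norm_expK, norm1, Finset.sum_mul, ← Finset.sum_neg_distrib]
  gcongr with j
  calc -((k j : ℝ) * (x j).im) ≤ |(k j : ℝ) * (x j).im| := neg_le_abs _
    _ = |(k j : ℝ)| * |(x j).im| := abs_mul _ _
    _ ≤ _ := by gcongr; exact hx j

theorem hasFDerivAt_expK (k : Fin n → ℤ) (x : CVec n) :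
    HasFDerivAt (expK k) ((expK k x * Complex.I) • kdot k) x := by
  have h1 : HasFDerivAt (fun x => Complex.I * kdot k x) (Complex.I • kdot k) x :=
    (kdot k).hasFDerivAt.const_mul Complex.I
  have h2 := h1.cexp
  simp only [← expK_eq] at h2
  rw [smul_smul] at h2
  exact h2

/-- The function `∑_k c_k(y) e^{i k·x}`. -/
def evalFam (c : (Fin n → ℤ) → CVec n → F) (z : CVec n × CVec n) : F :=
  ∑' k, expK k z.2 • c k z.1

theorem isOpen_strip (s : ℝ) : IsOpen (strip n s) := by
  have : strip n s = ⋂ j, {x : CVec n | |(x j).im| < s} := by ext; simp [strip]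
  rw [this]
  refine isOpen_iInter_of_finite fun j => isOpen_lt ?_ continuous_const
  fun_prop

theorem strip_mono {s t : ℝ} (h : s ≤ t) : strip n s ⊆ strip n t :=
  fun _ hx j => (hx j).trans_le h

theorem exists_mem_strip_sub {s : ℝ} {x : CVec n} (hx : x ∈ strip n s) :
    ∃ τ > 0, x ∈ strip n (s - τ) := by
  have h : ∀ j, ∀ᶠ τ : ℝ in 𝓝[>] 0, |(x j).im| < s - τ := by
    intro j
    have h1 : Tendsto (fun τ : ℝ => s - τ) (𝓝[>] 0) (𝓝 (s - 0)) :=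
      (tendsto_const_nhds.sub tendsto_id).mono_left nhdsWithin_le_nhds
    rw [sub_zero] at h1
    exact h1.eventually (lt_mem_nhds (hx j))
  obtain ⟨τ, h1, h2⟩ := ((eventually_all.2 h).and self_mem_nhdsWithin).exists
  exact ⟨τ, h2, h1⟩

theorem FamBound.summable_eval [CompleteSpace F] {c : (Fin n → ℤ) → CVec n → F} {U : Set (CVec n)}
    {σ C : ℝ} (h : FamBound c U σ C) {y x : CVec n} (hy : y ∈ U) (hx : x ∈ strip n σ) :
    Summable fun k => expK k x • c k y := by
  refine Summable.of_norm_bounded (h.summable hy) fun k => ?_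
  rw [norm_smul, mul_comm]
  gcongr
  exact norm_expK_le fun j => (hx j).le

theorem FamBound.norm_eval_le [CompleteSpace F] {c : (Fin n → ℤ) → CVec n → F}
    {U : Set (CVec n)} {σ C : ℝ} (h : FamBound c U σ C) {z : CVec n × CVec n}
    (hz : z ∈ U ×ˢ strip n σ) : ‖evalFam c z‖ ≤ C := by
  refine tsum_of_norm_bounded (h.summable hz.1).hasSum (fun k => ?_) |>.trans
    ((h.summable hz.1).tsum_le_of_sum_le (h z.1 hz.1))
  rw [norm_smul, mul_comm]
  gcongr
  exact norm_expK_le fun j => (hz.2 j).le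

theorem evalFam_add_period (c : (Fin n → ℤ) → CVec n → F) (y x : CVec n) (m : Fin n → ℤ) :
    evalFam c (y, x + period m) = evalFam c (y, x) := by
  simp only [evalFam, expK_add_period]

/-- The derivative of `e^{i k·x} c(y)`. -/
theorem hasFDerivAt_term {k : Fin n → ℤ} {c : CVec n → F} {z : CVec n × CVec n}
    (hc : DifferentiableAt ℂ c z.1) :
    HasFDerivAt (fun z : CVec n × CVec n => expK k z.2 • c z.1)
      (expK k z.2 • (fderiv ℂ c z.1).comp (ContinuousLinearMap.fst ℂ _ _) +
        ((expK k z.2 * Complex.I) • (kdot k).comp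
          (ContinuousLinearMap.snd ℂ _ _)).smulRight (c z.1)) z := by
  have h1 : HasFDerivAt (fun z : CVec n × CVec n => expK k z.2)
      ((expK k z.2 * Complex.I) • (kdot k).comp (ContinuousLinearMap.snd ℂ _ _)) z := by
    have := (hasFDerivAt_expK k z.2).comp z hasFDerivAt_snd
    exact this
  have h2 : HasFDerivAt (fun z : CVec n × CVec n => c z.1)
      ((fderiv ℂ c z.1).comp (ContinuousLinearMap.fst ℂ _ _)) z :=
    hc.hasFDerivAt.comp z hasFDerivAt_fst
  exact h1.smul h2

/-- Functions given by families may be differentiated term by term. -/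
theorem FamBound.hasFDerivAt_eval [CompleteSpace F] {c : (Fin n → ℤ) → CVec n → F}
    {U : Set (CVec n)} {σ C : ℝ} (h : FamBound c U σ C) (hU : IsOpen U) (hc : FamHol c U)
    {z : CVec n × CVec n} (hz : z ∈ U ×ˢ strip n σ) :
    DifferentiableAt ℂ (evalFam c) z ∧ ∀ v w : CVec n,
      HasSum (fun k => expK k z.2 • (fderiv ℂ (c k) z.1 v + (Complex.I * kdot k w) • c k z.1))
        (fderiv ℂ (evalFam c) z (v, w)) := by
  -- On a slightly narrower strip the terms are dominated by C e^{-|k|₁τ}, uniformly in the point,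
  -- so termwise differentiation applies.
  obtain ⟨τ, hτ, hzτ⟩ := exists_mem_strip_sub hz.2
  have hO : IsOpen (U ×ˢ strip n (σ - τ)) := hU.prod (isOpen_strip _)
  have hterm : ∀ k, ∀ z ∈ U ×ˢ strip n (σ - τ), HasFDerivAt
      (fun z : CVec n × CVec n => expK k z.2 • c k z.1) _ z := fun k z hz =>
    hasFDerivAt_term ((hc k).differentiableAt (hU.mem_nhds hz.1))
  have key := hasFDerivAt_tsum_of_bounded hO (f := fun k (z : CVec n × CVec n) =>
      expK k z.2 • c k z.1) (u := fun k => C * Real.exp (-(norm1 k * τ)))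
    (fun k z hz => (hterm k z hz).differentiableAt.differentiableWithinAt)
    ((summable_exp_norm1 hτ).mul_left C) (fun k z hz => by
      rw [norm_smul]
      have h1 := h.single hz.1 k
      have h2 : ‖expK k z.2‖ ≤ Real.exp (norm1 k * (σ - τ)) := norm_expK_le fun j => (hz.2 j).le
      calc ‖expK k z.2‖ * ‖c k z.1‖ ≤ Real.exp (norm1 k * (σ - τ)) * ‖c k z.1‖ := by gcongr
        _ = ‖c k z.1‖ * Real.exp (norm1 k * σ) * Real.exp (-(norm1 k * τ)) := by
            rw [mul_assoc, ← Real.exp_add, mul_comm]; congr 2; ring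
        _ ≤ _ := by gcongr) (z := z) ⟨hz.1, hzτ⟩
  have hfd : fderiv ℂ (evalFam c) z = ∑' k, fderiv ℂ
      (fun z : CVec n × CVec n => expK k z.2 • c k z.1) z := key.2.fderiv
  refine ⟨key.2.differentiableAt, fun v w => ?_⟩
  have h1 := (ContinuousLinearMap.apply ℂ F (v, w)).hasSum key.1.hasSum
  rw [hfd]
  refine h1.congr_fun fun k => ?_
  simp only [ContinuousLinearMap.apply_apply]
  rw [(hterm k z ⟨hz.1, hzτ⟩).fderiv]
  simp [smul_add, smul_smul, mul_assoc]

theorem FamBound.differentiableOn_eval [CompleteSpace F] {c : (Fin n → ℤ) → CVec n → F}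
    {U : Set (CVec n)} {σ C : ℝ} (h : FamBound c U σ C) (hU : IsOpen U) (hc : FamHol c U) :
    DifferentiableOn ℂ (evalFam c) (U ×ˢ strip n σ) := fun _ hz =>
  (h.hasFDerivAt_eval hU hc hz).1.differentiableWithinAt

/-- Coefficients of the Hamiltonian vector field `(-∂_x χ, ∂_y χ)`. -/
def vfFam (B : Finset (Fin n → ℤ)) (χ : (Fin n → ℤ) → CVec n → ℂ) :
    (Fin n → ℤ) → CVec n → CVec n × CVec n := fun l y =>
  if l ∈ B then (-((Complex.I * χ l y) • ivec l), freq (χ l) y) else 0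

theorem evalFam_vfFam (B : Finset (Fin n → ℤ)) (χ : (Fin n → ℤ) → CVec n → ℂ)
    (z : CVec n × CVec n) : evalFam (vfFam B χ) z = ∑ l ∈ B, expK l z.2 •
      (-((Complex.I * χ l z.1) • ivec l), freq (χ l) z.1) := by
  rw [evalFam, tsum_eq_sum (s := B)]
  · refine Finset.sum_congr rfl fun l hl => ?_
    rw [vfFam, if_pos hl]
  · intro l hl
    rw [vfFam, if_neg hl, smul_zero]

theorem ivec_eq_sum (k : Fin n → ℤ) :
    ivec k = ∑ j, (k j : ℂ) • EuclideanSpace.single j (1 : ℂ) := by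
  ext i; simp [Pi.single_apply]

theorem kdot_freq (k : Fin n → ℤ) (g : CVec n → ℂ) (y : CVec n) :
    kdot k (freq g y) = fderiv ℂ g y (ivec k) := by
  rw [kdot_apply, ivec_eq_sum, map_sum]
  simp [freq]

/-- Differentiation along the Hamiltonian vector field of `χ` is the bracket with `χ`. -/
theorem fderiv_evalFam_vf [CompleteSpace F] {B : Finset (Fin n → ℤ)}
    {χ : (Fin n → ℤ) → CVec n → ℂ} {c : (Fin n → ℤ) → CVec n → F}
    {U : Set (CVec n)} {σ C : ℝ} (h : FamBound c U σ C) (hU : IsOpen U) (hc : FamHol c U)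
    {z : CVec n × CVec n} (hz : z ∈ U ×ˢ strip n σ) :
    fderiv ℂ (evalFam c) z (evalFam (vfFam B χ) z) = evalFam (lieFam B χ c) z := by
  rw [evalFam_vfFam, map_sum]
  have h1 : ∀ l, HasSum (fun m => expK m z.2 • (Complex.I •
      (fderiv ℂ (χ l) z.1 (ivec (m - l)) • c (m - l) z.1 -
        χ l z.1 • fderiv ℂ (c (m - l)) z.1 (ivec l))))
      (fderiv ℂ (evalFam c) z (expK l z.2 •
        (-((Complex.I * χ l z.1) • ivec l), freq (χ l) z.1))) := by
    intro l
    rw [map_smul]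
    have h2 := ((h.hasFDerivAt_eval hU hc hz).2 (-((Complex.I * χ l z.1) • ivec l))
      (freq (χ l) z.1)).const_smul (expK l z.2)
    -- Multiplication by the character of l shifts the modes by l; re-indexing by m ↦ m - l matches
    -- the definition of `lieFam`.
    have h3 := (Equiv.subRight l).hasSum_iff.2 h2
    refine h3.congr_fun fun m => ?_
    simp only [Function.comp_apply, Equiv.subRight_apply, kdot_freq, map_neg, map_smul]
    have hexp : expK m z.2 = expK l z.2 * expK (m - l) z.2 := by
      rw [← expK_add, add_sub_cancel]
    rw [hexp]
    module
  have h4 := hasSum_sum (s := B) fun l _ => h1 l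
  rw [evalFam, ← h4.tsum_eq]
  refine tsum_congr fun m => ?_
  rw [lieFam, Finset.smul_sum]

end EvalFam

end Averaging
end

noncomputable section

namespace Averaging

open Metric Set Filter Topology

/-! ### The Hamiltonian vector field -/

section VectorField

variable {n : ℕ} {B : Finset (Fin n → ℤ)} {χ : (Fin n → ℤ) → CVec n → ℂ}

/-- Applying the differential to the complex conjugate of the gradient gives the square of the
gradient's norm. -/
theorem norm_freq_le (g : CVec n → ℂ) (y : CVec n) : ‖freq g y‖ ≤ ‖fderiv ℂ g y‖ := by
  rcases eq_or_ne (freq g y) 0 with h | h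
  · rw [h, norm_zero]; positivity
  have h0 : 0 < ‖freq g y‖ := norm_pos_iff.2 h
  let v : CVec n := WithLp.toLp 2 fun j => (starRingEnd ℂ) (freq g y j)
  have hv : v = ∑ j, (starRingEnd ℂ) (freq g y j) • EuclideanSpace.single j (1 : ℂ) := by
    ext i; simp [v, Pi.single_apply]
  have hnv : ‖v‖ = ‖freq g y‖ := by
    simp [v, EuclideanSpace.norm_eq]
  have h1 : fderiv ℂ g y v = ((‖freq g y‖ ^ 2 : ℝ) : ℂ) := by
    rw [hv, map_sum, EuclideanSpace.norm_sq_eq]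
    push_cast
    refine Finset.sum_congr rfl fun j _ => ?_
    rw [map_smul, smul_eq_mul, mul_comm, ← Complex.mul_conj']
    rfl
  have h2 := (fderiv ℂ g y).le_opNorm v
  rw [h1, Complex.norm_real, Real.norm_of_nonneg (by positivity), hnv] at h2
  nlinarith

theorem norm_vf_fst_le {V : Set (CVec n)} {σ τ M : ℝ} (hχ : FamBound χ V σ M) (hτ : 0 < τ)
    {z : CVec n × CVec n} (hz : z ∈ V ×ˢ strip n (σ - τ)) :
    ‖(evalFam (vfFam B χ) z).1‖ ≤ M / (Real.exp 1 * τ) := by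
  rw [evalFam_vfFam, Prod.fst_sum]
  refine (norm_sum_le _ _).trans ?_
  refine le_trans (Finset.sum_le_sum fun l _ => ?_)
    (hχ.weighted hτ (by linarith : (σ - τ) + τ ≤ σ) hz.1 B)
  simp only [Prod.smul_fst, norm_smul, norm_neg, norm_mul, Complex.norm_I, one_mul]
  have h1 : ‖expK l z.2‖ ≤ Real.exp (norm1 l * (σ - τ)) := norm_expK_le fun j => (hz.2 j).le
  have h2 := norm_ivec_le l
  calc ‖expK l z.2‖ * (‖χ l z.1‖ * ‖ivec l‖)
      ≤ Real.exp (norm1 l * (σ - τ)) * (‖χ l z.1‖ * norm1 l) := by gcongr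
    _ = _ := by ring

theorem norm_vf_snd_le {V : Set (CVec n)} {σ δ M : ℝ} (hV : IsOpen V) (hχ : FamBound χ V σ M)
    (hχV : FamHol χ V) (hδ : 0 < δ) {z : CVec n × CVec n} (hz : z.2 ∈ strip n σ)
    (hzV : closedBall z.1 δ ⊆ V) : ‖(evalFam (vfFam B χ) z).2‖ ≤ M / δ := by
  -- With the angles frozen, the second component is the gradient of this one function of y, bounded
  -- by M; Cauchy then gives M/δ.
  have hd : DifferentiableOn ℂ (fun y => ∑ l ∈ B, expK l z.2 * χ l y) V :=
    DifferentiableOn.fun_sum fun l _ => (hχV l).const_mul _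
  have hzV' : z.1 ∈ V := hzV (mem_closedBall_self hδ.le)
  have h1 : (evalFam (vfFam B χ) z).2 = freq (fun y => ∑ l ∈ B, expK l z.2 * χ l y) z.1 := by
    rw [evalFam_vfFam, Prod.snd_sum]
    ext j
    have h2 : HasFDerivAt (fun y => ∑ l ∈ B, expK l z.2 * χ l y)
        (∑ l ∈ B, expK l z.2 • fderiv ℂ (χ l) z.1) z.1 :=
      HasFDerivAt.fun_sum fun l _ =>
        (((hχV l).differentiableAt (hV.mem_nhds hzV')).hasFDerivAt).const_mul _
    simp [freq, h2.fderiv]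
  rw [h1]
  refine (norm_freq_le _ _).trans (norm_fderiv_le hV hd hδ hzV fun y hy => ?_)
  refine (norm_sum_le _ _).trans (le_trans (Finset.sum_le_sum fun l _ => ?_) (hχ y (hzV hy) B))
  rw [norm_mul, mul_comm]
  gcongr
  exact norm_expK_le fun j => (hz j).le

theorem famHol_vfFam {V : Set (CVec n)} (hV : IsOpen V) (hχV : FamHol χ V) :
    FamHol (vfFam B χ) V := by
  intro l
  by_cases hl : l ∈ B
  · have : vfFam B χ l = fun y => (-((Complex.I * χ l y) • ivec l), freq (χ l) y) := by
      ext1 y; rw [vfFam, if_pos hl]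
    rw [this]
    refine DifferentiableOn.prodMk ?_ ?_
    · exact (((hχV l).const_mul _).smul_const _).neg
    · rw [differentiableOn_euclidean]
      exact fun j => differentiableOn_fderiv_apply hV (hχV l) _
  · have : vfFam B χ l = fun _ => 0 := by
      ext1 y; rw [vfFam, if_neg hl]
    rw [this]
    exact differentiableOn_const _

/-- A crude bound suffices: it only makes the Lie series of the flow converge, and its size enters
no later estimate. -/
theorem exists_famBound_vfFam {V W : Set (CVec n)} {σ δ M : ℝ} (hV : IsOpen V)
    (hχ : FamBound χ V σ M) (hχV : FamHol χ V) (hδ : 0 < δ)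
    (hWV : ∀ y ∈ W, closedBall y δ ⊆ V) : ∃ C, FamBound (vfFam B χ) W σ C := by
  classical
  refine ⟨∑ l ∈ B, (M * norm1 l + M / δ), fun y hy s => ?_⟩
  have hyV : y ∈ V := hWV y hy (mem_closedBall_self hδ.le)
  have hM := hχ.nonneg hyV
  have h0 : ∀ l ∈ s, l ∉ B → ‖vfFam B χ l y‖ * Real.exp (norm1 l * σ) = 0 := by
    intro l _ hl
    rw [vfFam, if_neg hl, norm_zero, zero_mul]
  calc ∑ l ∈ s, ‖vfFam B χ l y‖ * Real.exp (norm1 l * σ)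
      ≤ ∑ l ∈ s ∩ B, ‖vfFam B χ l y‖ * Real.exp (norm1 l * σ) := by
        refine le_of_eq (Finset.sum_subset Finset.inter_subset_left fun l hl hl' => ?_).symm
        exact h0 l hl fun hB => hl' (Finset.mem_inter.2 ⟨hl, hB⟩)
    _ ≤ ∑ l ∈ B, ‖vfFam B χ l y‖ * Real.exp (norm1 l * σ) :=
        Finset.sum_le_sum_of_subset_of_nonneg Finset.inter_subset_right fun _ _ _ => by positivity
    _ ≤ _ := Finset.sum_le_sum fun l hl => ?_
  rw [vfFam, if_pos hl]
  have hk := norm1_nonneg l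
  have he := Real.exp_pos (norm1 l * σ)
  have hs : ∀ w ∈ V, ‖χ l w‖ ≤ M / Real.exp (norm1 l * σ) := fun w hw => by
    rw [le_div_iff₀ he]; exact hχ.single hw l
  have h1 : ‖-((Complex.I * χ l y) • ivec l)‖ ≤ M / Real.exp (norm1 l * σ) * norm1 l := by
    rw [norm_neg, norm_smul, norm_mul, Complex.norm_I, one_mul]
    exact mul_le_mul (hs y hyV) (norm_ivec_le l) (norm_nonneg _) (by positivity)
  have h2 : ‖freq (χ l) y‖ ≤ M / Real.exp (norm1 l * σ) / δ :=
    (norm_freq_le _ _).trans (norm_fderiv_le hV (hχV l) hδ (hWV y hy)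
      fun w hw => hs w (hWV y hy hw))
  have h3 : ‖(-((Complex.I * χ l y) • ivec l), freq (χ l) y)‖ ≤
      M / Real.exp (norm1 l * σ) * norm1 l + M / Real.exp (norm1 l * σ) / δ := by
    rw [Prod.norm_def]
    refine max_le (h1.trans ?_) (h2.trans ?_)
    · have : 0 ≤ M / Real.exp (norm1 l * σ) / δ := by positivity
      linarith
    · have : 0 ≤ M / Real.exp (norm1 l * σ) * norm1 l := by positivity
      linarith
  calc _ ≤ (M / Real.exp (norm1 l * σ) * norm1 l + M / Real.exp (norm1 l * σ) / δ) *
        Real.exp (norm1 l * σ) := by gcongr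
    _ = _ := by field_simp

/-- The symplectic form as a continuous bilinear map. -/
def sympCLM (n : ℕ) : (CVec n × CVec n) →L[ℂ] (CVec n × CVec n) →L[ℂ] ℂ :=
  LinearMap.toContinuousLinearMap
    ((LinearMap.toContinuousLinearMap (𝕜 := ℂ) (E := CVec n × CVec n) (F' := ℂ)).toLinearMap ∘ₗ
      LinearMap.mk₂ ℂ sympForm
        (fun a a' b => by
          simp only [sympForm, ← Finset.sum_add_distrib]
          refine Finset.sum_congr rfl fun j _ => ?_
          simp only [Prod.fst_add, Prod.snd_add, PiLp.add_apply]; ring)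
        (fun c a b => by
          simp only [sympForm, smul_eq_mul, Finset.mul_sum]
          refine Finset.sum_congr rfl fun j _ => ?_
          simp only [Prod.smul_fst, Prod.smul_snd, PiLp.smul_apply, smul_eq_mul]; ring)
        (fun a b b' => by
          simp only [sympForm, ← Finset.sum_add_distrib]
          refine Finset.sum_congr rfl fun j _ => ?_
          simp only [Prod.fst_add, Prod.snd_add, PiLp.add_apply]; ring)
        (fun c a b => by
          simp only [sympForm, smul_eq_mul, Finset.mul_sum]
          refine Finset.sum_congr rfl fun j _ => ?_
          simp only [Prod.smul_fst, Prod.smul_snd, PiLp.smul_apply, smul_eq_mul]; ring))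

theorem sympCLM_apply (a b : CVec n × CVec n) : sympCLM n a b = sympForm a b := rfl

theorem sympForm_swap (a b : CVec n × CVec n) : sympForm a b = -sympForm b a := by
  simp only [sympForm, ← Finset.sum_neg_distrib]
  exact Finset.sum_congr rfl fun j _ => by ring

/-- The vector field is the symplectic gradient of `χ`. -/
theorem sympForm_vf {V : Set (CVec n)} (hV : IsOpen V) (hχV : FamHol χ V)
    {z : CVec n × CVec n} (hz : z.1 ∈ V) (b : CVec n × CVec n) :
    sympCLM n (evalFam (vfFam B χ) z) b =
      -fderiv ℂ (fun z : CVec n × CVec n => ∑ l ∈ B, expK l z.2 • χ l z.1) z b := by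
  have h1 : HasFDerivAt (fun z : CVec n × CVec n => ∑ l ∈ B, expK l z.2 • χ l z.1)
      (∑ l ∈ B, _) z :=
    HasFDerivAt.fun_sum fun l _ => hasFDerivAt_term ((hχV l).differentiableAt (hV.mem_nhds hz))
  rw [h1.fderiv, evalFam_vfFam, map_sum, sum_apply,
    sum_apply, ← Finset.sum_neg_distrib]
  refine Finset.sum_congr rfl fun l _ => ?_
  have h2 : fderiv ℂ (χ l) z.1 b.1 = ∑ j, freq (χ l) z.1 j * b.1 j := by
    have hb : b.1 = ∑ j, b.1 j • EuclideanSpace.single j (1 : ℂ) := by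
      ext i; simp [Pi.single_apply]
    conv_lhs => rw [hb]
    rw [map_sum]
    refine Finset.sum_congr rfl fun j _ => ?_
    rw [map_smul, smul_eq_mul, mul_comm]; rfl
  have h3 : sympForm (-((Complex.I * χ l z.1) • ivec l), freq (χ l) z.1) b =
      -(Complex.I * χ l z.1) * kdot l b.2 - fderiv ℂ (χ l) z.1 b.1 := by
    rw [h2, kdot_apply, sympForm, Finset.mul_sum, ← Finset.sum_sub_distrib]
    refine Finset.sum_congr rfl fun j _ => ?_
    simp
    ring
  rw [map_smul, smul_apply, sympCLM_apply, h3]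
  simp
  ring

/-- Differentiating the relation of `sympForm_vf` expresses the first term through minus the Hessian
of the generating function; symmetry of the Hessian makes the two terms cancel. This is the skewness
hypothesis of `flow_symplectic`. -/
theorem sympForm_fderiv_vf {V : Set (CVec n)} (hV : IsOpen V) (hχV : FamHol χ V)
    {z : CVec n × CVec n} (hz : z.1 ∈ V) (hX : DifferentiableAt ℂ (evalFam (vfFam B χ)) z)
    (a b : CVec n × CVec n) :
    sympCLM n (fderiv ℂ (evalFam (vfFam B χ)) z a) b +
      sympCLM n a (fderiv ℂ (evalFam (vfFam B χ)) z b) = 0 := by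
  set g : CVec n × CVec n → ℂ := fun z => ∑ l ∈ B, expK l z.2 • χ l z.1 with hg
  have hO : IsOpen (V ×ˢ (univ : Set (CVec n))) := hV.prod isOpen_univ
  have hgd : DifferentiableOn ℂ g (V ×ˢ univ) := fun w hw =>
    (HasFDerivAt.fun_sum fun l _ => hasFDerivAt_term
      ((hχV l).differentiableAt (hV.mem_nhds hw.1))).differentiableAt.differentiableWithinAt
  have hzO : z ∈ V ×ˢ (univ : Set (CVec n)) := ⟨hz, mem_univ _⟩
  have hg2 := ((differentiableOn_fderiv hO hgd).differentiableAt (hO.mem_nhds hzO)).hasFDerivAt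
  have hsymm := second_derivative_symmetric_of_eventually (f := g) (f' := fderiv ℂ g)
    (by filter_upwards [hO.mem_nhds hzO] with w hw using
          (hgd.differentiableAt (hO.mem_nhds hw)).hasFDerivAt) hg2
  have h1 : ∀ a b, sympCLM n (fderiv ℂ (evalFam (vfFam B χ)) z a) b =
      -fderiv ℂ (fderiv ℂ g) z a b := by
    intro a b
    have h2 : HasFDerivAt (fun w => sympCLM n (evalFam (vfFam B χ) w) b)
        (((sympCLM n).flip b).comp (fderiv ℂ (evalFam (vfFam B χ)) z)) z :=
      ((sympCLM n).flip b).hasFDerivAt.comp z hX.hasFDerivAt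
    have h3 : HasFDerivAt (fun w => -fderiv ℂ g w b)
        (-((ContinuousLinearMap.apply ℂ ℂ b).comp (fderiv ℂ (fderiv ℂ g) z))) z :=
      ((ContinuousLinearMap.apply ℂ ℂ b).hasFDerivAt.comp z hg2).neg
    have h4 : (fun w => sympCLM n (evalFam (vfFam B χ) w) b) =ᶠ[𝓝 z]
        fun w => -fderiv ℂ g w b := by
      filter_upwards [hO.mem_nhds hzO] with w hw using sympForm_vf hV hχV hw.1 b
    have := congrArg (fun L => L a) (h2.unique (h3.congr_of_eventuallyEq h4))
    simpa using this
  rw [sympCLM_apply a, sympForm_swap, ← sympCLM_apply, h1, h1, hsymm a b]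
  ring

end VectorField

/-! ### Reality -/

section Reality

variable {n : ℕ} {F : Type*} [NormedAddCommGroup F] [NormedSpace ℂ F]

/-- Reality of the function with Fourier coefficients `c`, for a conjugation `J`. -/
def FamReal (J : F →L[ℝ] F) (c : (Fin n → ℤ) → CVec n → F) (U : Set (CVec n)) : Prop :=
  ∀ y ∈ U, IsRealVec y → ∀ k, c (-k) y = J (c k y)

theorem isRealVec_ivec (k : Fin n → ℤ) : IsRealVec (ivec k) := fun j => by simp

theorem FamReal.fderiv_apply {J : F →L[ℝ] F} {c : (Fin n → ℤ) → CVec n → F} {U : Set (CVec n)}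
    (h : FamReal J c U) (hU : IsOpen U) (hc : FamHol c U) {y : CVec n} (hy : y ∈ U)
    (hyr : IsRealVec y) {v : CVec n} (hv : IsRealVec v) (k : Fin n → ℤ) :
    fderiv ℂ (c (-k)) y v = J (fderiv ℂ (c k) y v) := by
  have hline : HasDerivAt (fun t : ℝ => y + t • v) v 0 := by
    simpa using ((hasDerivAt_id (0 : ℝ)).smul_const v).const_add y
  have hcont : Tendsto (fun t : ℝ => y + t • v) (𝓝 0) (𝓝 y) := by
    simpa using hline.continuousAt.tendsto
  have hd : ∀ k, HasDerivAt (fun t : ℝ => c k (y + t • v)) (fderiv ℂ (c k) y v) 0 := by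
    intro k
    have h1 : HasFDerivAt (c k) ((fderiv ℂ (c k) y).restrictScalars ℝ) (y + (0 : ℝ) • v) := by
      simpa using ((hc k).differentiableAt (hU.mem_nhds hy)).hasFDerivAt.restrictScalars ℝ
    exact h1.comp_hasDerivAt (0 : ℝ) hline
  have h2 : HasDerivAt (fun t : ℝ => J (c k (y + t • v))) (J (fderiv ℂ (c k) y v)) 0 :=
    J.hasFDerivAt.comp_hasDerivAt (0 : ℝ) (hd k)
  refine (hd (-k)).unique (h2.congr_of_eventuallyEq ?_)
  filter_upwards [hcont.eventually (hU.mem_nhds hy)] with t ht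
  refine h _ ht (fun j => ?_) k
  simp [hyr j, hv j]

/-- Complex conjugation on `ℂ`. -/
def conjℂ : ℂ →L[ℝ] ℂ := Complex.conjCLE.toContinuousLinearMap

theorem conjℂ_apply (z : ℂ) : conjℂ z = (starRingEnd ℂ) z := rfl

/-- Complex conjugation on `ℂⁿ`. -/
def conjVec (n : ℕ) : CVec n →L[ℝ] CVec n :=
  LinearMap.toContinuousLinearMap
    { toFun := fun v => WithLp.toLp 2 fun j => (starRingEnd ℂ) (v j)
      map_add' := fun v w => by ext j; simp
      map_smul' := fun c v => by ext j; simp }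

theorem conjVec_apply (v : CVec n) (j : Fin n) : conjVec n v j = (starRingEnd ℂ) (v j) := rfl

theorem conjVec_smul (c : ℂ) (v : CVec n) :
    conjVec n (c • v) = (starRingEnd ℂ) c • conjVec n v := by
  ext j; simp [conjVec_apply]

theorem conjVec_eq_self {v : CVec n} : conjVec n v = v ↔ IsRealVec v := by
  constructor
  · intro h j
    have := congrArg (fun w : CVec n => w j) h
    exact Complex.conj_eq_iff_im.1 (by simpa [conjVec_apply] using this)
  · intro h; ext j
    rw [conjVec_apply]; exact Complex.conj_eq_iff_im.2 (h j)

/-- Re-index by l ↦ -l: the sign from conjugating i is compensated by the sign of the integer vector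
in which each y-derivative is taken. -/
theorem famReal_lieFam {J : F →L[ℝ] F} (hJ : ∀ (c : ℂ) v, J (c • v) = (starRingEnd ℂ) c • J v)
    {B : Finset (Fin n → ℤ)} (hB : ∀ l ∈ B, -l ∈ B)
    {χ : (Fin n → ℤ) → CVec n → ℂ} {c : (Fin n → ℤ) → CVec n → F} {U : Set (CVec n)}
    (hU : IsOpen U) (hχ : FamHol χ U) (hc : FamHol c U) (hχr : FamReal conjℂ χ U)
    (hcr : FamReal J c U) : FamReal J (lieFam B χ c) U := by
  intro y hy hyr m
  have h1 : lieFam B χ c (-m) y = ∑ l ∈ B, Complex.I •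
      (fderiv ℂ (χ (-l)) y (ivec (-(m - l))) • c (-(m - l)) y -
        χ (-l) y • fderiv ℂ (c (-(m - l))) y (ivec (-l))) := by
    rw [lieFam]
    refine Finset.sum_nbij' (fun l => -l) (fun l => -l) hB hB (fun _ _ => neg_neg _)
      (fun _ _ => neg_neg _) fun l _ => ?_
    simp only [neg_neg]
    rw [show -m - l = -(m - -l) by abel]
  rw [h1, lieFam, map_sum]
  refine Finset.sum_congr rfl fun l _ => ?_
  rw [hJ, map_sub, hJ, hJ, ivec_neg, ivec_neg, map_neg, map_neg,
    hχr.fderiv_apply hU hχ hy hyr (isRealVec_ivec _), hcr.fderiv_apply hU hc hy hyr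
      (isRealVec_ivec _), hχr y hy hyr, hcr y hy hyr, Complex.conj_I, conjℂ_apply, conjℂ_apply]
  module

theorem conj_expK {k : Fin n → ℤ} {x : CVec n} (hx : IsRealVec x) :
    (starRingEnd ℂ) (expK k x) = expK (-k) x := by
  have : ∀ j, (starRingEnd ℂ) (x j) = x j := fun j => Complex.conj_eq_iff_im.2 (hx j)
  rw [expK, expK, ← Complex.exp_conj]
  simp [this]

theorem FamReal.eval [CompleteSpace F] {J : F →L[ℝ] F}
    (hJ : ∀ (c : ℂ) v, J (c • v) = (starRingEnd ℂ) c • J v)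
    {c : (Fin n → ℤ) → CVec n → F} {U : Set (CVec n)} {σ C : ℝ}
    (hcr : FamReal J c U) (hc : FamBound c U σ C) {z : CVec n × CVec n}
    (hz : z ∈ U ×ˢ strip n σ) (h1 : IsRealVec z.1) (h2 : IsRealVec z.2) :
    J (evalFam c z) = evalFam c z := by
  have h3 := J.hasSum (hc.summable_eval hz.1 hz.2).hasSum
  rw [← (Equiv.neg _).hasSum_iff] at h3
  rw [evalFam]
  refine h3.unique ?_
  refine (hc.summable_eval hz.1 hz.2).hasSum.congr_fun fun k => ?_
  simp only [Function.comp_apply, Equiv.neg_apply]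
  rw [hJ, conj_expK h2, ← hcr z.1 hz.1 h1, neg_neg]

/-- Complex conjugation on phase space. -/
def conjPhase (n : ℕ) : CVec n × CVec n →L[ℝ] CVec n × CVec n :=
  (conjVec n).prodMap (conjVec n)

theorem conjPhase_smul (c : ℂ) (v : CVec n × CVec n) :
    conjPhase n (c • v) = (starRingEnd ℂ) c • conjPhase n v := by
  ext1 <;> simp [conjPhase, conjVec_smul]

theorem famReal_vfFam {B : Finset (Fin n → ℤ)} (hB : ∀ l ∈ B, -l ∈ B)
    {χ : (Fin n → ℤ) → CVec n → ℂ} {U : Set (CVec n)} (hU : IsOpen U) (hχ : FamHol χ U)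
    (hχr : FamReal conjℂ χ U) : FamReal (conjPhase n) (vfFam B χ) U := by
  intro y hy hyr l
  by_cases hl : l ∈ B
  · rw [vfFam, vfFam, if_pos hl, if_pos (hB l hl)]
    refine Prod.ext ?_ ?_
    · have : conjVec n (ivec l) = ivec l := conjVec_eq_self.2 (isRealVec_ivec l)
      simp [conjPhase, conjVec_smul, this, hχr y hy hyr, ivec_neg, conjℂ_apply]
    · ext j
      have := hχr.fderiv_apply hU hχ hy hyr (v := EuclideanSpace.single j (1 : ℂ))
        (fun i => by by_cases h : i = j <;> simp [h]) l
      simpa [conjPhase, conjVec_apply, freq, conjℂ_apply] using this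
  · have hl' : -l ∉ B := fun h => hl (by simpa using hB _ h)
    rw [vfFam, vfFam, if_neg hl, if_neg hl', map_zero]

end Reality

end Averaging
end

noncomputable section

namespace Averaging

open Metric Set Filter Topology

/-! ### The time-one map of a trigonometric polynomial. -/

section TimeOneMap

variable {n : ℕ}

theorem box_subset {D : Set (RVec n)} {ρ ρ' σ σ' δ τ : ℝ} (hρ : ρ' + δ ≤ ρ) (hσ : σ' + τ ≤ σ)
    {z : CVec n × CVec n} (hz : z ∈ nbhd D ρ' ×ˢ strip n σ') :
    box z δ τ ⊆ nbhd D ρ ×ˢ strip n σ := by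
  intro w hw
  rw [mem_box] at hw
  refine ⟨closedBall_subset_nbhd hρ hz.1 (by rw [mem_closedBall, dist_eq_norm]; exact hw.1.le),
    fun j => ?_⟩
  have h1 : |(w.2 j - z.2 j).im| < τ := by
    refine lt_of_le_of_lt ?_ hw.2
    exact (Complex.abs_im_le_norm _).trans (PiLp.norm_apply_le (w.2 - z.2) j)
  have h2 := hz.2 j
  rw [Complex.sub_im] at h1
  rw [abs_lt] at h1 h2 ⊢
  constructor <;> linarith

/-- The time-one map of the Hamiltonian flow of a trigonometric polynomial `χ`, and the
expansion of functions composed with it. -/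
theorem exists_timeOneMap {D : Set (RVec n)} {ρ σ δ τ M q : ℝ} {B : Finset (Fin n → ℤ)}
    {χ : (Fin n → ℤ) → CVec n → ℂ} (hδ : 0 < δ) (hτ : 0 < τ) (hσ : 3 * τ < σ)
    (hχ : FamBound χ (nbhd D ρ) σ M) (hχ' : FamHol χ (nbhd D ρ)) (hM0 : 0 ≤ M)
    (hq0 : 0 < q) (hq : 2 * M / (δ * τ) ≤ q) (hq8 : q ≤ 1 / 8) :
    ∃ Ψ : CVec n × CVec n → CVec n × CVec n,
      SymplecticChange Ψ (nbhd D (ρ - 3 * δ)) (σ - 3 * τ) (nbhd D ρ) σ ∧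
      ((∀ l ∈ B, -l ∈ B) → FamReal conjℂ χ (nbhd D ρ) →
        PreservesReal Ψ (nbhd D (ρ - 3 * δ))) ∧
      ∀ (G : ℕ → CVec n × CVec n → ℂ) (C : ℝ),
        (∀ j, DifferentiableOn ℂ (G j) (nbhd D (ρ - 2 * δ) ×ˢ strip n (σ - 2 * τ))) →
        (∀ j, ∀ w ∈ nbhd D (ρ - 2 * δ) ×ˢ strip n (σ - 2 * τ),
          fderiv ℂ (G j) w (evalFam (vfFam B χ) w) = G (j + 1) w) →
        (∀ j, ∀ w ∈ nbhd D (ρ - 2 * δ) ×ˢ strip n (σ - 2 * τ),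
          ‖G (j + 1) w‖ ≤ C * q ^ (j + 1) * (j + 1).factorial) →
        ∀ z ∈ nbhd D (ρ - 3 * δ) ×ˢ strip n (σ - 3 * τ),
          HasSum (fun j : ℕ => ((1 : ℝ) / (j.factorial : ℝ)) • G j z) (G 0 (Ψ z)) := by
  -- Three layers of thickness (δ, τ): the vector field is estimated on the first, its iterated
  -- brackets and the integral curves live on the second, O, and initial points are taken in the
  -- third, V.
  set O : Set (CVec n × CVec n) := nbhd D (ρ - 2 * δ) ×ˢ strip n (σ - 2 * τ) with hO
  set V : Set (CVec n × CVec n) := nbhd D (ρ - 3 * δ) ×ˢ strip n (σ - 3 * τ) with hV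
  set X : CVec n × CVec n → CVec n × CVec n := evalFam (vfFam B χ) with hX
  have hOo : IsOpen O := (isOpen_nbhd _ _).prod (isOpen_strip _)
  have hVo : IsOpen V := (isOpen_nbhd _ _).prod (isOpen_strip _)
  have hboxO : ∀ z ∈ V, box z δ τ ⊆ O := fun z hz =>
    box_subset (by linarith) (by linarith) hz
  have hself : ∀ z : CVec n × CVec n, z ∈ box z δ τ := fun z => by
    rw [mem_box]; simpa using ⟨hδ, hτ⟩
  have hVO : V ⊆ O := fun z hz => hboxO z hz (hself z)
  have hOsub : O ⊆ nbhd D (ρ - δ) ×ˢ strip n (σ - τ) :=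
    prod_mono (nbhd_mono (by linarith)) (strip_mono (by linarith))
  obtain ⟨C₀, hC₀⟩ := exists_famBound_vfFam (B := B) (W := nbhd D (ρ - δ)) (isOpen_nbhd D ρ) hχ
    hχ' hδ fun y hy => closedBall_subset_nbhd (by linarith) hy
  have hsubρ : nbhd D (ρ - δ) ⊆ nbhd D ρ := nbhd_mono (by linarith)
  have hvf : FamBound (vfFam B χ) (nbhd D (ρ - δ)) (σ - τ) C₀ :=
    hC₀.mono subset_rfl (by linarith) le_rfl
  have hvfh : FamHol (vfFam B χ) (nbhd D (ρ - δ)) :=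
    famHol_vfFam (isOpen_nbhd _ _) (hχ'.mono hsubρ)
  have hit : ∀ j, FamBound ((lieFam B χ)^[j] (vfFam B χ)) (nbhd D (ρ - 2 * δ)) (σ - 2 * τ)
      (C₀ * q ^ j * j.factorial) := fun j =>
    famBound_iterate hδ hτ (by linarith) hχ hχ' hvf hvfh hM0 hq j
  have hith : ∀ j, FamHol ((lieFam B χ)^[j] (vfFam B χ)) (nbhd D (ρ - 2 * δ)) := fun j =>
    (famHol_iterate (isOpen_nbhd _ _) (hχ'.mono hsubρ) hvfh j).mono (nbhd_mono (by linarith))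
  have hMq : M ≤ δ * τ / 16 := by
    have h1 : 2 * M / (δ * τ) ≤ 1 / 8 := hq.trans hq8
    rw [div_le_iff₀ (by positivity)] at h1
    linarith
  have hXd : DifferentiableOn ℂ X O := by
    simpa using (hit 0).differentiableOn_eval (isOpen_nbhd _ _) (hith 0)
  have hb₁ : ∀ w ∈ O, ‖(X w).1‖ ≤ δ / 4 := by
    intro w hw
    have h1 := norm_vf_fst_le (B := B) hχ (τ := 2 * τ) (by positivity) (z := w)
      ⟨nbhd_mono (by linarith) hw.1, hw.2⟩
    refine h1.trans ?_
    have he : (1 : ℝ) ≤ Real.exp 1 := Real.one_le_exp zero_le_one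
    rw [div_le_iff₀ (by positivity)]
    have : δ * τ / 16 ≤ δ / 4 * (1 * (2 * τ)) := by nlinarith [mul_pos hδ hτ]
    calc M ≤ δ * τ / 16 := hMq
      _ ≤ δ / 4 * (1 * (2 * τ)) := this
      _ ≤ _ := by gcongr
  have hb₂ : ∀ w ∈ O, ‖(X w).2‖ ≤ τ / 4 := by
    intro w hw
    have h1 := norm_vf_snd_le (B := B) (isOpen_nbhd D ρ) hχ hχ' hδ
      (strip_mono (by linarith) hw.2) (closedBall_subset_nbhd (by linarith) hw.1)
    refine h1.trans ?_
    rw [div_le_iff₀ hδ]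
    nlinarith [mul_pos hδ hτ]
  have hflow : ∀ z, z ∈ V → ∃ γ : ℝ → CVec n × CVec n, γ 0 = z ∧
      (∀ t ∈ Icc (0 : ℝ) 1, HasDerivWithinAt γ (X (γ t)) (Icc 0 1) t) ∧
      ∀ t ∈ Icc (0 : ℝ) 1, ‖(γ t).1 - z.1‖ ≤ δ / 4 ∧ ‖(γ t).2 - z.2‖ ≤ τ / 4 := fun z hz =>
    exists_flow_box hδ hτ (hXd.mono (hboxO z hz)) (fun w hw => hb₁ w (hboxO z hz hw))
      fun w hw => hb₂ w (hboxO z hz hw)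
  choose! γ hγ0 hγd hγb using hflow
  have hγO : ∀ z ∈ V, ∀ t ∈ Icc (0 : ℝ) 1, γ z t ∈ O := by
    intro z hz t ht
    refine hboxO z hz (mem_box.2 ⟨?_, ?_⟩)
    · linarith [(hγb z hz t ht).1]
    · linarith [(hγb z hz t ht).2]
  -- Lie derivatives of the identity map: the first is the field X itself, the others are brackets
  -- of its components with χ.
  let G : ℕ → CVec n × CVec n → CVec n × CVec n := fun j z =>
    Nat.casesOn j z fun i => evalFam ((lieFam B χ)^[i] (vfFam B χ)) z
  have hG0 : ∀ z, G 0 z = z := fun _ => rfl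
  have hGs : ∀ j z, G (j + 1) z = evalFam ((lieFam B χ)^[j] (vfFam B χ)) z := fun _ _ => rfl
  have hGd : ∀ j, DifferentiableOn ℂ (G j) O := by
    intro j
    cases j with
    | zero => exact differentiableOn_id
    | succ j => exact (hit j).differentiableOn_eval (isOpen_nbhd _ _) (hith j)
  have hstep : ∀ j, ∀ w ∈ O, fderiv ℂ (G j) w (X w) = G (j + 1) w := by
    intro j w hw
    cases j with
    | zero =>
      have : G 0 = id := rfl
      rw [this, fderiv_id]; rfl
    | succ j =>
      rw [hGs, Function.iterate_succ_apply']
      exact fderiv_evalFam_vf (hit j) (isOpen_nbhd _ _) (hith j) hw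
  -- Since `G (j + 1)` carries only j brackets, the constant is divided by q.
  have hGb : ∀ j, ∀ w ∈ O, ‖G (j + 1) w‖ ≤ C₀ / q * q ^ (j + 1) * (j + 1).factorial := by
    intro j w hw
    rw [hGs]
    have h1 := (hit j).norm_eval_le hw
    refine h1.trans ?_
    have hC₀0 : 0 ≤ C₀ := hC₀.nonneg (nbhd_mono (by linarith) hw.1)
    have h2 : C₀ / q * q ^ (j + 1) = C₀ * q ^ j := by field_simp; ring
    rw [h2]
    gcongr
    exact Nat.le_succ j
  have hq1 : q < 1 := by linarith
  have hΨsum : ∀ z ∈ V, HasSum (fun j : ℕ => ((1 : ℝ) ^ j / (j.factorial : ℝ)) • G j z)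
      (γ z 1) := by
    intro z hz
    have := hasSum_lieSeries hOo hGd hstep hq0.le hq1 hGb (hγd z hz) (hγO z hz)
      (t := 1) (by simp)
    rwa [hγ0 z hz] at this
  obtain ⟨hΨd, hΨs⟩ := flow_symplectic hOo hVo hVO hGd hG0 (fun w _ => rfl) hstep hq0.le hq8 hGb
    hγ0 hγd hγO (sympCLM n) (fun w hw a b => sympForm_fderiv_vf (isOpen_nbhd D (ρ - δ))
      (hχ'.mono hsubρ) (hOsub hw).1 (hXd.differentiableAt (hOo.mem_nhds hw)) a b)
  have h1I : (1 : ℝ) ∈ Icc (0 : ℝ) 1 := by simp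
  refine ⟨fun z => γ z 1, ⟨?_, hΨd, ?_, ?_, hΨs⟩, ?_, ?_⟩
  · intro z hz
    have := hγO z hz 1 h1I
    exact ⟨nbhd_mono (by linarith) this.1, strip_mono (by linarith) this.2⟩
  · intro y hy x hx m
    have hx' : x + period m ∈ strip n (σ - 3 * τ) := fun j => by
      simpa [period] using hx j
    have h2 := hΨsum (y, x) ⟨hy, hx⟩
    have h3 := hΨsum (y, x + period m) ⟨hy, hx'⟩
    -- Only the zeroth term, the identity, feels the translation; all other terms are periodic in
    -- the angles.
    have h4 := h2.add (hasSum_ite_eq (0 : ℕ) ((0, period m) : CVec n × CVec n))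
    have h5 := h3.unique (h4.congr_fun fun j => ?_)
    · rw [h5]; simp [Prod.ext_iff]
    · cases j with
      | zero => simp [hG0]
      | succ j => simp [hGs, evalFam_add_period]
  · intro z hz w hw hzw
    have := flow_injective (z := γ z) (w := γ w) (C := max (δ / 4) (τ / 4)) hδ hτ
      (hXd.mono (by rw [hγ0 z hz]; exact hboxO z hz))
      (fun p hp => by
        rw [hγ0 z hz] at hp
        exact max_le_max (hb₁ p (hboxO z hz hp)) (hb₂ p (hboxO z hz hp)))
      (hγd z hz) (hγd w hw) (fun t ht => by rw [hγ0 z hz]; exact hγb z hz t ht)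
      (fun t ht => by rw [hγ0 w hw]; exact hγb w hw t ht) hzw
    rwa [hγ0 z hz, hγ0 w hw] at this
  · intro hB hr y hy hyr x hxr
    have hx : x ∈ strip n (σ - 3 * τ) := fun j => by
      rw [hxr j, abs_zero]; linarith
    have hzV : (y, x) ∈ V := ⟨hy, hx⟩
    have hfr : ∀ j, FamReal (conjPhase n) ((lieFam B χ)^[j] (vfFam B χ)) (nbhd D (ρ - δ)) := by
      have hr' : FamReal conjℂ χ (nbhd D (ρ - δ)) := fun y hy => hr y (hsubρ hy)
      intro j
      induction j with
      | zero => exact famReal_vfFam hB (isOpen_nbhd _ _) (hχ'.mono hsubρ) hr'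
      | succ j ih =>
        rw [Function.iterate_succ_apply']
        exact famReal_lieFam conjPhase_smul hB (isOpen_nbhd _ _) (hχ'.mono hsubρ)
          (famHol_iterate (isOpen_nbhd _ _) (hχ'.mono hsubρ) hvfh j) hr' ih
    have hGr : ∀ j, conjPhase n (G j (y, x)) = G j (y, x) := by
      intro j
      cases j with
      | zero =>
        rw [hG0]
        exact Prod.ext (conjVec_eq_self.2 hyr) (conjVec_eq_self.2 hxr)
      | succ j =>
        rw [hGs]
        exact FamReal.eval conjPhase_smul (fun y hy => hfr j y (nbhd_mono (by linarith) hy))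
          (hit j) (hVO hzV) hyr hxr
    have h2 := hΨsum (y, x) hzV
    have h3 := (conjPhase n).hasSum h2
    have h4 : conjPhase n (γ (y, x) 1) = γ (y, x) 1 := by
      refine h3.unique (h2.congr_fun fun j => ?_)
      rw [map_smul, hGr]
    exact ⟨conjVec_eq_self.1 (congrArg Prod.fst h4), conjVec_eq_self.1 (congrArg Prod.snd h4)⟩
  · intro G' C hd hs hb z hz
    have := hasSum_lieSeries hOo hd hs hq0.le hq1 hb (hγd z hz) (hγO z hz) (t := 1) h1I
    rw [hγ0 z hz] at this
    simpa using this

end TimeOneMap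

end Averaging
end

noncomputable section

namespace Averaging

open Metric Set Filter Topology

/-! ### Restricting a family to a set of modes. -/

section Selection

variable {n : ℕ} {F : Type*} [NormedAddCommGroup F]

open Classical in
/-- The part of a family supported in the set of modes satisfying `P`. -/
def sel (P : (Fin n → ℤ) → Prop) (c : (Fin n → ℤ) → CVec n → F) : (Fin n → ℤ) → CVec n → F :=
  fun k y => if P k then c k y else 0

theorem sel_pos {P : (Fin n → ℤ) → Prop} {c : (Fin n → ℤ) → CVec n → F} {k : Fin n → ℤ}
    (h : P k) : sel P c k = c k := by
  ext1 y; rw [sel, if_pos h]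

theorem sel_neg {P : (Fin n → ℤ) → Prop} {c : (Fin n → ℤ) → CVec n → F} {k : Fin n → ℤ}
    (h : ¬ P k) : sel P c k = fun _ => 0 := by
  ext1 y; rw [sel, if_neg h]

theorem FamBound.sel {P : (Fin n → ℤ) → Prop} {c : (Fin n → ℤ) → CVec n → F} {U : Set (CVec n)}
    {σ C : ℝ} (h : FamBound c U σ C) : FamBound (sel P c) U σ C := by
  refine h.of_le fun k y _ => ?_
  by_cases hk : P k
  · rw [sel_pos hk]
  · rw [sel_neg hk]; simp

end Selection

/-! ### Series of families and the homological equation. -/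

section FamilyAlgebra

variable {n : ℕ} {F : Type*} [NormedAddCommGroup F] [NormedSpace ℂ F]

/-- Sums of series of families. -/
theorem famSum [CompleteSpace F] {d : ℕ → (Fin n → ℤ) → CVec n → F} {U : Set (CVec n)} {σ : ℝ} {u : ℕ → ℝ}
    (hU : IsOpen U) (hd : ∀ j, FamBound (d j) U σ (u j)) (hdh : ∀ j, FamHol (d j) U)
    (hu : Summable u) :
    FamHol (fun k y => ∑' j, d j k y) U ∧ FamBound (fun k y => ∑' j, d j k y) U σ (∑' j, u j) ∧
    ∀ z ∈ U ×ˢ strip n σ, HasSum (fun j => evalFam (d j) z)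
      (evalFam (fun k y => ∑' j, d j k y) z) := by
  have hsingle : ∀ k j, ∀ y ∈ U, ‖d j k y‖ ≤ u j * Real.exp (-(norm1 k * σ)) := by
    intro k j y hy
    rw [Real.exp_neg, ← div_eq_mul_inv, le_div_iff₀ (Real.exp_pos _)]
    exact (hd j).single hy k
  have hsumk : ∀ k, ∀ y ∈ U, Summable fun j => ‖d j k y‖ := fun k y hy =>
    Summable.of_nonneg_of_le (fun _ => norm_nonneg _) (fun j => hsingle k j y hy)
      (hu.mul_right _)
  refine ⟨fun k y hy => ?_, fun y hy s => ?_, fun z hz => ?_⟩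
  · exact (hasFDerivAt_tsum_of_bounded hU (fun j => hdh j k) (hu.mul_right _)
      (hsingle k) hy).2.differentiableAt.differentiableWithinAt
  · have h1 : ∀ k ∈ s, ‖∑' j, d j k y‖ * Real.exp (norm1 k * σ) ≤
        ∑' j, ‖d j k y‖ * Real.exp (norm1 k * σ) := by
      intro k _
      rw [tsum_mul_right]
      gcongr
      exact norm_tsum_le_tsum_norm (hsumk k y hy)
    refine (Finset.sum_le_sum h1).trans ?_
    have hs : ∀ k ∈ s, Summable fun j => ‖d j k y‖ * Real.exp (norm1 k * σ) :=
      fun k _ => (hsumk k y hy).mul_right _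
    rw [← Summable.tsum_finsetSum hs]
    exact (summable_sum hs).tsum_le_tsum (fun j => hd j y hy s) hu
  -- Absolute convergence over pairs (j, k) justifies interchanging the two summations.
  · have hp : Summable fun p : ℕ × (Fin n → ℤ) => expK p.2 z.2 • d p.1 p.2 z.1 := by
      refine Summable.of_norm ?_
      rw [summable_prod_of_nonneg fun _ => norm_nonneg _]
      have hfib : ∀ j, Summable fun k => ‖expK k z.2 • d j k z.1‖ := fun j => by
        refine Summable.of_nonneg_of_le (fun _ => norm_nonneg _) (fun k => ?_)
          ((hd j).summable hz.1)
        rw [norm_smul, mul_comm]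
        gcongr
        exact norm_expK_le fun i => (hz.2 i).le
      refine ⟨hfib, Summable.of_nonneg_of_le (fun _ => tsum_nonneg fun _ => norm_nonneg _)
        (fun j => (hfib j).tsum_le_of_sum_le fun s => ?_) hu⟩
      refine (Finset.sum_le_sum fun k _ => ?_).trans (hd j z.1 hz.1 s)
      rw [norm_smul, mul_comm]
      gcongr
      exact norm_expK_le fun i => (hz.2 i).le
    have h2 := hp.hasSum.prod_fiberwise fun j => ((hd j).summable_eval hz.1 hz.2).hasSum
    have h3 : ∑' p : ℕ × (Fin n → ℤ), expK p.2 z.2 • d p.1 p.2 z.1 =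
        evalFam (fun k y => ∑' j, d j k y) z := by
      rw [← (Equiv.prodComm (Fin n → ℤ) ℕ).tsum_eq]
      have hp' := (Equiv.prodComm (Fin n → ℤ) ℕ).summable_iff.2 hp
      refine hp'.tsum_prod.trans (tsum_congr fun k => ?_)
      exact (tsum_const_smul'' (expK k z.2))
    rw [h3] at h2
    exact h2

theorem FamHol.sel {P : (Fin n → ℤ) → Prop} {c : (Fin n → ℤ) → CVec n → F} {U : Set (CVec n)}
    (h : FamHol c U) : FamHol (sel P c) U := by
  intro k
  by_cases hk : P k
  · rw [sel_pos hk]; exact h k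
  · rw [sel_neg hk]; exact differentiableOn_const _

theorem FamReal.sel {J : F →L[ℝ] F} {P : (Fin n → ℤ) → Prop} (hP : ∀ k, P (-k) ↔ P k)
    {c : (Fin n → ℤ) → CVec n → F} {U : Set (CVec n)} (h : FamReal J c U) :
    FamReal J (sel P c) U := by
  intro y hy hyr k
  by_cases hk : P k
  · rw [sel_pos hk, sel_pos ((hP k).2 hk)]; exact h y hy hyr k
  · rw [sel_neg hk, sel_neg (fun h => hk ((hP k).1 h)), map_zero]

theorem FamBound.const_smul {c : (Fin n → ℤ) → CVec n → F} {U : Set (CVec n)}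
    {σ C : ℝ} (h : FamBound c U σ C) (a : ℝ) :
    FamBound (fun k y => a • c k y) U σ (|a| * C) := by
  intro y hy s
  have : ∀ k ∈ s, ‖a • c k y‖ * Real.exp (norm1 k * σ) =
      |a| * (‖c k y‖ * Real.exp (norm1 k * σ)) := fun k _ => by
    rw [norm_smul, Real.norm_eq_abs]; ring
  rw [Finset.sum_congr rfl this, ← Finset.mul_sum]
  gcongr
  exact h y hy s

theorem finite_norm1_le (K : ℝ) : {k : Fin n → ℤ | norm1 k ≤ K}.Finite := by
  refine (Set.finite_Icc (fun _ : Fin n => -⌈K⌉) (fun _ => ⌈K⌉)).subset fun k hk => ?_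
  have h1 : ∀ j, |k j| ≤ ⌈K⌉ := fun j => by
    have h2 : |(k j : ℝ)| ≤ norm1 k :=
      Finset.single_le_sum (f := fun j => |(k j : ℝ)|) (fun _ _ => abs_nonneg _)
        (Finset.mem_univ j)
    have h3 : ((|k j| : ℤ) : ℝ) ≤ (⌈K⌉ : ℝ) := by
      push_cast
      exact (h2.trans hk).trans (Int.le_ceil K)
    exact_mod_cast h3
  exact ⟨fun j => (abs_le.1 (h1 j)).1, fun j => (abs_le.1 (h1 j)).2⟩

/-- The non-resonant modes of order at most `K`. -/
def lowModes (Λ : AddSubgroup (Fin n → ℤ)) (K : ℝ) : Finset (Fin n → ℤ) :=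
  ((finite_norm1_le K).subset (fun _ h => h.2) : {k | k ∉ Λ ∧ norm1 k ≤ K}.Finite).toFinset

theorem mem_lowModes {Λ : AddSubgroup (Fin n → ℤ)} {K : ℝ} {k : Fin n → ℤ} :
    k ∈ lowModes Λ K ↔ k ∉ Λ ∧ norm1 k ≤ K := by
  simp [lowModes]

theorem neg_mem_lowModes {Λ : AddSubgroup (Fin n → ℤ)} {K : ℝ} {k : Fin n → ℤ} :
    -k ∈ lowModes Λ K ↔ k ∈ lowModes Λ K := by
  simp [mem_lowModes, norm1_neg]

/-- The solution `χ` of the homological equation `{h, χ} + c = 0` on the modes in `B`. -/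
def homSol (B : Finset (Fin n → ℤ)) (h : CVec n → ℂ) (c : (Fin n → ℤ) → CVec n → ℂ) :
    (Fin n → ℤ) → CVec n → ℂ :=
  sel (· ∈ B) fun l y => c l y / (Complex.I * fderiv ℂ h y (ivec l))

theorem famHol_homSol {B : Finset (Fin n → ℤ)} {h : CVec n → ℂ}
    {c : (Fin n → ℤ) → CVec n → ℂ} {U : Set (CVec n)} (hU : IsOpen U)
    (hh : DifferentiableOn ℂ h U) (hc : FamHol c U)
    (hne : ∀ y ∈ U, ∀ l ∈ B, fderiv ℂ h y (ivec l) ≠ 0) : FamHol (homSol B h c) U := by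
  intro l
  by_cases hl : l ∈ B
  · rw [homSol, sel_pos hl]
    simp only [div_eq_mul_inv]
    exact (hc l).mul (((differentiableOn_fderiv_apply hU hh _).const_mul _).inv
      fun y hy => mul_ne_zero Complex.I_ne_zero (hne y hy l hl))
  · rw [homSol, sel_neg hl]; exact differentiableOn_const _

theorem famBound_homSol {B : Finset (Fin n → ℤ)} {h : CVec n → ℂ}
    {c : (Fin n → ℤ) → CVec n → ℂ} {U : Set (CVec n)} {σ w a : ℝ} (ha : 0 < a)
    (hc : FamBound (sel (· ∈ B) c) U σ w)
    (hne : ∀ y ∈ U, ∀ l ∈ B, a ≤ ‖fderiv ℂ h y (ivec l)‖) :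
    FamBound (homSol B h c) U σ (w / a) := by
  have h1 := hc.const_smul a⁻¹
  rw [abs_of_pos (inv_pos.2 ha), ← div_eq_inv_mul] at h1
  refine h1.of_le fun l y hy => ?_
  by_cases hl : l ∈ B
  · rw [homSol, sel_pos hl, sel_pos hl, norm_div, norm_mul, Complex.norm_I, one_mul, norm_smul,
      Real.norm_of_nonneg (inv_pos.2 ha).le, ← div_eq_inv_mul]
    gcongr
    exact hne y hy l hl
  · rw [homSol, sel_neg hl, sel_neg hl]; simp

theorem famReal_homSol {B : Finset (Fin n → ℤ)} (hB : ∀ l, -l ∈ B ↔ l ∈ B) {h : CVec n → ℂ}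
    {c : (Fin n → ℤ) → CVec n → ℂ} {U : Set (CVec n)}
    (hh : ∀ y ∈ U, IsRealVec y → IsRealVec (freq h y)) (hc : FamReal conjℂ c U) :
    FamReal conjℂ (homSol B h c) U := by
  refine FamReal.sel hB fun y hy hyr k => ?_
  have h1 : (starRingEnd ℂ) (fderiv ℂ h y (ivec k)) = fderiv ℂ h y (ivec k) := by
    rw [← kdot_freq, kdot_apply, map_sum]
    refine Finset.sum_congr rfl fun j _ => ?_
    rw [map_mul, Complex.conj_eq_iff_im.2 (hh y hy hyr j)]
    simp
  rw [hc y hy hyr, conjℂ_apply, conjℂ_apply, map_div₀, map_mul, h1, Complex.conj_I, ivec_neg,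
    map_neg, neg_mul, mul_neg]

end FamilyAlgebra

end Averaging
end

noncomputable section

namespace Averaging

open Metric Set Filter Topology

/-! ### One averaging step. -/

section AveragingStep

variable {n : ℕ}

/-- The resonant part of a family. -/
def resPart (Λ : AddSubgroup (Fin n → ℤ)) (c : (Fin n → ℤ) → CVec n → ℂ) :
    (Fin n → ℤ) → CVec n → ℂ := sel (· ∈ Λ) c

/-- The non-resonant part of order at most `K`. -/
def lowPart (Λ : AddSubgroup (Fin n → ℤ)) (K : ℝ) (c : (Fin n → ℤ) → CVec n → ℂ) :
    (Fin n → ℤ) → CVec n → ℂ := sel (· ∈ lowModes Λ K) c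

/-- The non-resonant part of order larger than `K`. -/
def highPart (Λ : AddSubgroup (Fin n → ℤ)) (K : ℝ) (c : (Fin n → ℤ) → CVec n → ℂ) :
    (Fin n → ℤ) → CVec n → ℂ := sel (fun k => k ∉ Λ ∧ K < norm1 k) c

theorem parts_add (Λ : AddSubgroup (Fin n → ℤ)) (K : ℝ) (c : (Fin n → ℤ) → CVec n → ℂ)
    (k : Fin n → ℤ) (y : CVec n) :
    resPart Λ c k y + highPart Λ K c k y + lowPart Λ K c k y = c k y := by
  by_cases h1 : k ∈ Λ
  · simp [resPart, highPart, lowPart, sel, mem_lowModes, h1]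
  · by_cases h2 : norm1 k ≤ K
    · simp [resPart, highPart, lowPart, sel, mem_lowModes, h1, h2]
    · simp [resPart, highPart, lowPart, sel, mem_lowModes, h1, h2, not_le.1 h2]

theorem evalFam_add {c d : (Fin n → ℤ) → CVec n → ℂ} {U : Set (CVec n)} {σ C C' : ℝ}
    (hc : FamBound c U σ C) (hd : FamBound d U σ C') {z : CVec n × CVec n}
    (hz : z ∈ U ×ˢ strip n σ) :
    evalFam (fun k y => c k y + d k y) z = evalFam c z + evalFam d z := by
  rw [evalFam, evalFam, evalFam,
    ← (hc.summable_eval hz.1 hz.2).tsum_add (hd.summable_eval hz.1 hz.2)]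
  simp only [smul_add]

theorem evalFam_smul (c : (Fin n → ℤ) → CVec n → ℂ) (a : ℝ) (z : CVec n × CVec n) :
    evalFam (fun k y => a • c k y) z = a • evalFam c z := by
  rw [evalFam, evalFam, ← tsum_const_smul'']
  simp only [smul_comm a]

/-- The unperturbed Hamiltonian along the flow of the solution of the homological equation. -/
theorem fderiv_fst_vf_homSol {B : Finset (Fin n → ℤ)} {h : CVec n → ℂ}
    {c : (Fin n → ℤ) → CVec n → ℂ} {z : CVec n × CVec n} (hh : DifferentiableAt ℂ h z.1)
    (hne : ∀ l ∈ B, fderiv ℂ h z.1 (ivec l) ≠ 0) :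
    fderiv ℂ (fun w : CVec n × CVec n => h w.1) z (evalFam (vfFam B (homSol B h c)) z) =
      -evalFam (sel (· ∈ B) c) z := by
  have h1 : fderiv ℂ (fun w : CVec n × CVec n => h w.1) z =
      (fderiv ℂ h z.1).comp (ContinuousLinearMap.fst ℂ _ _) :=
    (hh.hasFDerivAt.comp z hasFDerivAt_fst).fderiv
  have h2 : evalFam (sel (· ∈ B) c) z = ∑ l ∈ B, expK l z.2 • c l z.1 := by
    rw [evalFam, tsum_eq_sum (s := B)]
    · exact Finset.sum_congr rfl fun l hl => by rw [sel_pos hl]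
    · intro l hl; rw [sel_neg hl, smul_zero]
  rw [evalFam_vfFam, h1, h2, map_sum, ← Finset.sum_neg_distrib]
  refine Finset.sum_congr rfl fun l hl => ?_
  rw [homSol, sel_pos hl]
  have h3 := hne l hl
  simp only [map_smul, ContinuousLinearMap.comp_apply, ContinuousLinearMap.coe_fst', map_neg,
    smul_eq_mul]
  field_simp

/-- Bracketing a resonant family with a non-resonant one gives no resonant terms. -/
theorem resPart_lieFam_resPart {Λ : AddSubgroup (Fin n → ℤ)} {K : ℝ}
    (χ c : (Fin n → ℤ) → CVec n → ℂ) {k : Fin n → ℤ} (hk : k ∈ Λ) (y : CVec n) :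
    lieFam (lowModes Λ K) χ (resPart Λ c) k y = 0 := by
  rw [lieFam]
  refine Finset.sum_eq_zero fun l hl => ?_
  have h1 : k - l ∉ Λ := fun h => (mem_lowModes.1 hl).1 <| by
    simpa using Λ.sub_mem hk h
  rw [resPart, sel_neg h1]
  simp

theorem tsum_geometric_succ_le {q : ℝ} (hq0 : 0 ≤ q) (hq8 : q ≤ 1 / 8) {β : ℝ} (hβ : 0 ≤ β) :
    HasSum (fun j : ℕ => β * q ^ (j + 1)) (β * (q * (1 - q)⁻¹)) ∧
      β * (q * (1 - q)⁻¹) ≤ 2 * q * β := by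
  refine ⟨?_, ?_⟩
  · have := ((hasSum_geometric_of_lt_one hq0 (by linarith)).mul_left q).mul_left β
    simpa [pow_succ'] using this
  · have h1 : (1 - q)⁻¹ ≤ 2 := by
      rw [inv_le_comm₀ (by linarith) two_pos]; linarith
    calc β * (q * (1 - q)⁻¹) ≤ β * (q * 2) := by gcongr
      _ = _ := by ring

/-- Here b, z, w measure the resonant, high and low non-resonant parts, χ solves the homological
equation for the low part, and q bounds one bracket with χ. The low part is cancelled to first
order, so everything new carries a factor q. In the resonant modes b enters only with q², because
the first bracket of the resonant part with χ has no such modes. -/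
theorem averaging_step {D : Set (RVec n)} {ρ σ δ τ a b z w q K : ℝ}
    {Λ : AddSubgroup (Fin n → ℤ)} {h : CVec n → ℂ} {c : (Fin n → ℤ) → CVec n → ℂ}
    (hδ : 0 < δ) (hτ : 0 < τ) (hσ : 3 * τ < σ) (ha : 0 < a) (hb : 0 ≤ b) (hz : 0 ≤ z)
    (hw : 0 < w) (hq : 2 * w / (a * (δ * τ)) ≤ q) (hq8 : q ≤ 1 / 8)
    (hh : DifferentiableOn ℂ h (nbhd D ρ)) (hc : FamHol c (nbhd D ρ))
    (hsd : ∀ y ∈ nbhd D ρ, ∀ l ∈ lowModes Λ K, a ≤ ‖fderiv ℂ h y (ivec l)‖)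
    (hV : FamBound (resPart Λ c) (nbhd D ρ) σ b)
    (hZ : FamBound (highPart Λ K c) (nbhd D ρ) σ z)
    (hW : FamBound (lowPart Λ K c) (nbhd D ρ) σ w) :
    ∃ (Ψ : CVec n × CVec n → CVec n × CVec n) (c' : (Fin n → ℤ) → CVec n → ℂ),
      SymplecticChange Ψ (nbhd D (ρ - 3 * δ)) (σ - 3 * τ) (nbhd D ρ) σ ∧
      ((∀ y ∈ nbhd D ρ, IsRealVec y → IsRealVec (freq h y)) → FamReal conjℂ c (nbhd D ρ) →
        PreservesReal Ψ (nbhd D (ρ - 3 * δ)) ∧ FamReal conjℂ c' (nbhd D (ρ - 3 * δ))) ∧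
      FamHol c' (nbhd D (ρ - 3 * δ)) ∧
      (∀ p ∈ nbhd D (ρ - 3 * δ) ×ˢ strip n (σ - 3 * τ),
        h (Ψ p).1 + evalFam c (Ψ p) = h p.1 + evalFam c' p) ∧
      FamBound (resPart Λ fun k y => c' k y - c k y) (nbhd D (ρ - 3 * δ)) (σ - 3 * τ)
        (2 * q * (z + w) + 2 * q ^ 2 * b) ∧
      FamBound (lowPart Λ K c') (nbhd D (ρ - 3 * δ)) (σ - 3 * τ) (2 * q * (b + z + w)) ∧
      FamBound (highPart Λ K fun k y => c' k y - c k y) (nbhd D (ρ - 3 * δ)) (σ - 3 * τ)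
        (2 * q * (b + z + w)) := by
  set B := lowModes Λ K with hB
  set χ := homSol B h c with hχdef
  set U : Set (CVec n) := nbhd D (ρ - 2 * δ) with hUdef
  have hUo : IsOpen U := isOpen_nbhd _ _
  have hUρ : U ⊆ nbhd D ρ := nbhd_mono (by linarith)
  have hU3 : nbhd D (ρ - 3 * δ) ⊆ U := nbhd_mono (by linarith)
  have hS3 : strip n (σ - 3 * τ) ⊆ strip n (σ - 2 * τ) := strip_mono (by linarith)
  have hne : ∀ y ∈ nbhd D ρ, ∀ l ∈ B, fderiv ℂ h y (ivec l) ≠ 0 := fun y hy l hl h0 => by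
    have := hsd y hy l hl
    rw [h0, norm_zero] at this
    linarith
  have hχ : FamBound χ (nbhd D ρ) σ (w / a) := famBound_homSol ha hW hsd
  have hχ' : FamHol χ (nbhd D ρ) := famHol_homSol (isOpen_nbhd _ _) hh hc hne
  have hM0 : 0 ≤ w / a := by positivity
  have hq' : 2 * (w / a) / (δ * τ) ≤ q := by
    refine le_of_eq_of_le ?_ hq
    field_simp
  have hq0 : 0 < q := lt_of_lt_of_le (by positivity) hq
  obtain ⟨Ψ, hΨ, hΨr, hΨG⟩ := exists_timeOneMap (B := B) hδ hτ hσ hχ hχ' hM0 hq0 hq' hq8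
  set V := resPart Λ c with hVdef
  set Z := highPart Λ K c with hZdef
  set W := lowPart Λ K c with hWdef
  have hVh : FamHol V (nbhd D ρ) := hc.sel
  have hZh : FamHol Z (nbhd D ρ) := hc.sel
  have hWh : FamHol W (nbhd D ρ) := hc.sel
  have hithol : ∀ v : (Fin n → ℤ) → CVec n → ℂ, FamHol v (nbhd D ρ) → ∀ j,
      FamHol ((lieFam B χ)^[j] v) (nbhd D ρ) := fun v hv j =>
    famHol_iterate (isOpen_nbhd _ _) hχ' hv j
  have hit : ∀ (v : (Fin n → ℤ) → CVec n → ℂ) (C : ℝ), FamHol v (nbhd D ρ) →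
      FamBound v (nbhd D ρ) σ C → ∀ j, FamBound ((lieFam B χ)^[j] v) U (σ - 2 * τ)
        (C * q ^ j * j.factorial) := fun v C hvh hv j =>
    famBound_iterate hδ hτ (by linarith) hχ hχ' (hv.mono (nbhd_mono (by linarith))
      (by linarith) le_rfl) (hvh.mono (nbhd_mono (by linarith))) hM0 hq' j
  have hfd : ∀ (v : (Fin n → ℤ) → CVec n → ℂ) (C : ℝ), FamHol v (nbhd D ρ) →
      FamBound v (nbhd D ρ) σ C → ∀ j, ∀ p ∈ U ×ˢ strip n (σ - 2 * τ),
      fderiv ℂ (evalFam ((lieFam B χ)^[j] v)) p (evalFam (vfFam B χ) p) =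
        evalFam ((lieFam B χ)^[j + 1] v) p := fun v C hvh hv j p hp => by
    rw [Function.iterate_succ_apply']
    exact fderiv_evalFam_vf (hit v C hvh hv j) hUo ((hithol v hvh j).mono hUρ) hp
  have hser : ∀ (v : (Fin n → ℤ) → CVec n → ℂ) (C : ℝ), FamHol v (nbhd D ρ) →
      FamBound v (nbhd D ρ) σ C → ∀ p ∈ nbhd D (ρ - 3 * δ) ×ˢ strip n (σ - 3 * τ),
      HasSum (fun j : ℕ => ((1 : ℝ) / (j.factorial : ℝ)) • evalFam ((lieFam B χ)^[j] v) p)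
        (evalFam v (Ψ p)) := fun v C hvh hv =>
    hΨG (fun j => evalFam ((lieFam B χ)^[j] v)) C
      (fun j => (hit v C hvh hv j).differentiableOn_eval hUo ((hithol v hvh j).mono hUρ))
      (hfd v C hvh hv) (fun j p hp => (hit v C hvh hv (j + 1)).norm_eval_le hp)
  -- By the homological equation the first Lie derivative of h is -W, so its Lie series is that of
  -- -W with factorials shifted by one.
  have hserh : ∀ p ∈ nbhd D (ρ - 3 * δ) ×ˢ strip n (σ - 3 * τ),
      HasSum (fun j : ℕ => -(((1 : ℝ) / ((j + 1).factorial : ℝ)) •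
        evalFam ((lieFam B χ)^[j] W) p)) (h (Ψ p).1 - h p.1) := by
    intro p hp
    have h1 := hΨG (fun j => Nat.casesOn j (fun p => h p.1)
      fun i p => -evalFam ((lieFam B χ)^[i] W) p) (w / q) ?_ ?_ ?_ p hp
    · rw [← hasSum_nat_add_iff' 1] at h1
      simpa using h1
    · rintro (_ | j)
      · exact hh.comp differentiableOn_fst fun p hp => hUρ hp.1
      · exact ((hit W w hWh hW j).differentiableOn_eval hUo ((hithol W hWh j).mono hUρ)).neg
    · rintro (_ | j) p hp
      · exact fderiv_fst_vf_homSol (hh.differentiableAt ((isOpen_nbhd _ _).mem_nhds (hUρ hp.1)))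
          (hne p.1 (hUρ hp.1))
      · have h2 := hfd W w hWh hW j p hp
        simp only [fderiv_fun_neg, neg_apply]
        rw [h2]
    · intro j p hp
      simp only [norm_neg]
      refine ((hit W w hWh hW j).norm_eval_le hp).trans ?_
      have h3 : w / q * q ^ (j + 1) = w * q ^ j := by rw [pow_succ']; field_simp
      rw [h3]
      gcongr
      omega
  -- W contributes 1/j! and h contributes -1/(j+1)! of the same bracket, together (1/j!)·j/(j+1). At
  -- j = 0 this vanishes, which is the cancellation of W.
  set d : ℕ → (Fin n → ℤ) → CVec n → ℂ := fun j k y => ((1 : ℝ) / (j.factorial : ℝ)) •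
    ((lieFam B χ)^[j] V k y + (lieFam B χ)^[j] Z k y +
      ((j : ℝ) / (j + 1)) • (lieFam B χ)^[j] W k y) with hd
  have hcoef : ∀ j : ℕ, |(j : ℝ) / (j + 1)| ≤ 1 := fun j => by
    rw [abs_of_nonneg (by positivity), div_le_one (by positivity)]; linarith
  have hZW : ∀ j : ℕ, FamBound (fun k y => ((1 : ℝ) / (j.factorial : ℝ)) •
      ((lieFam B χ)^[j] Z k y + ((j : ℝ) / (j + 1)) • (lieFam B χ)^[j] W k y)) U (σ - 2 * τ)
      ((z + w) * q ^ j) := fun j => by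
    have h1 := ((hit Z z hZh hZ j).add ((hit W w hWh hW j).const_smul
      ((j : ℝ) / (j + 1)))).const_smul ((1 : ℝ) / (j.factorial : ℝ))
    refine h1.mono subset_rfl le_rfl ?_
    rw [abs_of_pos (by positivity), one_div, inv_mul_le_iff₀ (by positivity)]
    have h2 := mul_le_mul_of_nonneg_right (hcoef j)
      (by positivity : 0 ≤ w * q ^ j * (j.factorial : ℝ))
    nlinarith
  have hdb : ∀ j, FamBound (d j) U (σ - 2 * τ) ((b + z + w) * q ^ j) := fun j => by
    have h1 := ((hit V b hVh hV j).const_smul ((1 : ℝ) / (j.factorial : ℝ))).add (hZW j)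
    have h2 := h1.mono (C' := (b + z + w) * q ^ j) subset_rfl le_rfl (by
      rw [abs_of_pos (by positivity)]
      field_simp
      nlinarith)
    refine h2.of_le fun k y _ => le_of_eq ?_
    simp only [hd, smul_add, add_assoc]
  have hdh : ∀ j, FamHol (d j) U := fun j k => by
    have h1 := ((((hithol V hVh j).mono hUρ k).add ((hithol Z hZh j).mono hUρ k)).add
      (((hithol W hWh j).mono hUρ k).const_smul ((j : ℝ) / (j + 1)))).const_smul
      ((1 : ℝ) / (j.factorial : ℝ))
    exact h1
  have hβ : 0 ≤ b + z + w := by positivity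
  have hqs : Summable fun j : ℕ => (b + z + w) * q ^ j :=
    (summable_geometric_of_lt_one hq0.le (by linarith)).mul_left _
  obtain ⟨hsh, -, hss⟩ := famSum hUo hdb hdh hqs
  set c' : (Fin n → ℤ) → CVec n → ℂ := fun k y => ∑' j, d j k y with hc'
  have htail : ∀ k, ∀ y ∈ U, c' k y = V k y + Z k y + ∑' j, d (j + 1) k y := fun k y hy => by
    have h1 : Summable fun j => d j k y := by
      refine Summable.of_norm_bounded (hqs.mul_right (Real.exp (-(norm1 k * (σ - 2 * τ)))))
        fun j => ?_
      rw [Real.exp_neg, ← div_eq_mul_inv, le_div_iff₀ (Real.exp_pos _)]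
      exact (hdb j).single hy k
    rw [hc']
    simp only
    rw [h1.tsum_eq_zero_add]
    simp [hd]
  obtain ⟨hgs, hgle⟩ := tsum_geometric_succ_le hq0.le hq8 hβ
  have hRb : FamBound (fun k y => ∑' j, d (j + 1) k y) U (σ - 2 * τ)
      (2 * q * (b + z + w)) :=
    (famSum hUo (fun j => hdb (j + 1)) (fun j => hdh (j + 1)) hgs.summable).2.1.mono subset_rfl
      le_rfl (hgs.tsum_eq.trans_le hgle)
  refine ⟨Ψ, c', hΨ, fun hfr hcr => ?_, hsh.mono hU3, fun p hp => ?_, ?_, ?_, ?_⟩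
  · have hBn : ∀ l, -l ∈ B ↔ l ∈ B := fun l => neg_mem_lowModes
    have hχr : FamReal conjℂ χ (nbhd D ρ) := famReal_homSol hBn hfr hcr
    refine ⟨hΨr (fun l hl => (hBn l).2 hl) hχr, fun y hy hyr k => ?_⟩
    have hitr : ∀ v : (Fin n → ℤ) → CVec n → ℂ, FamHol v (nbhd D ρ) →
        FamReal conjℂ v (nbhd D ρ) → ∀ j, FamReal conjℂ ((lieFam B χ)^[j] v) (nbhd D ρ) := by
      intro v hvh hv j
      induction j with
      | zero => exact hv
      | succ j ih =>
        rw [Function.iterate_succ_apply']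
        exact famReal_lieFam (fun c v => by simp [conjℂ_apply]) (fun l hl => (hBn l).2 hl)
          (isOpen_nbhd _ _) hχ' (hithol v hvh j) hχr ih
    have hyρ := hUρ (hU3 hy)
    have hVr : FamReal conjℂ V (nbhd D ρ) := hcr.sel fun k => by simp
    have hWr : FamReal conjℂ W (nbhd D ρ) := hcr.sel hBn
    have hZr : FamReal conjℂ Z (nbhd D ρ) := hcr.sel fun k => by simp [norm1_neg]
    have h1 : ∀ j, d j (-k) y = (starRingEnd ℂ) (d j k y) := fun j => by
      simp only [hd]
      rw [hitr V hVh hVr j y hyρ hyr, hitr Z hZh hZr j y hyρ hyr, hitr W hWh hWr j y hyρ hyr]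
      simp [conjℂ_apply]
    simp only [hc', h1, conjℂ_apply]
    exact (Complex.conj_tsum _).symm
  · have hp' : p ∈ U ×ˢ strip n (σ - 2 * τ) := ⟨hU3 hp.1, hS3 hp.2⟩
    have hΨp := hΨ.mapsTo hp
    have h1 := (((hser V b hVh hV p hp).add (hser Z z hZh hZ p hp)).add
      (hser W w hWh hW p hp)).add (hserh p hp)
    have hterm : ∀ j, evalFam (d j) p =
        ((1 : ℝ) / (j.factorial : ℝ)) • evalFam ((lieFam B χ)^[j] V) p +
        ((1 : ℝ) / (j.factorial : ℝ)) • evalFam ((lieFam B χ)^[j] Z) p +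
        ((1 : ℝ) / (j.factorial : ℝ)) • evalFam ((lieFam B χ)^[j] W) p +
        -(((1 : ℝ) / ((j + 1).factorial : ℝ)) • evalFam ((lieFam B χ)^[j] W) p) := fun j => by
      have hbV := hit V b hVh hV j
      have hbZ := hit Z z hZh hZ j
      have hbW := (hit W w hWh hW j).const_smul ((j : ℝ) / (j + 1))
      rw [hd, evalFam_smul, evalFam_add (hbV.add hbZ) hbW hp', evalFam_add hbV hbZ hp',
        evalFam_smul, Nat.factorial_succ]
      have hj : (1 : ℝ) / (((j + 1) * j.factorial : ℕ) : ℝ) =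
          1 / (j.factorial : ℝ) * (1 - (j : ℝ) / (j + 1)) := by
        push_cast; field_simp; ring
      rw [hj]
      module
    have h2 := (hss p hp').unique (by simpa only [hterm] using h1)
    have h3 : evalFam c (Ψ p) = evalFam V (Ψ p) + evalFam Z (Ψ p) + evalFam W (Ψ p) := by
      rw [← evalFam_add hV hZ hΨp, ← evalFam_add (hV.add hZ) hW hΨp]
      congr 1
      ext k y
      exact (parts_add Λ K c k y).symm
    rw [h2, h3]; ring
  · obtain ⟨hgs1, hgle1⟩ := tsum_geometric_succ_le hq0.le hq8 (add_nonneg hz hw.le)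
    have hu := hgs.sub (hasSum_ite_eq 0 (b * q))
    -- In the first-order term the bracket of V has no resonant modes, so its share bq is removed
    -- from the bound.
    have he : ∀ j, FamBound (resPart Λ (d (j + 1))) U (σ - 2 * τ)
        ((b + z + w) * q ^ (j + 1) - if j = 0 then b * q else 0) := by
      rintro (_ | j)
      · refine ((hZW 1).sel (P := (· ∈ Λ))).mono subset_rfl le_rfl (by simp; linarith)
          |>.of_le fun k y _ => ?_
        by_cases hk : k ∈ Λ
        · rw [resPart, sel_pos hk, sel_pos hk]
          have h1 := resPart_lieFam_resPart (K := K) χ c hk y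
          simp only [hd, zero_add, Function.iterate_one]
          rw [← hB, ← hVdef] at h1
          rw [h1, zero_add]
        · rw [resPart, sel_neg hk, sel_neg hk]
      · simpa [resPart] using (hdb (j + 2)).sel (P := (· ∈ Λ))
    have h1 := (famSum hUo he (fun j => (hdh (j + 1)).sel) hu.summable).2.1
    rw [hu.tsum_eq] at h1
    refine h1.mono hU3 (by linarith) ?_ |>.of_le fun k y hy => ?_
    · have h2 : (b + z + w) * (q * (1 - q)⁻¹) - b * q =
          (z + w) * (q * (1 - q)⁻¹) + q * (b * (q * (1 - q)⁻¹)) := by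
        have : 1 - q ≠ 0 := by linarith
        field_simp; ring
      have h3 := (tsum_geometric_succ_le hq0.le hq8 hb).2
      rw [h2]
      nlinarith
    · by_cases hk : k ∈ Λ
      · simp only [resPart, sel_pos hk]
        rw [htail k y (hU3 hy), hVdef, hZdef, resPart, highPart, sel_pos hk,
          sel_neg fun h => h.1 hk]
        simp
      · rw [resPart, sel_neg hk]; simp
  · refine (hRb.sel (P := (· ∈ B))).mono hU3 (by linarith) le_rfl |>.of_le fun k y hy => ?_
    by_cases hk : k ∈ B
    · rw [lowPart, sel_pos hk, sel_pos hk, htail k y (hU3 hy), hVdef, hZdef, resPart, highPart,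
        sel_neg (mem_lowModes.1 hk).1, sel_neg fun h => h.2.not_ge (mem_lowModes.1 hk).2]
      simp
    · rw [lowPart, sel_neg hk, sel_neg hk]
  · refine (hRb.sel (P := fun k => k ∉ Λ ∧ K < norm1 k)).mono hU3 (by linarith) le_rfl
      |>.of_le fun k y hy => ?_
    by_cases hk : k ∉ Λ ∧ K < norm1 k
    · rw [highPart, sel_pos hk, sel_pos hk, htail k y (hU3 hy), hVdef, hZdef, resPart, highPart,
        sel_neg hk.1, sel_pos hk]
      simp
    · rw [highPart, sel_neg hk, sel_neg hk]

end AveragingStep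

end Averaging
end

noncomputable section

namespace Averaging

open Metric Set Filter Topology

/-! ### Iteration of the averaging step. -/

section Iteration

variable {n : ℕ}

theorem FamBound.sel_of_sub {P : (Fin n → ℤ) → Prop} {c c' : (Fin n → ℤ) → CVec n → ℂ}
    {U V : Set (CVec n)} {σ σ' C C' : ℝ} (hVU : V ⊆ U) (hσ : σ' ≤ σ)
    (h : FamBound (Averaging.sel P c) U σ C)
    (h' : FamBound (Averaging.sel P fun k y => c' k y - c k y) V σ' C') :
    FamBound (Averaging.sel P c') V σ' (C + C') := by
  refine ((h.mono hVU hσ le_rfl).add h').of_le fun k y _ => ?_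
  by_cases hk : P k
  · simp [sel_pos hk]
  · simp [sel_neg hk]

/-- The Hamiltonians `h + ∑ c_k e^{ik·x}` on the `(ρ, σ)`-neighbourhood and `h + ∑ c'_k e^{ik·x}`
on the smaller `(ρ', σ')`-neighbourhood are related by a symplectic change of variables. -/
def Conjugate (D : Set (RVec n)) (h : CVec n → ℂ) (c : (Fin n → ℤ) → CVec n → ℂ) (ρ σ : ℝ)
    (c' : (Fin n → ℤ) → CVec n → ℂ) (ρ' σ' : ℝ) : Prop :=
  ∃ Ψ : CVec n × CVec n → CVec n × CVec n,
    SymplecticChange Ψ (nbhd D ρ') σ' (nbhd D ρ) σ ∧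
    ((∀ y ∈ nbhd D ρ, IsRealVec y → IsRealVec (freq h y)) → FamReal conjℂ c (nbhd D ρ) →
      PreservesReal Ψ (nbhd D ρ') ∧ FamReal conjℂ c' (nbhd D ρ')) ∧
    FamHol c' (nbhd D ρ') ∧
    ∀ p ∈ nbhd D ρ' ×ˢ strip n σ', h (Ψ p).1 + evalFam c (Ψ p) = h p.1 + evalFam c' p

theorem SymplecticChange.comp {Ψ Φ : CVec n × CVec n → CVec n × CVec n}
    {D : Set (RVec n)} {ρ σ ρ' σ' ρ'' σ'' : ℝ}
    (hΨ : SymplecticChange Ψ (nbhd D ρ') σ' (nbhd D ρ) σ)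
    (hΦ : SymplecticChange Φ (nbhd D ρ'') σ'' (nbhd D ρ') σ') :
    SymplecticChange (Ψ ∘ Φ) (nbhd D ρ'') σ'' (nbhd D ρ) σ where
  mapsTo := hΨ.mapsTo.comp hΦ.mapsTo
  holomorphic := hΨ.holomorphic.comp hΦ.holomorphic hΦ.mapsTo
  equivariant y hy x hx m := by
    have h1 := hΦ.mapsTo (mk_mem_prod hy hx)
    simp only [Function.comp_apply]
    rw [hΦ.equivariant y hy x hx m, hΨ.equivariant _ h1.1 _ h1.2 m]
  injOn := hΨ.injOn.comp hΦ.injOn hΦ.mapsTo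
  symplectic z hz a b := by
    have h1 := hΦ.holomorphic.differentiableAt
      (((isOpen_nbhd _ _).prod (isOpen_strip _)).mem_nhds hz)
    have h2 := hΨ.holomorphic.differentiableAt
      (((isOpen_nbhd _ _).prod (isOpen_strip _)).mem_nhds (hΦ.mapsTo hz))
    rw [fderiv_comp z h2 h1]
    simp only [ContinuousLinearMap.comp_apply]
    rw [hΨ.symplectic _ (hΦ.mapsTo hz), hΦ.symplectic z hz]

theorem Conjugate.refl {D : Set (RVec n)} {h : CVec n → ℂ} {c : (Fin n → ℤ) → CVec n → ℂ}
    {ρ σ : ℝ} (hc : FamHol c (nbhd D ρ)) : Conjugate D h c ρ σ c ρ σ :=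
  ⟨id, ⟨mapsTo_id _, differentiableOn_id, fun _ _ _ _ _ => rfl, injOn_id _, fun z _ a b => by
    rw [fderiv_id]; rfl⟩, fun _ hcr => ⟨fun _ _ hy _ hx => ⟨hy, hx⟩, hcr⟩, hc, fun _ _ => rfl⟩

theorem Conjugate.trans {D : Set (RVec n)} {h : CVec n → ℂ}
    {c c' c'' : (Fin n → ℤ) → CVec n → ℂ} {ρ σ ρ' σ' ρ'' σ'' : ℝ} (hρ : ρ' ≤ ρ) (hσ : 0 < σ'')
    (h₁ : Conjugate D h c ρ σ c' ρ' σ') (h₂ : Conjugate D h c' ρ' σ' c'' ρ'' σ'') :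
    Conjugate D h c ρ σ c'' ρ'' σ'' := by
  obtain ⟨Ψ, hΨ, hΨr, hc', hΨe⟩ := h₁
  obtain ⟨Φ, hΦ, hΦr, hc'', hΦe⟩ := h₂
  refine ⟨Ψ ∘ Φ, hΨ.comp hΦ, fun hfr hcr => ?_, hc'', fun p hp => ?_⟩
  · obtain ⟨h1, h2⟩ := hΨr hfr hcr
    obtain ⟨h3, h4⟩ := hΦr (fun y hy => hfr y (nbhd_mono hρ hy)) h2
    refine ⟨fun y hy hyr x hx => ?_, h4⟩
    have h5 := h3 y hy hyr x hx
    have hx0 : x ∈ strip n σ'' := fun j => by rw [hx j, abs_zero]; exact hσ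
    exact h1 _ (hΦ.mapsTo (mk_mem_prod hy hx0)).1 h5.1 _ h5.2
  · simp only [Function.comp_apply]
    rw [hΨe _ (hΦ.mapsTo hp), hΦe p hp]

/-- The number β bounds the total size at every stage, so each step contracts the low part by at
least κ, where κw = 2qβ. Step i uses the parameter qκ^i, hence all accumulated changes are geometric
sums; the allowance 3w in β holds the current low part and the growth of the two others. -/
theorem averaging_iterate {D : Set (RVec n)} {ρ σ δ τ a b z w q β κ K : ℝ}
    {Λ : AddSubgroup (Fin n → ℤ)} {h : CVec n → ℂ} {c : (Fin n → ℤ) → CVec n → ℂ}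
    (hδ : 0 < δ) (hτ : 0 < τ) (ha : 0 < a) (hb : 0 ≤ b) (hz : 0 ≤ z) (hw : 0 < w)
    (hβ : b + z + 3 * w ≤ β) (hκ : 4 * β / (a * (δ * τ)) = κ) (hκ4 : κ ≤ 1 / 4)
    (hq : 2 * w / (a * (δ * τ)) = q)
    (hh : DifferentiableOn ℂ h (nbhd D ρ)) (hc : FamHol c (nbhd D ρ))
    (hsd : ∀ y ∈ nbhd D ρ, ∀ l ∈ lowModes Λ K, a ≤ ‖fderiv ℂ h y (ivec l)‖)
    (hV : FamBound (resPart Λ c) (nbhd D ρ) σ b)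
    (hZ : FamBound (highPart Λ K c) (nbhd D ρ) σ z)
    (hW : FamBound (lowPart Λ K c) (nbhd D ρ) σ w) (N : ℕ) (hN : 3 * N * τ < σ) :
    ∃ c' : (Fin n → ℤ) → CVec n → ℂ,
      Conjugate D h c ρ σ c' (ρ - 3 * N * δ) (σ - 3 * N * τ) ∧
      FamBound (resPart Λ fun k y => c' k y - c k y) (nbhd D (ρ - 3 * N * δ)) (σ - 3 * N * τ)
        (4 * q * (z + 2 * w + q * β)) ∧
      FamBound (lowPart Λ K c') (nbhd D (ρ - 3 * N * δ)) (σ - 3 * N * τ) (κ ^ N * w) ∧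
      FamBound (highPart Λ K c') (nbhd D (ρ - 3 * N * δ)) (σ - 3 * N * τ) (z + 2 * κ * w) := by
  have hβ0 : 0 < β := by linarith
  have hκ0 : 0 < κ := by rw [← hκ]; positivity
  have hq0 : 0 < q := by rw [← hq]; positivity
  have hqβ : 2 * q * β = κ * w := by rw [← hκ, ← hq]; field_simp; ring
  have hq24 : q ≤ 1 / 24 := by
    have h1 : q * β ≤ 1 / 24 * β := by
      have : κ * w ≤ 1 / 4 * w := by gcongr
      linarith
    exact le_of_mul_le_mul_right h1 hβ0
  set E : ℝ := 2 * q * (z + 2 * w) + 2 * q ^ 2 * β with hE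
  have hE0 : 0 ≤ E := by positivity
  have hEw : E ≤ w / 3 := by
    have h1 : q * (z + 2 * w) ≤ q * β := by gcongr; linarith
    have h2 : q * (q * β) ≤ 1 / 24 * (q * β) := by gcongr
    have h3 : κ * w ≤ 1 / 4 * w := by gcongr
    rw [hE]
    nlinarith
  set s : ℕ → ℝ := fun i => ∑ j ∈ Finset.range i, κ ^ j with hs
  have hs0 : ∀ i, 0 ≤ s i := fun i => Finset.sum_nonneg fun _ _ => by positivity
  -- Here 4/3 = 1/(1 - 1/4), from κ ≤ 1/4.
  have hs1 : ∀ i, s i ≤ 4 / 3 := fun i => by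
    have h1 := mul_neg_geom_sum κ i
    have h2 : 0 < κ ^ i := by positivity
    have h3 := mul_le_mul_of_nonneg_right hκ4 (hs0 i)
    simp only [hs] at h3 ⊢
    linarith
  have key : ∀ i : ℕ, 3 * i * τ < σ → ∃ c' : (Fin n → ℤ) → CVec n → ℂ,
      Conjugate D h c ρ σ c' (ρ - 3 * i * δ) (σ - 3 * i * τ) ∧
      FamBound (resPart Λ fun k y => c' k y - c k y) (nbhd D (ρ - 3 * i * δ)) (σ - 3 * i * τ)
        (E * s i) ∧
      FamBound (lowPart Λ K c') (nbhd D (ρ - 3 * i * δ)) (σ - 3 * i * τ) (κ ^ i * w) ∧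
      FamBound (highPart Λ K c') (nbhd D (ρ - 3 * i * δ)) (σ - 3 * i * τ) (z + κ * w * s i) := by
    intro i
    induction i with
    | zero =>
      intro _
      simp only [Nat.cast_zero, mul_zero, zero_mul, sub_zero, pow_zero, one_mul]
      refine ⟨c, Conjugate.refl hc, fun y _ t => ?_, hW, hZ.mono subset_rfl le_rfl (by simp [hs])⟩
      simp [hs, resPart, sel]
    | succ i ih =>
      intro hi
      push_cast at hi ⊢
      have hκi : κ ^ i ≤ 1 := pow_le_one₀ hκ0.le (by linarith)
      have hκi0 : 0 < κ ^ i := by positivity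
      obtain ⟨c₁, h1, h2, h3, h4⟩ := ih (by linarith)
      have hsub : nbhd D (ρ - 3 * i * δ) ⊆ nbhd D ρ :=
        nbhd_mono (by have : 0 ≤ 3 * i * δ := by positivity
                      linarith)
      have hσi : σ - 3 * i * τ ≤ σ := by
        have : 0 ≤ 3 * i * τ := by positivity
        linarith
      have h5 := hV.sel_of_sub hsub hσi h2
      have hc₁ : FamHol c₁ (nbhd D (ρ - 3 * i * δ)) := by
        obtain ⟨_, _, _, h, _⟩ := h1
        exact h
      have hEs : E * s i ≤ w / 2 := by
        have := mul_le_mul hEw (hs1 i) (hs0 i) (by positivity)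
        linarith
      have hκs : κ * w * s i ≤ w / 3 := by
        have : κ * w ≤ 1 / 4 * w := by gcongr
        have := mul_le_mul this (hs1 i) (hs0 i) (by positivity)
        linarith
      have hκw : κ ^ i * w ≤ w := mul_le_of_le_one_left hw.le hκi
      obtain ⟨Ψ, c₂, h6, h7, h8, h9, h10, h11, h12⟩ := averaging_step (q := q * κ ^ i) hδ hτ
        (by linarith) ha (b := b + E * s i) (z := z + κ * w * s i) (w := κ ^ i * w)
        (by have := hs0 i; positivity) (by have := hs0 i; positivity) (by positivity)
        (le_of_eq (by rw [← hq]; ring)) (by nlinarith) (hh.mono hsub) hc₁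
        (fun y hy => hsd y (hsub hy)) h5 h4 h3
      have e1 : ρ - 3 * (i + 1) * δ = ρ - 3 * i * δ - 3 * δ := by ring
      have e2 : σ - 3 * (i + 1) * τ = σ - 3 * i * τ - 3 * τ := by ring
      have hsub' : nbhd D (ρ - 3 * i * δ - 3 * δ) ⊆ nbhd D (ρ - 3 * i * δ) :=
        nbhd_mono (by linarith)
      have hs' : s (i + 1) = s i + κ ^ i := by simp [hs, Finset.sum_range_succ]
      have htot : 2 * (q * κ ^ i) * (b + E * s i + (z + κ * w * s i) + κ ^ i * w) ≤
          κ ^ (i + 1) * w := by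
        calc _ ≤ 2 * (q * κ ^ i) * β := by gcongr; linarith
          _ = κ ^ i * (2 * q * β) := by ring
          _ = _ := by rw [hqβ]; ring
      rw [e1, e2]
      refine ⟨c₂, h1.trans (by have : 0 ≤ 3 * i * δ := by positivity
                               linarith) (by linarith) ⟨Ψ, h6, h7, h8, h9⟩, ?_, ?_, ?_⟩
      · have h20 := (h2.mono hsub' (by linarith : σ - 3 * i * τ - 3 * τ ≤ _) le_rfl).add h10
        refine (h20.mono (C' := E * s (i + 1)) (Subset.refl _) le_rfl ?_).of_le fun k y _ => ?_
        · rw [hs']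
          have h13 : q * κ ^ i * (z + κ * w * s i + κ ^ i * w) ≤ q * κ ^ i * (z + 2 * w) :=
            mul_le_mul_of_nonneg_left (by linarith) (by positivity)
          have h14 : (q * κ ^ i) ^ 2 * (b + E * s i) ≤ q ^ 2 * κ ^ i * β := by
            have : (q * κ ^ i) ^ 2 ≤ q ^ 2 * κ ^ i := by
              rw [mul_pow, sq (κ ^ i)]
              gcongr
              exact mul_le_of_le_one_left hκi0.le hκi
            refine mul_le_mul this (by linarith) ?_ (by positivity)
            have := hs0 i
            positivity
          have h15 : E * κ ^ i = 2 * (q * κ ^ i * (z + 2 * w)) + 2 * (q ^ 2 * κ ^ i * β) := by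
            rw [hE]; ring
          linarith
        · by_cases hk : k ∈ Λ
          · simp [resPart, sel_pos hk]
          · simp [resPart, sel_neg hk]
      · exact h11.mono subset_rfl le_rfl htot
      · refine (h4.sel_of_sub hsub' (by linarith) h12).mono subset_rfl le_rfl ?_
        rw [hs', mul_add]
        have h13 : κ ^ (i + 1) * w = κ * w * κ ^ i := by ring
        linarith
  obtain ⟨c', h1, h2, h3, h4⟩ := key N hN
  refine ⟨c', h1, h2.mono subset_rfl le_rfl ?_, h3, h4.mono subset_rfl le_rfl ?_⟩
  · have := mul_le_mul_of_nonneg_left (hs1 N) hE0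
    nlinarith
  · have := mul_le_mul_of_nonneg_left (hs1 N) (mul_pos hκ0 hw).le
    nlinarith [mul_pos hκ0 hw]

end Iteration

end Averaging
end

noncomputable section

namespace Averaging

open Metric Set Filter Topology

/-! ### The normal form with exponentially small remainder. -/

section NormalForm

variable {n : ℕ}

/-- One long averaging step followed by `N` short ones. -/
theorem averaging_two_stage {D : Set (RVec n)} {ρ σ a b w β K : ℝ}
    {Λ : AddSubgroup (Fin n → ℤ)} {h : CVec n → ℂ} {c : (Fin n → ℤ) → CVec n → ℂ}
    (hρ : 0 < ρ) (hσ : 0 < σ) (hK : 2 ≤ K) (ha : 0 < a) (hb : 0 ≤ b) (hw : 0 < w)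
    (hβ : b + 4 * w ≤ β) {N : ℕ} (hN : 1 ≤ N) (hκ : N ^ 2 * (288 * K * β / (a * ρ * σ)) ≤ 1 / 8)
    (hh : DifferentiableOn ℂ h (nbhd D ρ)) (hc : FamHol c (nbhd D ρ))
    (hsd : ∀ y ∈ nbhd D ρ, ∀ l ∈ lowModes Λ K, a ≤ ‖fderiv ℂ h y (ivec l)‖)
    (hV : FamBound (resPart Λ c) (nbhd D ρ) σ b)
    (hZ : FamBound (highPart Λ K c) (nbhd D ρ) σ w)
    (hW : FamBound (lowPart Λ K c) (nbhd D ρ) σ w) :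
    ∃ c' : (Fin n → ℤ) → CVec n → ℂ,
      Conjugate D h c ρ σ c' (ρ / 2) (σ * (1 - 1 / K)) ∧
      FamBound (resPart Λ fun k y => c' k y - c k y) (nbhd D (ρ / 2)) (σ * (1 - 1 / K))
        (14 * (144 * K * w / (a * ρ * σ)) * w) ∧
      FamBound (lowPart Λ K c') (nbhd D (ρ / 2)) (σ * (1 - 1 / K)) ((1 / 8) ^ N * (w / 8)) ∧
      FamBound (highPart Λ K c') (nbhd D (ρ / 2)) (σ * (1 - 1 / K)) (3 / 2 * w) := by
  have hK0 : 0 < K := by linarith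
  have hβ0 : 0 < β := by linarith
  have hN0 : (1 : ℝ) ≤ N := by exact_mod_cast hN
  have hNp : (0 : ℝ) < N := by linarith
  set κ : ℝ := 288 * K * β / (a * ρ * σ) with hκd
  set q : ℝ := 144 * K * w / (a * ρ * σ) with hqd
  have hκ0 : 0 < κ := by positivity
  have hq0 : 0 < q := by positivity
  have hN2 : (1 : ℝ) ≤ (N : ℝ) ^ 2 := one_le_pow₀ hN0
  have hκ8 : κ ≤ 1 / 8 := le_trans (le_mul_of_one_le_left hκ0.le hN2) hκ
  have hqβ : 2 * q * β = κ * w := by rw [hqd, hκd]; ring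
  have hκw : κ * w ≤ w / 8 := by nlinarith
  have hqw : q * w ≤ w / 64 := by nlinarith
  -- The long step spends half of the permitted losses, namely 3δ = ρ/4 and 3τ = σ/(2K). With these,
  -- 4β/(aδτ) and 2w/(aδτ) are exactly κ and q.
  obtain ⟨c₁, h1, h2, h3, h4⟩ := averaging_iterate (δ := ρ / 12) (τ := σ / (6 * K)) (β := β)
    (κ := κ) (q := q) (by positivity) (by positivity) ha hb hw.le hw (by linarith)
    (by rw [hκd]; field_simp; norm_num) (by linarith) (by rw [hqd]; field_simp; norm_num) hh hc hsd
    hV hZ hW 1 (by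
      have : σ / (6 * K) ≤ σ / 12 := by gcongr; linarith
      push_cast; linarith)
  have e1 : ρ - 3 * ((1 : ℕ) : ℝ) * (ρ / 12) = 3 / 4 * ρ := by push_cast; ring
  have e2 : σ - 3 * ((1 : ℕ) : ℝ) * (σ / (6 * K)) = σ - σ / (2 * K) := by
    push_cast; field_simp; ring
  rw [e1, e2] at h1 h2 h3 h4
  rw [pow_one] at h3
  have hσK : σ / (2 * K) ≤ σ / 4 := by gcongr; linarith
  have hsub : nbhd D (3 / 4 * ρ) ⊆ nbhd D ρ := nbhd_mono (by linarith)
  have hσ1 : σ - σ / (2 * K) ≤ σ := by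
    have : 0 < σ / (2 * K) := by positivity
    linarith
  have hc₁ : FamHol c₁ (nbhd D (3 / 4 * ρ)) := by
    obtain ⟨_, _, _, h, _⟩ := h1
    exact h
  set dev : ℝ := 4 * q * (w + 2 * w + q * β) with hdev
  have hdev1 : dev ≤ 13 * q * w := by rw [hdev]; nlinarith
  have hdev0 : 0 ≤ dev := by positivity
  -- The other half is shared by N short steps. Shortening raises the ratio by N², but the low part
  -- is now κw, so the deviation parameter becomes N²κq, which is at most q/8: no power of N
  -- survives in the final deviation.
  obtain ⟨c₂, k1, k2, k3, k4⟩ := averaging_iterate (δ := ρ / (12 * N)) (τ := σ / (6 * K * N))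
    (β := β) (κ := N ^ 2 * κ) (q := N ^ 2 * κ * q) (b := b + dev) (z := w + 2 * κ * w) (w := κ * w)
    (by positivity) (by positivity) ha (by positivity) (by positivity) (by positivity)
    (by linarith)
    (by rw [hκd]; field_simp; norm_num) (by linarith) (by rw [hqd, hκd]; field_simp; norm_num)
    (hh.mono hsub) hc₁ (fun y hy => hsd y (hsub hy)) (hV.sel_of_sub hsub hσ1 h2) h4 h3 N (by
      have : 3 * N * (σ / (6 * K * N)) = σ / (2 * K) := by field_simp; norm_num
      rw [this]; linarith)
  have e3 : 3 / 4 * ρ - 3 * N * (ρ / (12 * N)) = ρ / 2 := by field_simp; norm_num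
  have e4 : σ - σ / (2 * K) - 3 * N * (σ / (6 * K * N)) = σ * (1 - 1 / K) := by
    field_simp; ring
  rw [e3, e4] at k1 k2 k3 k4
  have hσ2 : 0 < σ * (1 - 1 / K) := by
    have : 1 / K ≤ 1 / 2 := by gcongr
    exact mul_pos hσ (by linarith)
  have hκN : (N : ℝ) ^ 2 * κ * w ≤ w / 8 := by nlinarith
  refine ⟨c₂, h1.trans (by linarith) hσ2 k1, ?_, k3.mono subset_rfl le_rfl ?_,
    k4.mono subset_rfl le_rfl ?_⟩
  · have h20 := (h2.mono (nbhd_mono (by linarith : ρ / 2 ≤ 3 / 4 * ρ))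
      (by rw [← e4]; have : 0 < 3 * N * (σ / (6 * K * N)) := by positivity
          linarith) le_rfl).add k2
    refine (h20.mono (Subset.refl _) le_rfl ?_).of_le fun k y _ => ?_
    · have h21 : N ^ 2 * κ * q * β ≤ w / 128 := by
        have : N ^ 2 * κ * q * β = N ^ 2 * κ * (κ * w) / 2 := by rw [← hqβ]; ring
        rw [this]
        nlinarith
      -- The short steps add at most qw to the 13qw of the long one, which makes the factor 14.
      have h22 : 4 * (N ^ 2 * κ * q) * (w + 2 * κ * w + 2 * (κ * w) + N ^ 2 * κ * q * β) ≤
          4 * (1 / 8 * q) * (2 * w) := by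
        gcongr
        linarith
      linarith
    · by_cases hk : k ∈ Λ
      · simp [resPart, sel_pos hk]
      · simp [resPart, sel_neg hk]
  · have : ((N : ℝ) ^ 2 * κ) ^ N ≤ (1 / 8) ^ N := by gcongr
    calc _ ≤ (1 / 8) ^ N * (κ * w) := by gcongr
      _ ≤ _ := by gcongr
  · have : N ^ 2 * κ * (κ * w) ≤ 1 / 8 * (w / 8) := by gcongr
    linarith

/-- `coth(x/2)^n - 1 ≤ (2n/x)^n` for `n ≥ 2`. -/
theorem one_add_pow_sub_one_le (hn : 2 ≤ n) {x : ℝ} (hx : 0 < x) :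
    (1 + 2 / (Real.exp x - 1)) ^ n - 1 ≤ (2 * n / x) ^ n := by
  set v : ℝ := x / 2 with hv
  have hv0 : 0 < v := by positivity
  set u : ℝ := 2 / (Real.exp x - 1) with hu
  have hexp : 0 < Real.exp x - 1 := by
    have := Real.add_one_lt_exp hx.ne'
    linarith
  have hu0 : 0 < u := by positivity
  -- Indeed u = e^{-v}/sinh v, and sinh v ≥ v.
  have huv : u ≤ v⁻¹ * Real.exp (-v) := by
    have h1 : v ≤ Real.sinh v := Real.self_le_sinh_iff.2 hv0.le
    rw [Real.sinh_eq] at h1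
    have h2 : Real.exp x - 1 = Real.exp v * (Real.exp v - Real.exp (-v)) := by
      rw [mul_sub, ← Real.exp_add, ← Real.exp_add, hv]; simp
    rw [hu, Real.exp_neg v, ← mul_inv, div_le_iff₀ hexp, inv_mul_eq_div,
      le_div_iff₀ (by positivity), h2]
    have := Real.exp_pos v
    nlinarith
  -- One factor e^{-v} is kept and traded for i!/v^i, which completes v^{-(n-i)} to v^{-n}; then i!
  -- times the binomial coefficient is at most n^i. The powers n^i with i < n sum to at most n^n
  -- because n ≥ 2.
  have hterm : ∀ i ∈ Finset.range n, u ^ (n - i) * (n.choose i : ℝ) ≤ (v⁻¹) ^ n * (n : ℝ) ^ i := by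
    intro i hi
    have hi' : i < n := Finset.mem_range.1 hi
    have h1 : u ^ (n - i) ≤ (v⁻¹) ^ n * i.factorial := by
      have h2 : (v⁻¹ * Real.exp (-v)) ^ (n - i) ≤ v⁻¹ ^ (n - i) * Real.exp (-v) := by
        rw [mul_pow]
        gcongr
        exact pow_le_of_le_one (Real.exp_pos _).le (Real.exp_le_one_iff.2 (by linarith))
          (by omega)
      have h3 := Real.pow_div_factorial_le_exp v hv0.le i
      rw [div_le_iff₀ (by positivity)] at h3
      have h4 : v⁻¹ ^ n = v⁻¹ ^ (n - i) * v⁻¹ ^ i := by rw [← pow_add]; congr 1; omega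
      calc u ^ (n - i) ≤ (v⁻¹ * Real.exp (-v)) ^ (n - i) := by gcongr
        _ ≤ v⁻¹ ^ (n - i) * Real.exp (-v) := h2
        _ ≤ v⁻¹ ^ (n - i) * (v⁻¹ ^ i * i.factorial) := by
          gcongr
          rw [Real.exp_neg, inv_pow, inv_le_comm₀ (Real.exp_pos _) (by positivity), mul_inv,
            inv_inv, ← div_eq_mul_inv, div_le_iff₀ (by positivity)]
          exact h3
        _ = _ := by rw [h4]; ring
    have h5 : (i.factorial : ℝ) * n.choose i ≤ (n : ℝ) ^ i := by
      have := Nat.descFactorial_le_pow n i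
      rw [Nat.descFactorial_eq_factorial_mul_choose] at this
      exact_mod_cast this
    calc _ ≤ (v⁻¹) ^ n * i.factorial * n.choose i := by gcongr
      _ = (v⁻¹) ^ n * (i.factorial * n.choose i) := by ring
      _ ≤ _ := by gcongr
  have hsum : (1 + u) ^ n - 1 = ∑ i ∈ Finset.range n, u ^ (n - i) * (n.choose i : ℝ) := by
    rw [add_pow, Finset.sum_range_succ]
    simp
  have hgeom : ∑ i ∈ Finset.range n, (n : ℝ) ^ i ≤ (n : ℝ) ^ n := by
    have h1 := mul_geom_sum (n : ℝ) n
    have h2 : (2 : ℝ) ≤ n := by exact_mod_cast hn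
    have h3 : 0 ≤ ∑ i ∈ Finset.range n, (n : ℝ) ^ i :=
      Finset.sum_nonneg fun _ _ => by positivity
    nlinarith
  rw [hsum]
  calc _ ≤ ∑ i ∈ Finset.range n, (v⁻¹) ^ n * (n : ℝ) ^ i := Finset.sum_le_sum hterm
    _ = (v⁻¹) ^ n * ∑ i ∈ Finset.range n, (n : ℝ) ^ i := by rw [Finset.mul_sum]
    _ ≤ (v⁻¹) ^ n * (n : ℝ) ^ n := by gcongr
    _ = _ := by rw [← mul_pow, hv]; congr 1; field_simp

theorem tsum_exp_abs {x : ℝ} (hx : 0 < x) :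
    ∑' k : ℤ, Real.exp (-(|(k : ℝ)| * x)) = 1 + 2 / (Real.exp x - 1) := by
  have hr : Real.exp (-x) < 1 := Real.exp_lt_one_iff.2 (by linarith)
  have hg : HasSum (fun k : ℕ => Real.exp (-(k * x))) (1 - Real.exp (-x))⁻¹ := by
    convert hasSum_geometric_of_lt_one (Real.exp_pos (-x)).le hr using 2 with k
    rw [← Real.exp_nat_mul]; congr 1; ring
  have h1 := HasSum.of_nat_of_neg (f := fun k : ℤ => Real.exp (-(|(k : ℝ)| * x)))
    (g := (1 - Real.exp (-x))⁻¹) (g' := (1 - Real.exp (-x))⁻¹)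
    (by simpa using hg) (by simpa using hg)
  rw [h1.tsum_eq, Real.exp_neg]
  have h2 := Real.add_one_lt_exp hx.ne'
  have h3 : Real.exp x - 1 ≠ 0 := by linarith
  have h4 := (Real.exp_pos x).ne'
  simp
  field_simp
  ring

/-- Passing from the sup norm to the `ℓ¹`-norm on a smaller strip. -/
theorem famBound_of_sup (hn : 2 ≤ n) {c : (Fin n → ℤ) → CVec n → ℂ} {U : Set (CVec n)}
    {s σ x : ℝ} (hx : 0 < x) (hσ : σ + x = s)
    (hc : ∀ y ∈ U, ∀ k, ‖c k y‖ * Real.exp (norm1 k * s) ≤ 1) :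
    FamBound c U σ (1 + (2 * n / x) ^ n) ∧ ∀ P : (Fin n → ℤ) → Prop, ¬ P 0 →
      FamBound (sel P c) U σ ((2 * n / x) ^ n) := by
  classical
  have h1 : ∀ y ∈ U, ∀ k, ‖c k y‖ * Real.exp (norm1 k * σ) ≤ Real.exp (-(norm1 k * x)) := by
    intro y hy k
    have h2 : Real.exp (norm1 k * σ) = Real.exp (norm1 k * s) * Real.exp (-(norm1 k * x)) := by
      rw [← Real.exp_add, ← hσ]; congr 1; ring
    rw [h2, ← mul_assoc]
    exact mul_le_of_le_one_left (Real.exp_pos _).le (hc y hy k)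
  have h3 : ∀ t : Finset (Fin n → ℤ), ∑ k ∈ t, Real.exp (-(norm1 k * x)) ≤
      1 + (2 * n / x) ^ n := fun t => by
    have h4 := sum_exp_norm1_le hx t
    have h5 := one_add_pow_sub_one_le hn hx
    rw [tsum_exp_abs hx] at h4
    linarith
  refine ⟨fun y hy t => (Finset.sum_le_sum fun k _ => h1 y hy k).trans (h3 t),
    fun P hP y hy t => ?_⟩
  have h6 : ∀ k ∈ t, ‖sel P c k y‖ * Real.exp (norm1 k * σ) ≤
      if k = 0 then 0 else Real.exp (-(norm1 k * x)) := by
    intro k _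
    by_cases hk : P k
    · rw [sel_pos hk, if_neg (by rintro rfl; exact hP hk)]
      exact h1 y hy k
    · rw [sel_neg hk]
      split_ifs <;> simp [(Real.exp_pos _).le]
  refine (Finset.sum_le_sum h6).trans ?_
  -- Adding the zero mode to the index set allows its contribution, exactly 1, to be subtracted from
  -- the bound for all modes.
  have h7 : ∑ k ∈ t, (if k = 0 then 0 else Real.exp (-(norm1 k * x))) ≤
      ∑ k ∈ insert 0 t, (if k = 0 then 0 else Real.exp (-(norm1 k * x))) :=
    Finset.sum_le_sum_of_subset_of_nonneg (Finset.subset_insert _ _) fun k _ _ => by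
      split_ifs <;> simp [(Real.exp_pos _).le]
  have h8 := h3 (insert 0 t)
  rw [← Finset.add_sum_erase _ _ (Finset.mem_insert_self 0 t)] at h7 h8
  have h9 : ∑ k ∈ (insert 0 t).erase 0, (if k = 0 then 0 else Real.exp (-(norm1 k * x))) =
      ∑ k ∈ (insert 0 t).erase 0, Real.exp (-(norm1 k * x)) :=
    Finset.sum_congr rfl fun k hk => if_neg (Finset.ne_of_mem_erase hk)
  rw [h9, if_pos rfl] at h7
  simp only [norm1_zero, zero_mul, neg_zero, Real.exp_zero] at h8
  linarith

/-- Families without modes of order at most `K` gain an exponential factor on smaller strips. -/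
theorem FamBound.high {c : (Fin n → ℤ) → CVec n → ℂ} {Λ : AddSubgroup (Fin n → ℤ)}
    {U : Set (CVec n)} {σ σ' C K : ℝ} (h : FamBound (highPart Λ K c) U σ C) (hσ : σ' ≤ σ) :
    FamBound (highPart Λ K c) U σ' (C * Real.exp (-(K * (σ - σ')))) := by
  intro y hy t
  have h1 : ∀ k ∈ t, ‖highPart Λ K c k y‖ * Real.exp (norm1 k * σ') ≤
      ‖highPart Λ K c k y‖ * Real.exp (norm1 k * σ) * Real.exp (-(K * (σ - σ'))) := by
    intro k _
    by_cases hk : k ∉ Λ ∧ K < norm1 k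
    · rw [mul_assoc, ← Real.exp_add]
      gcongr
      nlinarith [hk.2]
    · rw [highPart, sel_neg hk]; simp
  refine (Finset.sum_le_sum h1).trans ?_
  rw [← Finset.sum_mul]
  gcongr
  exact h y hy t

/-- The two-stage scheme is run on εf with b = ε(1 + A) for the resonant part, which contains the
zero mode, and w = εA for the two others, which do not. The strip is reduced to s(1 - 1/K) to reach
the ℓ¹-norm, again by 1 - 1/K through the scheme, and finally to half its first reduced width for
the remainder. -/
theorem normal_form (hn : 2 ≤ n) {D : Set (RVec n)} {ρ s a ε K A : ℝ}
    {Λ : AddSubgroup (Fin n → ℤ)} {h : CVec n → ℂ} {c : (Fin n → ℤ) → CVec n → ℂ}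
    (hρ : 0 < ρ) (hs : 0 < s) (hK : 2 ≤ K) (ha : 0 < a) (hε : 0 < ε)
    (hA : (2 * n * K / s) ^ n = A)
    (hh : DifferentiableOn ℂ h (nbhd D ρ)) (hc : FamHol c (nbhd D ρ))
    (hcb : ∀ y ∈ nbhd D ρ, ∀ k, ‖c k y‖ * Real.exp (norm1 k * s) ≤ 1)
    (hsd : ∀ y ∈ nbhd D ρ, ∀ l ∈ lowModes Λ K, a ≤ ‖fderiv ℂ h y (ivec l)‖)
    (hsm : 11520 * K * (K * s / 4 + 2) ^ 2 * (ε * (1 + A)) ≤ a * ρ * (s * (1 - 1 / K))) :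
    ∃ c' : (Fin n → ℤ) → CVec n → ℂ,
      Conjugate D h (fun k y => ε • c k y) ρ (s * (1 - 1 / K)) (fun k y => ε • c' k y) (ρ / 2)
        (s * (1 - 1 / K) ^ 2) ∧
      (∃ C, FamBound c' (nbhd D (ρ / 2)) (s * (1 - 1 / K) ^ 2) C) ∧
      FamBound (resPart Λ fun k y => c' k y - c k y) (nbhd D (ρ / 2)) (s * (1 - 1 / K) ^ 2)
        (2016 * K * A ^ 2 * ε / (a * ρ * (s * (1 - 1 / K)))) ∧
      ∃ C < 2 * A * Real.exp (-((K - 3) * s / 2)),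
        FamBound (sel (· ∉ Λ) c') (nbhd D (ρ / 2)) (s * (1 - 1 / K) / 2) C := by
  have hK0 : 0 < K := by linarith
  have hA0 : 0 < A := by
    rw [← hA]
    have : (0 : ℝ) < n := by exact_mod_cast (by omega : 0 < n)
    positivity
  have hK2 : 1 / K ≤ 1 / 2 := by gcongr
  set σ : ℝ := s * (1 - 1 / K) with hσd
  have hσ : 0 < σ := mul_pos hs (by linarith)
  have hx : (2 * n / (s / K) : ℝ) ^ n = A := by rw [← hA]; congr 1; field_simp
  obtain ⟨hb, hbs⟩ := famBound_of_sup hn (x := s / K) (σ := σ) (by positivity)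
    (by rw [hσd]; field_simp; ring) hcb
  rw [hx] at hb hbs
  set F : (Fin n → ℤ) → CVec n → ℂ := fun k y => ε • c k y with hF
  have hselF : ∀ (P : (Fin n → ℤ) → Prop) (C : ℝ), FamBound (sel P c) (nbhd D ρ) σ C →
      FamBound (sel P F) (nbhd D ρ) σ (ε * C) := fun P C hP => by
    have h1 := hP.const_smul ε
    rw [abs_of_pos hε] at h1
    refine h1.of_le fun k y _ => ?_
    by_cases hk : P k
    · rw [sel_pos hk, sel_pos hk]
    · rw [sel_neg hk, sel_neg hk]; simp
  -- From N ≥ Ks/4 and 1/8 ≤ e^{-2} one gets (1/8)^N ≤ e^{-Ks/2}, while N ≤ Ks/4 + 2 is what the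
  -- smallness hypothesis allows.
  set N : ℕ := ⌈K * s / 4⌉₊ + 1 with hN
  have hN1 : (N : ℝ) ≤ K * s / 4 + 2 := by
    have := Nat.ceil_lt_add_one (by positivity : 0 ≤ K * s / 4)
    rw [hN]; push_cast; linarith
  have hN2 : K * s / 4 ≤ N := by
    have := Nat.le_ceil (K * s / 4)
    rw [hN]; push_cast; linarith
  -- The choice of β covers b + 4w, and 288 · 5 · 8 = 11520 gives the constant of the smallness
  -- hypothesis.
  obtain ⟨c'', h1, h2, h3, h4⟩ := averaging_two_stage (Λ := Λ) (K := K) (a := a) (ρ := ρ) (σ := σ)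
    (c := F) (h := h) (D := D) (b := ε * (1 + A)) (w := ε * A) (β := 5 * (ε * (1 + A))) (N := N)
    hρ hσ hK ha (by positivity) (by positivity) (by nlinarith) (by omega) (by
      rw [mul_div_assoc', div_le_iff₀ (by positivity)]
      have h5 : (N : ℝ) ^ 2 ≤ (K * s / 4 + 2) ^ 2 := by gcongr
      have h6 : (N : ℝ) ^ 2 * (11520 * K * (ε * (1 + A))) ≤
        (K * s / 4 + 2) ^ 2 * (11520 * K * (ε * (1 + A))) := by gcongr
      linarith)
    hh (fun k => (hc k).const_smul ε) hsd (hselF _ _ hb.sel) (hselF _ _ (hbs _ fun h => h.1 Λ.zero_mem))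
    (hselF _ _ (hbs _ fun h => (mem_lowModes.1 h).1 Λ.zero_mem))
  have hσ' : σ * (1 - 1 / K) = s * (1 - 1 / K) ^ 2 := by rw [hσd]; ring
  rw [hσ'] at h1 h2 h3 h4
  set σ' : ℝ := s * (1 - 1 / K) ^ 2 with hσ'd
  have hsm' : (fun k y => ε • ((ε⁻¹ : ℝ) • c'' k y)) = c'' := by
    ext k y; rw [smul_smul, mul_inv_cancel₀ hε.ne', one_smul]
  have hback : ∀ (P : (Fin n → ℤ) → Prop) (C : ℝ), FamBound (sel P c'') (nbhd D (ρ / 2)) σ' C →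
      FamBound (sel P fun k y => (ε⁻¹ : ℝ) • c'' k y) (nbhd D (ρ / 2)) σ' (ε⁻¹ * C) :=
    fun P C hP => by
    have h1 := hP.const_smul ε⁻¹
    rw [abs_of_pos (inv_pos.2 hε)] at h1
    refine h1.of_le fun k y _ => ?_
    by_cases hk : P k
    · rw [sel_pos hk, sel_pos hk]
    · rw [sel_neg hk, sel_neg hk]; simp
  have hσσ' : σ' ≤ σ := by
    rw [← hσ']
    exact mul_le_of_le_one_right hσ.le (by have : 0 < 1 / K := by positivity
                                           linarith)
  have hlow := hback _ _ h3
  have hhigh := hback _ _ h4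
  have hres : FamBound (resPart Λ fun k y => (ε⁻¹ : ℝ) • c'' k y - c k y) (nbhd D (ρ / 2)) σ'
      (2016 * K * A ^ 2 * ε / (a * ρ * σ)) := by
    have h5 := h2.const_smul ε⁻¹
    rw [abs_of_pos (inv_pos.2 hε)] at h5
    refine (h5.mono (Subset.refl _) le_rfl (le_of_eq ?_)).of_le fun k y _ => le_of_eq ?_
    · field_simp; ring
    · by_cases hk : k ∈ Λ
      · rw [resPart, resPart, sel_pos hk, sel_pos hk, smul_sub, hF, smul_smul,
          inv_mul_cancel₀ hε.ne', one_smul]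
      · rw [resPart, resPart, sel_neg hk, sel_neg hk]; simp
  have hsub : nbhd D (ρ / 2) ⊆ nbhd D ρ := nbhd_mono (by linarith)
  refine ⟨fun k y => (ε⁻¹ : ℝ) • c'' k y, by rwa [hsm'], ?_, hres,
    ε⁻¹ * (3 / 2 * (ε * A)) * Real.exp (-(K * (σ' - σ / 2))) + ε⁻¹ * ((1 / 8) ^ N * (ε * A / 8)),
    ?_, ?_⟩
  · have h6 := FamBound.sel_of_sub hsub hσσ' (hb.sel (P := (· ∈ Λ))) hres
    have h7 := (h6.add hhigh).add hlow
    refine ⟨_, h7.of_le fun k y _ => le_of_eq ?_⟩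
    rw [← parts_add Λ K (fun k y => (ε⁻¹ : ℝ) • c'' k y)]
    simp only [resPart, highPart, lowPart]
  rotate_left
  · have hhalf : σ / 2 ≤ σ' := by rw [← hσ']; nlinarith
    have h8 := (FamBound.high hhigh hhalf).add (hlow.mono (Subset.refl _) hhalf le_rfl)
    refine h8.of_le fun k y _ => le_of_eq ?_
    by_cases hk : k ∈ Λ
    · rw [sel_neg (P := (· ∉ Λ)) (by simpa using hk), highPart, sel_neg fun h => h.1 hk,
        sel_neg (fun h => (mem_lowModes.1 h).1 hk)]
      simp
    · rw [sel_pos (P := (· ∉ Λ)) hk, ← parts_add Λ K (fun k y => (ε⁻¹ : ℝ) • c'' k y) k y, resPart, sel_neg hk, zero_add]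
      rfl
  -- The gain of the high modes between the strips σ' and σ/2; the quadratic (K - 1)(K - 2) produces
  -- the shift to K - 3.
  · have h9 : K * (σ' - σ / 2) = (K - 3) * s / 2 + s / K := by
      rw [hσ'd, hσd]; field_simp; ring
    have h10 : Real.exp (-(K * (σ' - σ / 2))) ≤ Real.exp (-((K - 3) * s / 2)) := by
      rw [h9]
      gcongr
      have : 0 < s / K := by positivity
      linarith
    have h11 : (1 / 8 : ℝ) ^ N ≤ Real.exp (-((K - 3) * s / 2)) := by
      have h12 : (1 / 8 : ℝ) ≤ Real.exp (-2) := by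
        rw [Real.exp_neg, one_div, inv_le_inv₀ (by norm_num) (Real.exp_pos _)]
        have := Real.exp_one_lt_d9
        have h13 : Real.exp 2 = Real.exp 1 * Real.exp 1 := by rw [← Real.exp_add]; norm_num
        rw [h13]
        nlinarith [Real.exp_pos 1]
      calc (1 / 8 : ℝ) ^ N ≤ Real.exp (-2) ^ N := by gcongr
        _ = Real.exp (-(2 * N)) := by rw [← Real.exp_nat_mul]; congr 1; ring
        _ ≤ _ := by gcongr; nlinarith
    have h14 : 0 < Real.exp (-((K - 3) * s / 2)) := Real.exp_pos _
    -- The high part contributes 3/2 and the low part 1/8, in total 13/8, strictly less than 2.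
    calc ε⁻¹ * (3 / 2 * (ε * A)) * Real.exp (-(K * (σ' - σ / 2))) +
          ε⁻¹ * ((1 / 8) ^ N * (ε * A / 8)) =
          3 / 2 * A * Real.exp (-(K * (σ' - σ / 2))) + A / 8 * (1 / 8) ^ N := by field_simp
      _ ≤ 3 / 2 * A * Real.exp (-((K - 3) * s / 2)) + A / 8 * Real.exp (-((K - 3) * s / 2)) := by
        gcongr
      _ < _ := by nlinarith [mul_pos hA0 h14]

end NormalForm

end Averaging
end

noncomputable section

namespace Averaging

open Metric Set Filter Topology MeasureTheory
open scoped Pointwise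

/-! ### Fourier coefficients and Fourier inversion. -/

section Fourier

variable {n : ℕ}

/-- Real angles as points of `ℂⁿ`. -/
def angle (θ : Fin n → ℝ) : CVec n := WithLp.toLp 2 fun j => ((θ j : ℝ) : ℂ)

theorem continuous_angle : Continuous (angle : (Fin n → ℝ) → CVec n) := by
  unfold angle
  fun_prop

theorem angle_mem_strip {s : ℝ} (hs : 0 < s) (θ : Fin n → ℝ) : angle θ ∈ strip n s := fun j => by
  simpa [angle] using hs

theorem fourierC_eq (f : CVec n → CVec n → ℂ) (k : Fin n → ℤ) (y : CVec n) :
    fourierC f k y = ((2 * Real.pi : ℝ) : ℂ)⁻¹ ^ n *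
      ∫ θ in Icc (0 : Fin n → ℝ) (fun _ => 2 * Real.pi), expK (-k) (angle θ) • f y (angle θ) := by
  rw [fourierC]
  congr 2
  ext θ
  rw [smul_eq_mul, mul_comm]
  congr 2
  simp [angle]

theorem integral_expK (k : Fin n → ℤ) :
    ∫ θ in Icc (0 : Fin n → ℝ) (fun _ => 2 * Real.pi), expK k (angle θ) =
      if k = 0 then ((2 * Real.pi : ℝ) : ℂ) ^ n else 0 := by
  have h1 : ∀ θ : Fin n → ℝ, expK k (angle θ) =
      ∏ j, Complex.exp (Complex.I * k j * (θ j : ℂ)) := fun θ => by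
    rw [expK, Finset.mul_sum, Complex.exp_sum]
    simp [angle, mul_assoc]
  simp only [h1]
  rw [← pi_univ_Icc, volume_pi, Measure.restrict_pi_pi,
    integral_fintype_prod_eq_prod fun j (t : ℝ) => Complex.exp (Complex.I * k j * (t : ℂ))]
  have h2 : ∀ m : ℤ, ∫ t in Icc (0 : ℝ) (2 * Real.pi), Complex.exp (Complex.I * m * (t : ℂ)) =
      if m = 0 then ((2 * Real.pi : ℝ) : ℂ) else 0 := fun m => by
    rw [integral_Icc_eq_integral_Ioc, ← intervalIntegral.integral_of_le (by positivity)]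
    split_ifs with hm
    · simp [hm]
    · rw [integral_exp_mul_complex (mul_ne_zero Complex.I_ne_zero (Int.cast_ne_zero.2 hm))]
      have : Complex.exp (Complex.I * m * ((2 * Real.pi : ℝ) : ℂ)) = 1 := by
        rw [Complex.exp_eq_one_iff]
        exact ⟨m, by push_cast; ring⟩
      rw [this]; simp
  simp only [Pi.zero_apply, h2]
  split_ifs with hk
  · simp [hk]
  · obtain ⟨j, hj⟩ := Function.ne_iff.1 hk
    exact Finset.prod_eq_zero (Finset.mem_univ j) (if_neg hj)

theorem continuous_expK (k : Fin n → ℤ) : Continuous (expK k) := by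
  unfold expK
  fun_prop

theorem norm_expK_angle (k : Fin n → ℤ) (θ : Fin n → ℝ) : ‖expK k (angle θ)‖ = 1 := by
  rw [expK, Complex.norm_exp]
  have : (Complex.I * ∑ j, (k j : ℂ) * angle θ j).re = 0 := by
    simp [angle]
  rw [this, Real.exp_zero]

/-- Fourier coefficients of a Fourier series. -/
theorem fourierC_evalFam {c : (Fin n → ℤ) → CVec n → ℂ} {U : Set (CVec n)} {σ C : ℝ}
    (hσ : 0 < σ) (hc : FamBound c U σ C) {y : CVec n} (hy : y ∈ U) (k : Fin n → ℤ) :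
    fourierC (fun y x => evalFam c (y, x)) k y = c k y := by
  rw [fourierC_eq]
  have hI : ∀ m, Integrable (fun θ => expK (-k) (angle θ) • (expK m (angle θ) • c m y))
      (volume.restrict (Icc (0 : Fin n → ℝ) (fun _ => 2 * Real.pi))) := fun m =>
    (Continuous.continuousOn (by
      have := continuous_expK (n := n)
      have := continuous_angle (n := n)
      fun_prop)).integrableOn_compact isCompact_Icc
  have hsum : Summable fun m => ‖c m y‖ := by
    refine Summable.of_nonneg_of_le (fun _ => norm_nonneg _) (fun m => ?_) (hc.summable hy)
    exact le_mul_of_one_le_right (norm_nonneg _)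
      (Real.one_le_exp (mul_nonneg (norm1_nonneg m) hσ.le))
  have h1 := hasSum_integral_of_summable_integral_norm hI (by
    simp only [smul_eq_mul, norm_mul, norm_expK_angle, one_mul, integral_const]
    exact hsum.mul_left _)
  have h2 : ∀ m, ∫ θ in Icc (0 : Fin n → ℝ) (fun _ => 2 * Real.pi),
      expK (-k) (angle θ) • (expK m (angle θ) • c m y) =
      if m = k then ((2 * Real.pi : ℝ) : ℂ) ^ n * c k y else 0 := fun m => by
    have h3 : ∀ θ : Fin n → ℝ, expK (-k) (angle θ) • (expK m (angle θ) • c m y) =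
        expK (m - k) (angle θ) * c m y := fun θ => by
      rw [sub_eq_neg_add, expK_add]; simp only [smul_eq_mul]; ring
    simp only [h3]
    rw [integral_mul_const, integral_expK]
    by_cases hm : m = k
    · simp [hm]
    · simp [hm, sub_eq_zero]
  simp only [h2] at h1
  have h4 := h1.unique (hasSum_ite_eq k (((2 * Real.pi : ℝ) : ℂ) ^ n * c k y))
  have h5 : ∀ θ : Fin n → ℝ, ∑' m, expK (-k) (angle θ) • (expK m (angle θ) • c m y) =
      expK (-k) (angle θ) • evalFam c (y, angle θ) := fun θ => by
    rw [evalFam, tsum_const_smul'']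
  simp only [h5] at h4
  rw [h4, inv_pow, inv_mul_cancel_left₀]
  exact pow_ne_zero _ (Complex.ofReal_ne_zero.2 (by positivity))

theorem famHol_fourierC {f : CVec n → CVec n → ℂ} {U : Set (CVec n)} {s : ℝ} (hs : 0 < s)
    (hU : IsOpen U) (hf : HolomorphicOnTorus f U s) : FamHol (fourierC f) U := by
  intro k
  have h1 := differentiableOn_integral (volume : Measure (Fin n → ℝ))
    (S := Icc 0 (fun _ => 2 * Real.pi)) isCompact_Icc (w := fun θ => expK (-k) (angle θ))
    ((continuous_expK _).comp continuous_angle) (p := angle) continuous_angle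
    (hU.prod (isOpen_strip s)) hf.holomorphic hU fun y hy θ _ => ⟨hy, angle_mem_strip hs θ⟩
  refine (h1.const_mul (((2 * Real.pi : ℝ) : ℂ)⁻¹ ^ n)).congr fun y _ => fourierC_eq f k y

/-- Continuous periodic functions descend to the torus. -/
theorem exists_torus_map {G : (Fin n → ℝ) → ℂ} (hG : Continuous G)
    (hp : ∀ (x : Fin n → ℝ) (m : Fin n → ℤ), G (fun i => x i + m i) = G x) :
    ∃ F : C(UnitAddTorus (Fin n), ℂ), ∀ x : Fin n → ℝ, F (fun i => (x i : UnitAddCircle)) = G x := by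
  have hq : IsOpenQuotientMap (Pi.map fun (_ : Fin n) (x : ℝ) => (x : UnitAddCircle)) :=
    IsOpenQuotientMap.piMap fun _ => QuotientAddGroup.isOpenQuotientMap_mk
  have hF : ∀ x, G (Function.surjInv hq.surjective (Pi.map (fun _ (x : ℝ) => (x : UnitAddCircle)) x))
      = G x := by
    intro x
    set x' := Function.surjInv hq.surjective (Pi.map (fun _ (x : ℝ) => (x : UnitAddCircle)) x)
    have h1 : Pi.map (fun (_ : Fin n) (x : ℝ) => (x : UnitAddCircle)) x' =
        Pi.map (fun _ (x : ℝ) => (x : UnitAddCircle)) x := Function.surjInv_eq hq.surjective _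
    have h2 : ∀ i, ∃ m : ℤ, m • (1 : ℝ) = x' i - x i := fun i => by
      rw [← AddCircle.coe_eq_zero_iff]
      have h3 : (x' i : UnitAddCircle) = (x i : UnitAddCircle) := congr_fun h1 i
      rw [AddCircle.coe_sub, h3, sub_self]
    choose m hm using h2
    rw [← hp x m]
    congr 1
    ext i
    have := hm i
    simp at this
    linarith
  refine ⟨⟨fun t => G (Function.surjInv hq.surjective t), ?_⟩, hF⟩
  rw [hq.isQuotientMap.continuous_iff]
  exact hG.congr fun x => (hF x).symm

theorem mFourier_coe (k : Fin n → ℤ) (x : Fin n → ℝ) :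
    UnitAddTorus.mFourier k (fun i => (x i : UnitAddCircle)) =
      expK k (angle ((2 * Real.pi) • x)) := by
  rw [expK, Finset.mul_sum, Complex.exp_sum]
  simp only [UnitAddTorus.mFourier, ContinuousMap.coe_mk]
  refine Finset.prod_congr rfl fun j _ => ?_
  rw [fourier_coe_apply]
  congr 1
  simp [angle]
  ring

/-- Fourier inversion at real angles. -/
theorem hasSum_fourierC_angle {f : CVec n → CVec n → ℂ} {U : Set (CVec n)} {s : ℝ} (hs : 0 < s)
    (hf : HolomorphicOnTorus f U s) {y : CVec n} (hy : y ∈ U)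
    (hsum : Summable fun k => ‖fourierC f k y‖) (θ : Fin n → ℝ) :
    HasSum (fun k => expK k (angle θ) • fourierC f k y) (f y (angle θ)) := by
  have hcont : Continuous fun θ : Fin n → ℝ => f y (angle θ) := by
    have h1 := hf.holomorphic.continuousOn
    exact h1.comp_continuous (continuous_const.prodMk continuous_angle)
      fun θ => ⟨hy, angle_mem_strip hs θ⟩
  obtain ⟨F, hF⟩ := exists_torus_map (G := fun x => f y (angle ((2 * Real.pi) • x)))
    (hcont.comp (continuous_const_smul _)) fun x m => by
      refine (congrArg (f y) ?_).trans (hf.periodic y hy _ (angle_mem_strip hs _) m)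
      ext j
      simp [angle, period]
      ring
  have hpi : (0 : ℝ) < 2 * Real.pi := by positivity
  have hcoef : ∀ k, UnitAddTorus.mFourierCoeff F k = fourierC f k y := fun k => by
    rw [UnitAddTorus.mFourierCoeff_eq_integral F k 0, fourierC_eq]
    simp only [mFourier_coe, hF]
    -- Rescaling the unit torus to angles in [0, 2π] produces the factor (2π)^{-n} of `fourierC`.
    rw [Measure.setIntegral_comp_smul_of_pos volume
      (fun θ => expK (-k) (angle θ) • f y (angle θ)) _ hpi]
    have hset : ((2 * Real.pi) • {x : Fin n → ℝ | ∀ i, x i ∈ Ioc ((0 : Fin n → ℝ) i)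
        ((0 : Fin n → ℝ) i + 1)} : Set (Fin n → ℝ)) = univ.pi fun _ => Ioc 0 (2 * Real.pi) := by
      ext x
      rw [mem_smul_set_iff_inv_smul_mem₀ hpi.ne']
      simp only [mem_ofPred_eq, mem_univ_pi, Pi.smul_apply, Pi.zero_apply, zero_add, mem_Ioc,
        smul_eq_mul]
      refine forall_congr' fun i => and_congr ?_ ?_
      · rw [mul_pos_iff_of_pos_left (inv_pos.2 hpi)]
      · rw [inv_mul_le_iff₀ hpi, mul_one]
    have hae : (univ.pi fun _ : Fin n => Ioc (0 : ℝ) (2 * Real.pi)) =ᵐ[volume]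
        Icc (0 : Fin n → ℝ) (fun _ => 2 * Real.pi) := by
      rw [volume_pi]
      exact Measure.univ_pi_Ioc_ae_eq_Icc (f := (0 : Fin n → ℝ))
    rw [hset, setIntegral_congr_set hae, Complex.real_smul, Module.finrank_fintype_fun_eq_card,
      Fintype.card_fin, Complex.ofReal_inv, Complex.ofReal_pow, inv_pow]
  have h2 := UnitAddTorus.hasSum_mFourier_series_apply_of_summable (f := F)
    (by rw [funext hcoef]; exact hsum.of_norm) (fun i => (((2 * Real.pi)⁻¹ • θ) i : UnitAddCircle))
  rw [hF] at h2
  simp only [hcoef, mFourier_coe, smul_inv_smul₀ hpi.ne'] at h2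
  simpa only [smul_eq_mul, mul_comm] using h2

theorem convex_strip (s : ℝ) : Convex ℝ (strip n s) := by
  intro x hx y hy a b ha hb hab j
  have h1 := hx j
  have h2 := hy j
  have h3 : ((a • x + b • y) j).im = a * (x j).im + b * (y j).im := by simp
  rw [h3]
  rw [abs_lt] at h1 h2 ⊢
  exact convex_Ioo (-s) s h1 h2 ha hb hab

/-- Fourier inversion. -/
theorem evalFam_fourierC {f : CVec n → CVec n → ℂ} {U : Set (CVec n)} {s σ C : ℝ}
    (hσ : 0 < σ) (hσs : σ ≤ s) (hU : IsOpen U) (hf : HolomorphicOnTorus f U s)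
    (hb : FamBound (fourierC f) U σ C) {y x : CVec n} (hy : y ∈ U) (hx : x ∈ strip n σ) :
    evalFam (fourierC f) (y, x) = f y x := by
  have hs : 0 < s := hσ.trans_le hσs
  have hsum : Summable fun m => ‖fourierC f m y‖ := by
    refine Summable.of_nonneg_of_le (fun _ => norm_nonneg _) (fun m => ?_) (hb.summable hy)
    exact le_mul_of_one_le_right (norm_nonneg _)
      (Real.one_le_exp (mul_nonneg (norm1_nonneg m) hσ.le))
  have hreal : ∀ θ : Fin n → ℝ, evalFam (fourierC f) (y, angle θ) = f y (angle θ) := fun θ =>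
    (hasSum_fourierC_angle hs hf hy hsum θ).tsum_eq
  -- Inversion is known at real angles only. On the complex line t ↦ a + tb, real t give real angles
  -- and t = i gives x; the parameters t that stay in the strip form a convex set, so the identity
  -- theorem carries the equality to t = i.
  set a : CVec n := angle fun j => (x j).re with ha
  set b : CVec n := angle fun j => (x j).im with hbd
  have hxab : x = a + Complex.I • b := by
    ext j
    simp only [ha, hbd, angle, PiLp.add_apply, PiLp.smul_apply, smul_eq_mul]
    rw [mul_comm]
    exact (Complex.re_add_im (x j)).symm
  set S : Set ℂ := (fun t : ℂ => t • b) ⁻¹' strip n σ with hS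
  have hSo : IsOpen S := (isOpen_strip σ).preimage (by fun_prop)
  have hSc : Convex ℝ S := (convex_strip σ).is_linear_preimage
    ⟨fun _ _ => add_smul _ _ _, fun c t => by simp [mul_smul]⟩
  have hmem : ∀ t : ℂ, t ∈ S → a + t • b ∈ strip n σ := fun t ht j => by
    have h1 := ht j
    have h2 : ((a + t • b) j).im = ((t • b) j).im := by simp [ha, angle]
    rwa [h2]
  have hmaps : ∀ t ∈ S, ((y, a + t • b) : CVec n × CVec n) ∈ U ×ˢ strip n σ := fun t ht =>
    ⟨hy, hmem t ht⟩
  have hd : ∀ g : CVec n × CVec n → ℂ, DifferentiableOn ℂ g (U ×ˢ strip n σ) →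
      DifferentiableOn ℂ (fun t : ℂ => g (y, a + t • b)) S := fun g hg =>
    hg.comp (by fun_prop) hmaps
  have hφ := ((hd _ (hb.differentiableOn_eval hU (famHol_fourierC hs hU hf))).sub
    (hd _ (hf.holomorphic.mono (prod_mono subset_rfl (strip_mono hσs))))).analyticOnNhd hSo
  have h0 : (0 : ℂ) ∈ S := by
    rw [hS, mem_preimage, zero_smul]
    intro j
    simpa using hσ
  have hI : Complex.I ∈ S := by
    intro j
    have : ((Complex.I • b) j).im = (x j).im := by simp [hbd, angle]
    rw [this]
    exact hx j
  have hfreq : ∃ᶠ t in 𝓝[≠] (0 : ℂ), evalFam (fourierC f) (y, a + t • b) - f y (a + t • b) = 0 := by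
    have h1 : Tendsto (fun t : ℝ => (t : ℂ)) (𝓝[≠] 0) (𝓝[≠] 0) := by
      refine tendsto_nhdsWithin_iff.2 ⟨?_, ?_⟩
      · exact (Complex.continuous_ofReal.tendsto' 0 0 Complex.ofReal_zero).mono_left
          nhdsWithin_le_nhds
      · filter_upwards [self_mem_nhdsWithin] with t ht
        simpa using ht
    refine h1.frequently (Eventually.frequently (Eventually.of_forall fun t => ?_))
    have h2 : a + (t : ℂ) • b = angle fun j => (x j).re + t * (x j).im := by
      ext j; simp [ha, hbd, angle]
    rw [h2, hreal, sub_self]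
  have h3 := hφ.eqOn_zero_of_preconnected_of_frequently_eq_zero hSc.isPreconnected h0 hfreq hI
  rw [hxab]
  simpa [sub_eq_zero] using h3

end Fourier

/-! ### Reality at all real points of the complex neighbourhood. -/

section Reality

variable {n : ℕ}

/-- A relation between two holomorphic functions on the real axis propagates. -/
theorem eq_conj_of_eventually {φ ψ : ℂ → ℂ} {R : ℝ} (hR : 1 < R)
    (hφ : DifferentiableOn ℂ φ (ball 0 R)) (hψ : DifferentiableOn ℂ ψ (ball 0 R))
    (h : ∀ᶠ t : ℝ in 𝓝 0, φ t = (starRingEnd ℂ) (ψ t)) : φ 1 = (starRingEnd ℂ) (ψ 1) := by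
  have hmem : ∀ t ∈ Icc (0 : ℝ) 1, (t : ℂ) ∈ ball (0 : ℂ) R := fun t ht => by
    rw [mem_ball_zero_iff, Complex.norm_real, Real.norm_of_nonneg ht.1]
    exact ht.2.trans_lt hR
  have han : ∀ g : ℂ → ℂ, DifferentiableOn ℂ g (ball 0 R) → ∀ t ∈ Icc (0 : ℝ) 1,
      AnalyticAt ℝ (fun t : ℝ => g t) t := fun g hg t ht =>
    ((hg.analyticOnNhd isOpen_ball _ (hmem t ht)).restrictScalars (𝕜 := ℝ)).comp
      (Complex.ofRealCLM.analyticAt t)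
  have h1 : AnalyticOnNhd ℝ (fun t : ℝ => φ t) (Icc 0 1) := han φ hφ
  have h2 : AnalyticOnNhd ℝ (fun t : ℝ => (starRingEnd ℂ) (ψ t)) (Icc 0 1) := fun t ht =>
    (Complex.conjCLE.toContinuousLinearMap.analyticAt _).comp (han ψ hψ t ht)
  have h3 := h1.eqOn_of_preconnected_of_eventuallyEq h2 isPreconnected_Icc
    (left_mem_Icc.2 zero_le_one) h
  simpa using h3 (right_mem_Icc.2 zero_le_one)

/-- The real part of a vector. -/
def reVec (z : CVec n) : RVec n := WithLp.toLp 2 fun j => (z j).re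

theorem toC_reVec {z : CVec n} (hz : IsRealVec z) : toC (reVec z) = z := by
  ext j
  simp only [toC, reVec]
  exact Complex.ext (by simp) (by simp [hz j])

theorem continuous_reVec : Continuous (reVec : CVec n → RVec n) := by
  unfold reVec
  fun_prop

theorem isRealVec_toC (y : RVec n) : IsRealVec (toC y) := fun j => by simp [toC]

theorem reVec_toC (y : RVec n) : reVec (toC y) = y := by
  ext j; simp [reVec, toC]

/-- A relation between two holomorphic functions on the neighbourhood of an open real set `D`,
valid at the points of `D`, holds at all real points. -/
theorem eq_conj_of_eqOn {D : Set (RVec n)} (hD : IsOpen D) {r : ℝ} {φ ψ : CVec n → ℂ}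
    (hφ : DifferentiableOn ℂ φ (nbhd D r)) (hψ : DifferentiableOn ℂ ψ (nbhd D r))
    (h : ∀ y ∈ D, φ (toC y) = (starRingEnd ℂ) (ψ (toC y))) {y : CVec n} (hy : y ∈ nbhd D r)
    (hyr : IsRealVec y) : φ y = (starRingEnd ℂ) (ψ y) := by
  obtain ⟨y₀, hy₀, hyy⟩ := hy
  -- A real point of D_r may lie outside D. The relation holds near the start of the real segment
  -- from y₀ to y, since D is open, and real-analyticity extends it to the end.
  set v := y - toC y₀ with hv
  have hvr : IsRealVec v := fun j => by simp [hv, hyr j, isRealVec_toC y₀ j]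
  obtain ⟨R, hR1, hR⟩ : ∃ R : ℝ, 1 < R ∧ R * ‖v‖ < r := by
    have h1 : Tendsto (fun R : ℝ => R * ‖v‖) (𝓝[>] 1) (𝓝 (1 * ‖v‖)) :=
      (continuous_id.mul continuous_const).continuousAt.tendsto.mono_left nhdsWithin_le_nhds
    rw [one_mul] at h1
    obtain ⟨R, h2, h3⟩ := ((h1.eventually (gt_mem_nhds hyy)).and self_mem_nhdsWithin).exists
    exact ⟨R, h3, h2⟩
  have hmaps : MapsTo (fun t : ℂ => toC y₀ + t • v) (ball 0 R) (nbhd D r) := fun t ht => by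
    refine ⟨y₀, hy₀, ?_⟩
    rw [mem_ball_zero_iff] at ht
    rw [add_sub_cancel_left, norm_smul]
    exact (mul_le_mul_of_nonneg_right ht.le (norm_nonneg _)).trans_lt hR
  have key := eq_conj_of_eventually hR1 (φ := fun t => φ (toC y₀ + t • v))
    (ψ := fun t => ψ (toC y₀ + t • v)) (hφ.comp (by fun_prop) hmaps)
    (hψ.comp (by fun_prop) hmaps) ?_
  · simpa [hv] using key
  · have hc : Continuous fun t : ℝ => reVec (toC y₀ + (t : ℂ) • v) :=
      continuous_reVec.comp (by fun_prop)
    have h0 : ∀ᶠ t : ℝ in 𝓝 0, reVec (toC y₀ + (t : ℂ) • v) ∈ D :=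
      hc.continuousAt.eventually_mem (hD.mem_nhds (by simpa [reVec_toC] using hy₀))
    filter_upwards [h0] with t ht
    have hr : IsRealVec (toC y₀ + (t : ℂ) • v) := fun j => by
      simp [isRealVec_toC y₀ j, hvr j]
    have := h _ ht
    rwa [toC_reVec hr] at this

theorem differentiableOn_freq {h : CVec n → ℂ} {U : Set (CVec n)} (hU : IsOpen U)
    (hh : DifferentiableOn ℂ h U) (j : Fin n) : DifferentiableOn ℂ (fun y => freq h y j) U :=
  differentiableOn_fderiv_apply hU hh _

theorem isRealVec_freq_toC {D : Set (RVec n)} (hD : IsOpen D) {r : ℝ} (hr : 0 < r)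
    {h : CVec n → ℂ} (hh : DifferentiableOn ℂ h (nbhd D r)) (hreal : ∀ y ∈ D, (h (toC y)).im = 0)
    {y : RVec n} (hy : y ∈ D) : IsRealVec (freq h (toC y)) := by
  intro j
  set U : Set (CVec n) := nbhd D r ∩ reVec ⁻¹' D with hU
  have hUo : IsOpen U := (isOpen_nbhd D r).inter (hD.preimage continuous_reVec)
  have h1 : FamReal conjℂ (fun _ : Fin n → ℤ => h) U := fun z hz hzr _ => by
    have h2 := hreal _ hz.2
    rw [toC_reVec hzr] at h2
    rw [conjℂ_apply, Complex.conj_eq_iff_im.2 h2]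
  have hyU : toC y ∈ U := ⟨⟨y, hy, by simpa using hr⟩, by simpa [reVec_toC] using hy⟩
  have h3 := h1.fderiv_apply hUo (fun _ => hh.mono inter_subset_left) hyU (isRealVec_toC y)
    (v := EuclideanSpace.single j 1) (fun i => by
      by_cases hij : i = j
      · subst hij; simp
      · simp [hij]) 0
  rw [conjℂ_apply] at h3
  exact Complex.conj_eq_iff_im.1 h3.symm

theorem isRealVec_freq {D : Set (RVec n)} (hD : IsOpen D) {r : ℝ} (hr : 0 < r)
    {h : CVec n → ℂ} (hh : DifferentiableOn ℂ h (nbhd D r)) (hreal : ∀ y ∈ D, (h (toC y)).im = 0)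
    {y : CVec n} (hy : y ∈ nbhd D r) (hyr : IsRealVec y) : IsRealVec (freq h y) := fun j =>
  Complex.conj_eq_iff_im.1 (eq_conj_of_eqOn hD (differentiableOn_freq (isOpen_nbhd _ _) hh j)
    (differentiableOn_freq (isOpen_nbhd _ _) hh j) (fun _ hy₀ =>
      (Complex.conj_eq_iff_im.2 (isRealVec_freq_toC hD hr hh hreal hy₀ j)).symm) hy hyr).symm

theorem famReal_fourierC {D : Set (RVec n)} (hD : IsOpen D) {r s : ℝ} (hs : 0 < s)
    {f : CVec n → CVec n → ℂ} (hf : HolomorphicOnTorus f (nbhd D r) s) (hfr : RealOn f D) :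
    FamReal conjℂ (fourierC f) (nbhd D r) := by
  intro y hy hyr k
  have hh := famHol_fourierC hs (isOpen_nbhd D r) hf
  refine eq_conj_of_eqOn hD (hh (-k)) (hh k) (fun y₀ hy₀ => ?_) hy hyr
  rw [fourierC_eq, fourierC_eq, map_mul, ← integral_conj]
  congr 1
  · rw [map_pow, map_inv₀, Complex.conj_ofReal]
  · congr 1
    ext θ
    have h1 : (starRingEnd ℂ) (f (toC y₀) (angle θ)) = f (toC y₀) (angle θ) :=
      Complex.conj_eq_iff_im.2 (hfr y₀ hy₀ (WithLp.toLp 2 θ))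
    have h2 : IsRealVec (angle θ) := fun j => by simp [angle]
    rw [smul_eq_mul, smul_eq_mul, map_mul, h1, conj_expK h2]

end Reality

end Averaging
end

noncomputable section

namespace Averaging

open Metric Set Filter Topology

/-! ### From families of coefficients back to functions. -/

section Functions

variable {n : ℕ}

theorem fourierC_congr {f g : CVec n → CVec n → ℂ} {y : CVec n}
    (h : ∀ θ, f y (angle θ) = g y (angle θ)) (k : Fin n → ℤ) : fourierC f k y = fourierC g k y := by
  rw [fourierC_eq, fourierC_eq]
  simp only [h]

theorem holomorphicOnTorus_evalFam {c : (Fin n → ℤ) → CVec n → ℂ} {U : Set (CVec n)} {σ C : ℝ}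
    (hU : IsOpen U) (hb : FamBound c U σ C) (hc : FamHol c U) :
    HolomorphicOnTorus (fun y x => evalFam c (y, x)) U σ where
  holomorphic := hb.differentiableOn_eval hU hc
  periodic y _ x _ m := evalFam_add_period c y x m

theorem proj_eq_evalFam (Λ : AddSubgroup (Fin n → ℤ)) (f : CVec n → CVec n → ℂ) (y x : CVec n) :
    proj Λ f y x = evalFam (resPart Λ (fourierC f)) (y, x) := by
  rw [proj, evalFam]
  have h1 := tsum_subtype (Λ : Set (Fin n → ℤ)) fun m => fourierC f m y * expK m x
  refine Eq.trans h1 (tsum_congr fun m => ?_)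
  by_cases hm : m ∈ Λ
  · rw [indicator_of_mem (by exact hm), resPart, sel_pos hm, smul_eq_mul, mul_comm]
  · rw [indicator_of_notMem (by exact hm), resPart, sel_neg hm, smul_zero]

theorem sumNorm_le {D : Set (RVec n)} {r s C : ℝ} {F : CVec n → CVec n → ℂ}
    {c : (Fin n → ℤ) → CVec n → ℂ} (hc : FamBound c (nbhd D r) s C)
    (hF : ∀ y ∈ nbhd D r, ∀ k, fourierC F k y = c k y) :
    sumNorm D r s F ≤ ENNReal.ofReal C := by
  refine iSup₂_le fun y hy => ?_
  simp only [hF y hy]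
  rw [← ENNReal.ofReal_tsum_of_nonneg (fun _ => by positivity) (hc.summable hy)]
  exact ENNReal.ofReal_le_ofReal ((hc.summable hy).tsum_le_of_sum_le (hc y hy))

theorem norm_fourierC_le {D : Set (RVec n)} {r s : ℝ} {f : CVec n → CVec n → ℂ}
    (hf : supNorm D r s f = 1) {y : CVec n} (hy : y ∈ nbhd D r) (k : Fin n → ℤ) :
    ‖fourierC f k y‖ * Real.exp (norm1 k * s) ≤ 1 := by
  have h1 : ENNReal.ofReal (‖fourierC f k y‖ * Real.exp (norm1 k * s)) ≤ supNorm D r s f :=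
    le_iSup_of_le k (le_iSup₂_of_le y hy le_rfl)
  rw [hf] at h1
  exact ENNReal.ofReal_le_one.1 h1

theorem nbhd_subset {D D' : Set (RVec n)} (hD : D ⊆ D') {r r' : ℝ} (hr : r ≤ r') :
    nbhd D r ⊆ nbhd D' r' := fun _ ⟨y, hy, h⟩ => ⟨y, hD hy, h.trans_le hr⟩

/-- The normal form for the coefficients of f, transported to the Hamiltonian: Fourier inversion is
applied at the image points of Ψ, whose angles lie in the strip of width s(1 - 1/K), where the
series of f converges absolutely. -/
theorem hamiltonian_normal_form {D D' : Set (RVec n)} {r s L Lbar a ε K A ρ : ℝ}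
    {Λ : AddSubgroup (Fin n → ℤ)} {h : CVec n → ℂ} {f : CVec n → CVec n → ℂ}
    (hA : AssumptionA D r h L Lbar) (hf : HolomorphicOnTorus f (nbhd D r) s)
    (hf1 : supNorm D r s f = 1) (hD : D' ⊆ D) (hρ : 0 < ρ) (hρr : ρ ≤ r) (hs : 0 < s)
    (hK : 2 ≤ K) (ha : 0 < a) (hε : 0 < ε) (hAK : (2 * n * K / s) ^ n = A)
    (hsd : ∀ y ∈ nbhd D' ρ, ∀ l ∈ lowModes Λ K, a ≤ ‖fderiv ℂ h y (ivec l)‖)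
    (hsm : 11520 * K * (K * s / 4 + 2) ^ 2 * (ε * (1 + A)) ≤ a * ρ * (s * (1 - 1 / K))) :
    ∃ (Ψ : CVec n × CVec n → CVec n × CVec n) (c : (Fin n → ℤ) → CVec n → ℂ),
      SymplecticChange Ψ (nbhd D' (ρ / 2)) (s * (1 - 1 / K) ^ 2) (nbhd D' ρ) (s * (1 - 1 / K)) ∧
      (RealOn f D → PreservesReal Ψ (nbhd D' (ρ / 2))) ∧
      FamHol c (nbhd D' (ρ / 2)) ∧
      (∃ C, FamBound c (nbhd D' (ρ / 2)) (s * (1 - 1 / K) ^ 2) C) ∧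
      (∀ y ∈ nbhd D' (ρ / 2), ∀ x ∈ strip n (s * (1 - 1 / K) ^ 2),
        Ham h ε f (Ψ (y, x)) = h y + ε * evalFam c (y, x)) ∧
      FamBound (resPart Λ fun k y => c k y - fourierC f k y) (nbhd D' (ρ / 2))
        (s * (1 - 1 / K) ^ 2) (2016 * K * A ^ 2 * ε / (a * ρ * (s * (1 - 1 / K)))) ∧
      ∃ C < 2 * A * Real.exp (-((K - 3) * s / 2)),
        FamBound (sel (· ∉ Λ) c) (nbhd D' (ρ / 2)) (s * (1 - 1 / K) / 2) C := by
  have hr : 0 < r := hρ.trans_le hρr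
  have hsub : nbhd D' ρ ⊆ nbhd D r := nbhd_subset hD hρr
  have hfh := famHol_fourierC hs (isOpen_nbhd D r) hf
  have hK0 : 0 < K := by linarith
  have hK2 : 1 / K ≤ 1 / 2 := by gcongr
  have hK1 : 0 < 1 / K := by positivity
  have hσ : 0 < s * (1 - 1 / K) := mul_pos hs (by linarith)
  have hσs : s * (1 - 1 / K) ≤ s := mul_le_of_le_one_right hs.le (by linarith)
  obtain ⟨c, ⟨Ψ, hΨ, hΨr, hc, hΨe⟩, ⟨C, hC⟩, hres, hrem⟩ := normal_form hA.two_le hρ hs hK ha hε hAK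
    (hA.holomorphic.mono hsub) (hfh.mono hsub)
    (fun y hy k => norm_fourierC_le hf1 (hsub hy) k) hsd hsm
  have hbf := (famBound_of_sup hA.two_le (x := s / K) (σ := s * (1 - 1 / K)) (by positivity)
    (by field_simp; ring) fun y hy k => norm_fourierC_le hf1 hy k).1
  have hcε : (fun k y => (ε⁻¹ : ℝ) • ε • c k y) = c := by
    ext k y; rw [smul_smul, inv_mul_cancel₀ hε.ne', one_smul]
  have hch : FamHol c (nbhd D' (ρ / 2)) := fun k => by
    have := (hc k).const_smul (ε⁻¹ : ℝ)
    rw [← hcε]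
    exact this
  refine ⟨Ψ, c, hΨ, fun hfr => ?_, hch, ⟨C, hC⟩, fun y hy x hx => ?_, hres, hrem⟩
  · refine (hΨr (fun y hy hyr => isRealVec_freq hA.isOpen hr hA.holomorphic hA.real (hsub hy) hyr)
      fun y hy hyr k => ?_).1
    change ε • fourierC f (-k) y = conjℂ (ε • fourierC f k y)
    rw [famReal_fourierC hA.isOpen hs hf hfr y (hsub hy) hyr k]
    simp [conjℂ_apply]
  · have h1 := hΨ.mapsTo (mk_mem_prod hy hx)
    have h2 := hΨe (y, x) (mk_mem_prod hy hx)
    rw [evalFam_smul, evalFam_smul, Complex.real_smul, Complex.real_smul] at h2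
    rw [Ham, ← evalFam_fourierC hσ hσs (isOpen_nbhd D r) hf hbf (hsub h1.1) h1.2]
    exact h2

end Functions

/-! ### Small divisors. -/

section SmallDivisors

variable {n : ℕ}

theorem norm_ivec (k : Fin n → ℤ) : ‖ivec k‖ = ‖intVec k‖ := by
  simp [EuclideanSpace.norm_eq, intVec]

theorem norm_intVec_le (k : Fin n → ℤ) : ‖intVec k‖ ≤ norm1 k := by
  rw [← norm_ivec]; exact norm_ivec_le k

theorem norm_kdot_le (k : Fin n → ℤ) (v : CVec n) : ‖kdot k v‖ ≤ ‖intVec k‖ * ‖v‖ := by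
  have h1 : kdot k v = inner ℂ (ivec k) v := by
    rw [kdot_apply, PiLp.inner_apply]
    simp [mul_comm]
  rw [h1, ← norm_ivec]
  exact norm_inner_le_norm _ _

/-- Every non-zero integer vector is a multiple of a generator. -/
theorem exists_generator {l : Fin n → ℤ} (hl : l ≠ 0) :
    ∃ (m : ℤ) (k : Fin n → ℤ), l = m • k ∧ m ≠ 0 ∧ k ∈ generators n (norm1 l) := by
  obtain ⟨j₀, hj₀⟩ := Function.ne_iff.1 hl
  obtain ⟨g, hg, hg1⟩ := Finset.extract_gcd (s := Finset.univ) l ⟨j₀, Finset.mem_univ _⟩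
  set d := Finset.univ.gcd l with hd
  have hd0 : d ≠ 0 := fun h0 => hj₀ (by simpa [h0] using hg j₀ (Finset.mem_univ _))
  have hgl : l = d • g := by ext j; simpa using hg j (Finset.mem_univ j)
  have hg0 : ∃ j, g j ≠ 0 := ⟨j₀, fun h0 => hj₀ (by rw [hgl]; simp [h0])⟩
  have hfin : {j | g j ≠ 0}.Nonempty := hg0
  obtain ⟨j, hj, hjmin⟩ := WellFounded.has_min (wellFounded_lt (α := Fin n)) _ hfin
  have hbefore : ∀ i < j, g i = 0 := fun i hi => by
    by_contra h0
    exact hjmin i h0 hi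
  have hle : ∀ m : ℤ, ∀ k : Fin n → ℤ, m ≠ 0 → l = m • k → norm1 k ≤ norm1 l := by
    intro m k hm hlk
    rw [hlk]
    refine Finset.sum_le_sum fun i _ => ?_
    have : (1 : ℝ) ≤ |(m : ℝ)| := by exact_mod_cast Int.one_le_abs hm
    simp only [Pi.smul_apply, smul_eq_mul, Int.cast_mul, abs_mul]
    exact le_mul_of_one_le_left (abs_nonneg _) this
  rcases lt_or_gt_of_ne hj with hneg | hpos
  · have h1 : l = (-d) • (-g) := by rw [neg_smul_neg, ← hgl]
    refine ⟨-d, -g, h1, neg_ne_zero.2 hd0, ⟨j, by simpa using hneg, fun i hi => by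
      simp [hbefore i hi]⟩, ?_, hle _ _ (neg_ne_zero.2 hd0) h1⟩
    have h2 := Finset.gcd_mul_left (s := Finset.univ) (f := g) (a := (-1 : ℤ))
    simp only [neg_mul, one_mul, hg1, mul_one] at h2
    exact h2
  · exact ⟨d, g, hgl, hd0, ⟨j, hpos, hbefore⟩, hg1, hle _ _ hd0 hgl⟩

theorem kdot_freq_toC {D : Set (RVec n)} (hD : IsOpen D) {r : ℝ} (hr : 0 < r)
    {h : CVec n → ℂ} (hh : DifferentiableOn ℂ h (nbhd D r)) (hreal : ∀ y ∈ D, (h (toC y)).im = 0)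
    {y : RVec n} (hy : y ∈ D) (k : Fin n → ℤ) :
    kdot k (freq h (toC y)) = ((inner ℝ (realFreq h y) (intVec k) : ℝ) : ℂ) := by
  rw [kdot_apply, PiLp.inner_apply]
  push_cast
  refine Finset.sum_congr rfl fun j _ => ?_
  have h1 := isRealVec_freq_toC hD hr hh hreal hy j
  have h2 : freq h (toC y) j = ((realFreq h y j : ℝ) : ℂ) :=
    Complex.ext (by simp [realFreq]) (by simp [h1])
  rw [h2]
  simp [intVec]

/-- A lower bound on a divisor at a real point persists on a complex neighbourhood. -/
theorem le_norm_fderiv_ivec {D : Set (RVec n)} {r L Lbar ρ a δ : ℝ} {h : CVec n → ℂ}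
    (hA : AssumptionA D r h L Lbar) (hρr : ρ ≤ r) {y : CVec n} {y₀ : RVec n}
    (hy₀ : y₀ ∈ D) (hyy : ‖y - toC y₀‖ < ρ) {l k : Fin n → ℤ} {m : ℤ} (hm : m ≠ 0)
    (hl : l = m • k) (hk : a + δ ≤ |inner ℝ (realFreq h y₀) (intVec k)|)
    (hδ : ‖intVec k‖ * (L * ρ) ≤ δ) : a ≤ ‖fderiv ℂ h y (ivec l)‖ := by
  have hρ : 0 < ρ := (norm_nonneg _).trans_lt hyy
  have hr : 0 < r := hρ.trans_le hρr
  have h1 : ivec l = (m : ℂ) • ivec k := by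
    ext j; simp [hl]
  rw [h1, map_smul, norm_smul, ← kdot_freq]
  have h2 : (1 : ℝ) ≤ ‖(m : ℂ)‖ := by
    rw [Complex.norm_intCast]
    exact_mod_cast Int.one_le_abs hm
  refine le_trans ?_ (le_mul_of_one_le_left (norm_nonneg _) h2)
  have h3 : kdot k (freq h y) = kdot k (freq h (toC y₀)) + kdot k (freq h y - freq h (toC y₀)) := by
    rw [map_sub]; ring
  have h4 : ‖kdot k (freq h y - freq h (toC y₀))‖ ≤ δ := by
    refine (norm_kdot_le k _).trans (le_trans ?_ hδ)
    gcongr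
    refine (hA.lipschitz y ⟨y₀, hy₀, hyy.trans_le hρr⟩ _ ⟨y₀, hy₀, by simpa using hr⟩).trans ?_
    have := hA.L_pos
    gcongr
  have h5 : ‖kdot k (freq h (toC y₀))‖ = |inner ℝ (realFreq h y₀) (intVec k)| := by
    rw [kdot_freq_toC hA.isOpen hr hA.holomorphic hA.real hy₀, Complex.norm_real, Real.norm_eq_abs]
  have h6 := norm_sub_norm_le (kdot k (freq h (toC y₀)))
    (-kdot k (freq h y - freq h (toC y₀)))
  rw [norm_neg, sub_neg_eq_add, ← h3] at h6
  linarith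

/-- Small divisors in the non-resonant region. -/
theorem smallDivisor_D0 {D : Set (RVec n)} {r L Lbar α K : ℝ} {h : CVec n → ℂ}
    (hA : AssumptionA D r h L Lbar) (hα : 0 < α) (hK : 0 < K) (hr : α / (4 * L * K) ≤ r) :
    ∀ y ∈ nbhd (D0 D h α K) (α / (4 * L * K)), ∀ l ∈ lowModes ⊥ K,
      α / 4 ≤ ‖fderiv ℂ h y (ivec l)‖ := by
  rintro y ⟨y₀, ⟨hy₀, -, hnr⟩, hyy⟩ l hl
  obtain ⟨hl0, hlK⟩ := mem_lowModes.1 hl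
  obtain ⟨m, k, hlk, hm, hk1, hk2, hk3⟩ := exists_generator (l := l) (by simpa using hl0)
  have hL := hA.L_pos
  have h1 := hnr k ⟨hk1, hk2, hk3.trans hlK⟩
  -- Of the lower bound α/2 at real points, half is spent on the complex neighbourhood, where |k| L
  -- r₀ ≤ α/4.
  refine le_norm_fderiv_ivec hA hr hy₀ hyy hm hlk (δ := α / 4) (by linarith) ?_
  calc ‖intVec k‖ * (L * (α / (4 * L * K))) ≤ K * (L * (α / (4 * L * K))) := by
        gcongr
        exact (norm_intVec_le k).trans (hk3.trans hlK)
    _ = α / 4 := by field_simp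

/-- Small divisors in the simply resonant regions. -/
theorem smallDivisor_D1k {D : Set (RVec n)} {r L Lbar α K : ℝ} {h : CVec n → ℂ}
    (hA : AssumptionA D r h L Lbar) (hα : 0 < α) (hK : 0 < K) {k : Fin n → ℤ}
    (hk : 0 < ‖intVec k‖) (hr : α / (L * ‖intVec k‖) ≤ r) :
    ∀ y ∈ nbhd (D1k D h α K k) (α / (L * ‖intVec k‖)),
      ∀ l ∈ lowModes (AddSubgroup.zmultiples k) K,
      α * K / ‖intVec k‖ ≤ ‖fderiv ℂ h y (ivec l)‖ := by
  rintro y ⟨y₀, ⟨hy₀, hres, -, hnr⟩, hyy⟩ l hl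
  obtain ⟨hl0, hlK⟩ := mem_lowModes.1 hl
  obtain ⟨m, l', hlk, hm, hk1, hk2, hk3⟩ := exists_generator (l := l) (by
    rintro rfl; exact hl0 (AddSubgroup.zero_mem _))
  have hL := hA.L_pos
  have hl' : l' ∉ AddSubgroup.zmultiples k := fun h => hl0 (by
    rw [hlk]; exact AddSubgroup.zsmul_mem _ h m)
  have h1 := hnr l' ⟨hk1, hk2, hk3.trans hlK⟩ hl'
  have hlK' : ‖intVec l'‖ ≤ K := (norm_intVec_le l').trans (hk3.trans hlK)
  set ω := realFreq h y₀ with hω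
  set N := ‖intVec k‖ with hN
  -- The factor 3 in the definition of the zone is used up as follows: one αK/|k| for the component
  -- of ω along k, small because |ω·k| < α, one for the passage to complex y, and one is left as the
  -- bound.
  have h2 : inner ℝ (perp k ω) (intVec l') =
      inner ℝ ω (intVec l') - inner ℝ ω (intVec k) / N ^ 2 * inner ℝ (intVec k) (intVec l') := by
    rw [perp, inner_sub_left, real_inner_smul_left]
  have h3 : |inner ℝ ω (intVec k) / N ^ 2 * inner ℝ (intVec k) (intVec l')| ≤ α * K / N := by
    rw [abs_mul, abs_div, abs_of_pos (pow_pos hk 2)]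
    have h4 := abs_real_inner_le_norm (intVec k) (intVec l')
    calc _ ≤ α / N ^ 2 * (N * K) := by gcongr; exact h4.trans (by gcongr)
      _ = _ := by field_simp
  refine le_norm_fderiv_ivec hA hr hy₀ hyy hm hlk (δ := α * K / N) ?_ ?_
  · have h5 := abs_sub (inner ℝ ω (intVec l'))
      (inner ℝ ω (intVec k) / N ^ 2 * inner ℝ (intVec k) (intVec l'))
    rw [← h2] at h5
    have h6 : 3 * α * K / N = 3 * (α * K / N) := by ring
    rw [h6] at h1
    linarith
  · calc ‖intVec l'‖ * (L * (α / (L * N))) ≤ K * (L * (α / (L * N))) := by gcongr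
      _ = α * K / N := by field_simp

theorem one_le_norm_intVec {k : Fin n → ℤ} (hk : k ≠ 0) : 1 ≤ ‖intVec k‖ := by
  obtain ⟨j, hj⟩ := Function.ne_iff.1 hk
  have h1 : (1 : ℝ) ≤ |(k j : ℝ)| := by exact_mod_cast Int.one_le_abs (by simpa using hj)
  exact h1.trans (by simpa [intVec] using PiLp.norm_apply_le (intVec k) j)

end SmallDivisors

end Averaging
end

noncomputable section

namespace Averaging

open Metric Set Filter Topology

/-! ### Arithmetic of the constants. -/

section Constants

variable {n : ℕ}

theorem alpha_sq {ε K ν : ℝ} (hε : 0 < ε) (hK : 0 < K) : alpha ε K ν ^ 2 = ε * K ^ (2 * ν) := by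
  rw [alpha, mul_pow, Real.sq_sqrt hε.le, mul_comm 2 ν, Real.rpow_mul hK.le]
  norm_cast

theorem alpha_pos {ε K ν : ℝ} (hε : 0 < ε) (hK : 0 < K) : 0 < alpha ε K ν :=
  mul_pos (Real.sqrt_pos.2 hε) (Real.rpow_pos_of_pos hK _)

/-- The smallness of ε says exactly this; it puts the radii r₀ and r_k below r. -/
theorem alpha_le {ε K ν L r : ℝ} (hε : 0 < ε) (hK : 0 < K) (hL : 0 < L) (hr : 0 < r)
    (h : ε ≤ (L * r) ^ 2 / K ^ (2 * ν)) : alpha ε K ν ≤ L * r := by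
  rw [le_div_iff₀ (Real.rpow_pos_of_pos hK _), ← alpha_sq hε hK] at h
  exact le_of_sq_le_sq h (by positivity)

/-- The largeness condition on `K` in terms of the `ℓ¹`-bound of the perturbation. -/
theorem rpow_lower_bound {s L K ν : ℝ} (hs : 0 < s) (hK : 0 < K)
    (h : 2 ^ (13 + n) * (n : ℝ) ^ n * (L * Real.exp (s / 2) / s ^ (n + 1)) ≤
      K ^ (2 * ν - (n : ℝ) - 4)) :
    2 ^ 13 * (L / s) * (2 * n * K / s) ^ n * Real.exp (s / 2) * K ^ 4 ≤ K ^ (2 * ν) := by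
  have h1 : K ^ (2 * ν) = K ^ (2 * ν - (n : ℝ) - 4) * K ^ (n + 4) := by
    rw [← Real.rpow_natCast K (n + 4), ← Real.rpow_add hK]
    congr 1; push_cast; ring
  rw [h1]
  refine le_trans (le_of_eq ?_) (mul_le_mul_of_nonneg_right h (by positivity))
  rw [div_pow, mul_pow, mul_pow, pow_add 2 13 n, pow_succ s n, pow_add K n 4]
  field_simp

theorem rpow_theta {K ν : ℝ} (hK : 0 < K) :
    1 / K ^ (2 * ν - 2 * (n : ℝ) - 3) = K ^ (2 * n + 3) / K ^ (2 * ν) := by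
  have h1 : K ^ (2 * ν) = K ^ (2 * ν - 2 * (n : ℝ) - 3) * K ^ (2 * n + 3) := by
    rw [← Real.rpow_natCast K (2 * n + 3), ← Real.rpow_add hK]
    congr 1; push_cast; ring
  have := Real.rpow_pos_of_pos hK (2 * ν - 2 * (n : ℝ) - 3)
  rw [h1]
  field_simp

/-- With A = (2nK/s)^n, the product with A is absorbed by (s/4 + 1)² ≤ e^{s/2}. For the summand 1,
which matters when s is large and A small, one uses (s/4 + 1)² ≤ 4e^{s/4} and Ae^{s/4} ≥ (K/2)^n ≥
9. Together 1 + 4/9 = 13/9. -/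
theorem exp_lower_bound (hn : 2 ≤ n) {s K : ℝ} (hs : 0 < s) (hK : 6 ≤ K) :
    (s / 4 + 1) ^ 2 * (1 + (2 * n * K / s) ^ n) ≤
      13 / 9 * ((2 * n * K / s) ^ n * Real.exp (s / 2)) := by
  have hn0 : (0 : ℝ) < n := by exact_mod_cast (by omega : 0 < n)
  set A : ℝ := (2 * n * K / s) ^ n with hA
  have hA0 : 0 < A := by positivity
  have h1 : (s / 4 + 1) ^ 2 ≤ Real.exp (s / 2) := by
    have h2 := Real.add_one_le_exp (s / 4)
    calc (s / 4 + 1) ^ 2 ≤ Real.exp (s / 4) ^ 2 := by gcongr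
      _ = _ := by rw [← Real.exp_nat_mul]; congr 1; push_cast; ring
  have h3 : (s / 4 + 1) ^ 2 ≤ 4 * Real.exp (s / 4) := by
    have h2 := Real.add_one_le_exp (s / 8)
    calc (s / 4 + 1) ^ 2 ≤ (2 * Real.exp (s / 8)) ^ 2 := by gcongr; linarith
      _ = 4 * Real.exp (s / 8) ^ 2 := by ring
      _ = _ := by rw [← Real.exp_nat_mul]; congr 2; push_cast; ring
  have h4 : 9 ≤ A * Real.exp (s / 4) := by
    have h5 : (s / (4 * n)) ^ n ≤ Real.exp (s / 4) := by
      have h6 : s / (4 * n) ≤ Real.exp (s / (4 * n)) := by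
        have := Real.add_one_le_exp (s / (4 * n))
        linarith
      calc (s / (4 * n)) ^ n ≤ Real.exp (s / (4 * n)) ^ n := by gcongr
        _ = _ := by rw [← Real.exp_nat_mul]; congr 1; field_simp
    calc (9 : ℝ) = 3 ^ 2 := by norm_num
      _ ≤ 3 ^ n := pow_le_pow_right₀ (by norm_num) hn
      _ ≤ (K / 2) ^ n := by gcongr; linarith
      _ = A * (s / (4 * n)) ^ n := by
        rw [hA, ← mul_pow]; congr 1; field_simp; norm_num
      _ ≤ _ := by gcongr
  have h7 : Real.exp (s / 2) = Real.exp (s / 4) * Real.exp (s / 4) := by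
    rw [← Real.exp_add]; congr 1; ring
  have h8 : (s / 4 + 1) ^ 2 ≤ 4 / 9 * (A * Real.exp (s / 2)) := by
    rw [h7]
    nlinarith [Real.exp_pos (s / 4)]
  nlinarith

/-- Lower bound of the product of small divisor and analyticity radii, resonant case. -/
theorem resonant_product_bound {ε s L K P α N : ℝ} (hε : 0 < ε) (hs : 0 < s) (hL : 0 < L)
    (hK : 6 ≤ K) (hP : 0 < P) (hα : α ^ 2 = ε * P) (hN : 0 < N) (hNK : 3 * N ≤ K) :
    15 / 2 * (ε * P * s / (L * K)) ≤ α * K / N * (α / (L * N)) * (s * (1 - 1 / K)) := by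
  have hK0 : 0 < K := by linarith
  have h1 : α * K / N * (α / (L * N)) * (s * (1 - 1 / K)) =
      (ε * P * s / (L * K)) * ((K - 1) * K / N ^ 2) := by
    have : α * K / N * (α / (L * N)) = α ^ 2 * K / (L * N ^ 2) := by field_simp
    rw [this, hα]
    field_simp
  rw [h1, mul_comm]
  refine mul_le_mul_of_nonneg_left ?_ (by positivity)
  -- From K ≥ 3N and K ≥ 6: (K/N)² (1 - 1/K) ≥ 9 · 5/6 = 15/2.
  rw [le_div_iff₀ (by positivity)]
  nlinarith

theorem nonresonant_product_bound {ε s L K P α : ℝ} (hε : 0 < ε) (hs : 0 < s) (hL : 0 < L)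
    (hK : 2 ≤ K) (hP : 0 < P) (hα : α ^ 2 = ε * P) :
    ε * P * s / (32 * L * K) ≤ α / 4 * (α / (4 * L * K)) * (s * (1 - 1 / K)) := by
  have hK0 : 0 < K := by linarith
  have h1 : α / 4 * (α / (4 * L * K)) * (s * (1 - 1 / K)) =
      (ε * P * s / (32 * L * K)) * (2 * (1 - 1 / K)) := by
    have : α / 4 * (α / (4 * L * K)) = α ^ 2 / (16 * L * K) := by field_simp; norm_num
    rw [this, hα]
    field_simp
    ring
  have h2 : 1 / K ≤ 1 / 2 := by gcongr
  rw [h1]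
  exact le_mul_of_one_le_right (by positivity) (by linarith)

/-- The smallness condition of the normal form, resonant case. -/
theorem resonant_smallness (hn : 2 ≤ n) {ε s L K P α N : ℝ} (hε : 0 < ε) (hs : 0 < s)
    (hL : 0 < L) (hK : 6 ≤ K)
    (hP : 2 ^ 13 * (L / s) * (2 * n * K / s) ^ n * Real.exp (s / 2) * K ^ 4 ≤ P)
    (hα : α ^ 2 = ε * P) (hN : 0 < N) (hNK : 3 * N ≤ K) :
    11520 * K * (K * s / 4 + 2) ^ 2 * (ε * (1 + (2 * n * K / s) ^ n)) ≤
      α * K / N * (α / (L * N)) * (s * (1 - 1 / K)) := by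
  have hK0 : 0 < K := by linarith
  have hn0 : (0 : ℝ) < n := by exact_mod_cast (by omega : 0 < n)
  have hexp := exp_lower_bound hn hs hK
  set A : ℝ := (2 * n * K / s) ^ n with hA
  set E : ℝ := Real.exp (s / 2)
  have hA0 : 0 < A := by positivity
  have hE0 : 0 < E := Real.exp_pos _
  have hP0 : 0 < P := lt_of_lt_of_le (by positivity) hP
  refine le_trans ?_ (resonant_product_bound hε hs hL hK hP0 hα hN hNK)
  calc 11520 * K * (K * s / 4 + 2) ^ 2 * (ε * (1 + A)) ≤
        11520 * K * (K * (s / 4 + 1)) ^ 2 * (ε * (1 + A)) := by gcongr; linarith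
    _ = 11520 * K ^ 3 * ε * ((s / 4 + 1) ^ 2 * (1 + A)) := by ring
    _ ≤ 11520 * K ^ 3 * ε * (13 / 9 * (A * E)) := by gcongr
    _ = 16640 * (K ^ 3 * ε * (A * E)) := by ring
    _ ≤ 61440 * (K ^ 3 * ε * (A * E)) := by gcongr; norm_num
    _ = 15 / 2 * (ε * (2 ^ 13 * (L / s) * A * E * K ^ 4) * s / (L * K)) := by field_simp; norm_num
    _ ≤ _ := by gcongr

/-- The smallness condition of the normal form, non-resonant case. -/
theorem nonresonant_smallness (hn : 2 ≤ n) {ε s L K K' P α : ℝ} (hε : 0 < ε) (hs : 0 < s)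
    (hL : 0 < L) (hK : 2 ≤ K) (hKK : 3 * K ≤ K')
    (hP : 2 ^ 13 * (L / s) * (2 * n * K' / s) ^ n * Real.exp (s / 2) * K' ^ 4 ≤ P)
    (hα : α ^ 2 = ε * P) :
    11520 * K * (K * s / 4 + 2) ^ 2 * (ε * (1 + (2 * n * K / s) ^ n)) ≤
      α / 4 * (α / (4 * L * K)) * (s * (1 - 1 / K)) := by
  have hK0 : 0 < K := by linarith
  have hK'0 : 0 < K' := by linarith
  have hn0 : (0 : ℝ) < n := by exact_mod_cast (by omega : 0 < n)
  have hexp := exp_lower_bound hn hs (by linarith : 6 ≤ K')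
  have hAA : (2 * n * K / s) ^ n ≤ (2 * n * K' / s) ^ n := by gcongr; linarith
  set A : ℝ := (2 * n * K' / s) ^ n with hA
  set E : ℝ := Real.exp (s / 2)
  have hA0 : 0 < A := by positivity
  have hE0 : 0 < E := Real.exp_pos _
  have hP0 : 0 < P := lt_of_lt_of_le (by positivity) hP
  refine le_trans ?_ (nonresonant_product_bound hε hs hL hK hP0 hα)
  calc 11520 * K * (K * s / 4 + 2) ^ 2 * (ε * (1 + (2 * n * K / s) ^ n)) ≤
        11520 * K * (K * (s / 4 + 1)) ^ 2 * (ε * (1 + A)) := by gcongr; linarith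
    _ = 11520 * K ^ 3 * ε * ((s / 4 + 1) ^ 2 * (1 + A)) := by ring
    _ ≤ 11520 * K ^ 3 * ε * (13 / 9 * (A * E)) := by gcongr
    _ = 16640 * ((K ^ 3 * K) * ε * (A * E)) / K := by field_simp; norm_num
    -- The gap 3K ≤ K' gives 256 · 81 = 20736 against 16640.
    _ ≤ 256 * ((3 * K) ^ 4 * ε * (A * E)) / K := by
      gcongr ?_ / _
      have : 0 < K ^ 3 * K * ε * (A * E) := by positivity
      linarith
    _ ≤ 256 * (K' ^ 4 * ε * (A * E)) / K := by gcongr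
    _ = ε * (2 ^ 13 * (L / s) * A * E * K' ^ 4) * s / (32 * L * K) := by field_simp; norm_num
    _ ≤ _ := by gcongr

theorem resonant_deviation_le {ε s L K ν α N : ℝ} (hε : 0 < ε) (hs : 0 < s)
    (hL : 0 < L) (hK : 6 ≤ K) (hα : α ^ 2 = ε * K ^ (2 * ν)) (hN : 0 < N) (hNK : 3 * N ≤ K) :
    2016 * K * ((2 * n * K / s) ^ n) ^ 2 * ε / (α * K / N * (α / (L * N)) * (s * (1 - 1 / K))) ≤
      theta n s L K ν := by
  have hK0 : 0 < K := by linarith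
  have hP0 : 0 < K ^ (2 * ν) := Real.rpow_pos_of_pos hK0 _
  rw [theta, rpow_theta hK0]
  have h1 := resonant_product_bound hε hs hL hK hP0 hα hN hNK
  set P := K ^ (2 * ν)
  calc _ ≤ 2016 * K * ((2 * n * K / s) ^ n) ^ 2 * ε / (15 / 2 * (ε * P * s / (L * K))) := by gcongr
    _ = (2 * n * K / s) ^ (2 * n) * (L / (s * P)) * K ^ 2 * (1344 / 5) := by
      rw [← pow_mul, mul_comm n 2]; field_simp; ring
    _ ≤ (2 * n * K / s) ^ (2 * n) * (L / (s * P)) * K ^ 2 * (1024 * K) := by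
      gcongr; linarith
    _ = _ := by
      rw [div_pow, mul_pow, mul_pow, pow_add 2 (2 * n) 10, pow_succ s (2 * n),
        pow_add K (2 * n) 3]
      field_simp
      norm_num

/-- Since 2K ≤ K', the factor 2^{2n} present in `theta` disappears here, and 64512 K² ≤ 2^14 K'³
because K'³ ≥ 54 K². -/
theorem nonresonant_deviation_le (hn : 2 ≤ n) {ε s L K K' ν α : ℝ} (hε : 0 < ε) (hs : 0 < s)
    (hL : 0 < L) (hK : 2 ≤ K) (hKK : 3 * K ≤ K') (hα : α ^ 2 = ε * K' ^ (2 * ν)) :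
    2016 * K * ((2 * n * K / s) ^ n) ^ 2 * ε / (α / 4 * (α / (4 * L * K)) * (s * (1 - 1 / K))) ≤
      thetaBar n s L K' ν := by
  have hK0 : 0 < K := by linarith
  have hK'0 : 0 < K' := by linarith
  have hP0 : 0 < K' ^ (2 * ν) := Real.rpow_pos_of_pos hK'0 _
  rw [thetaBar, rpow_theta hK'0]
  have h1 := nonresonant_product_bound hε hs hL hK hP0 hα
  set P := K' ^ (2 * ν)
  have h2 : (2 * n * K / s) ^ (2 * n) ≤ (n * K' / s) ^ (2 * n) := by
    have : (0 : ℝ) ≤ n := Nat.cast_nonneg n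
    refine pow_le_pow_left₀ (by positivity) ?_ _
    gcongr ?_ / _
    nlinarith
  calc _ ≤ 2016 * K * ((2 * n * K / s) ^ n) ^ 2 * ε / (ε * P * s / (32 * L * K)) := by gcongr
    _ = (2 * n * K / s) ^ (2 * n) * (L / (s * P)) * (64512 * K ^ 2) := by
      rw [← pow_mul, mul_comm n 2]; field_simp; norm_num
    _ ≤ (n * K' / s) ^ (2 * n) * (L / (s * P)) * (2 ^ 14 * K' ^ 3) := by
      have h3 : 64512 * K ^ 2 ≤ 2 ^ 14 * K' ^ 3 := by
        have h4 : (3 * K) ^ 2 * 6 ≤ K' ^ 2 * K' := by gcongr; linarith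
        nlinarith [sq_nonneg K]
      gcongr
    _ = _ := by
      rw [div_pow, mul_pow, pow_succ s (2 * n), pow_add K' (2 * n) 3]
      field_simp

end Constants

end Averaging
end

noncomputable section

namespace Averaging

open Metric Set Filter Topology

/-! ### Projections on the resonant modes. -/

section Projections

variable {n : ℕ}

theorem evalFam_res_add (Λ : AddSubgroup (Fin n → ℤ)) {c : (Fin n → ℤ) → CVec n → ℂ}
    {U : Set (CVec n)} {σ C : ℝ} (hc : FamBound c U σ C) {z : CVec n × CVec n}
    (hz : z ∈ U ×ˢ strip n σ) :
    evalFam c z = evalFam (resPart Λ c) z + evalFam (sel (· ∉ Λ) c) z := by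
  rw [resPart, ← evalFam_add (hc.sel (P := (· ∈ Λ))) (hc.sel (P := (· ∉ Λ))) hz]
  congr 1
  ext k y
  by_cases hk : k ∈ Λ <;> simp [sel, hk]

theorem evalFam_resPart_bot (c : (Fin n → ℤ) → CVec n → ℂ) (y x : CVec n) :
    evalFam (resPart ⊥ c) (y, x) = c 0 y := by
  rw [evalFam, tsum_eq_single 0]
  · rw [resPart, sel_pos (zero_mem _), expK_zero, one_smul]
  · intro k hk
    rw [resPart, sel_neg (by simpa using hk), smul_zero]

theorem resPart_resPart (Λ : AddSubgroup (Fin n → ℤ)) (c : (Fin n → ℤ) → CVec n → ℂ) :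
    resPart Λ (resPart Λ c) = resPart Λ c := by
  ext k y
  by_cases hk : k ∈ Λ <;> simp [resPart, sel, hk]

theorem evalFam_resPart_sel_not (Λ : AddSubgroup (Fin n → ℤ)) (c : (Fin n → ℤ) → CVec n → ℂ)
    (z : CVec n × CVec n) : evalFam (resPart Λ (sel (· ∉ Λ) c)) z = 0 := by
  have h : ∀ k, resPart Λ (sel (· ∉ Λ) c) k z.1 = 0 := fun k => by
    by_cases hk : k ∈ Λ <;> simp [resPart, sel, hk]
  simp [evalFam, h]

theorem proj_evalFam {Λ : AddSubgroup (Fin n → ℤ)} {c : (Fin n → ℤ) → CVec n → ℂ}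
    {U : Set (CVec n)} {σ C : ℝ} (hσ : 0 < σ) (hc : FamBound c U σ C) {y : CVec n} (hy : y ∈ U)
    (x : CVec n) :
    proj Λ (fun y x => evalFam c (y, x)) y x = evalFam (resPart Λ c) (y, x) := by
  rw [proj_eq_evalFam]
  refine tsum_congr fun k => ?_
  by_cases hk : k ∈ Λ
  · rw [resPart, resPart, sel_pos hk, sel_pos hk, fourierC_evalFam hσ hc hy]
  · rw [resPart, resPart, sel_neg hk, sel_neg hk]

/-- Convergence of the resonant series of d is read off from c and the difference, so it needs no
separate estimate. -/
theorem resPart_fourierC_bound (Λ : AddSubgroup (Fin n → ℤ)) {c d : (Fin n → ℤ) → CVec n → ℂ}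
    {U : Set (CVec n)} {σ C C' : ℝ} (hc : FamBound c U σ C)
    (h : FamBound (resPart Λ fun k y => c k y - d k y) U σ C') :
    FamBound (resPart Λ d) U σ (C + |(-1 : ℝ)| * C') := by
  refine ((hc.sel (P := (· ∈ Λ))).add (h.const_smul (-1))).of_le fun k y _ => le_of_eq ?_
  by_cases hk : k ∈ Λ <;> simp [resPart, sel, hk]

theorem evalFam_resPart_sub {Λ : AddSubgroup (Fin n → ℤ)} {c d : (Fin n → ℤ) → CVec n → ℂ}
    {U : Set (CVec n)} {σ C C' : ℝ} (hc : FamBound (resPart Λ c) U σ C)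
    (hd : FamBound (resPart Λ d) U σ C') {z : CVec n × CVec n} (hz : z ∈ U ×ˢ strip n σ) :
    evalFam (resPart Λ fun k y => c k y - d k y) z =
      evalFam (resPart Λ c) z - evalFam (resPart Λ d) z := by
  rw [evalFam, evalFam, evalFam,
    ← (hc.summable_eval hz.1 hz.2).tsum_sub (hd.summable_eval hz.1 hz.2)]
  refine tsum_congr fun k => ?_
  by_cases hk : k ∈ Λ <;> simp [resPart, sel, hk, mul_sub]

end Projections

end Averaging
end

/-! ### The averaging theorem. -/

theorem theorem5p1
    {n : ℕ} (D : Set (Averaging.RVec n)) (r s L Lbar ε K₁ K₂ ν : ℝ)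
    (h : Averaging.CVec n → ℂ) (f : Averaging.CVec n → Averaging.CVec n → ℂ)
    (hr : 0 < r) (hs : 0 < s) (hε : 0 < ε)
    (hA : Averaging.AssumptionA D r h L Lbar)
    (hf : Averaging.HolomorphicOnTorus f (Averaging.nbhd D r) s)
    (hf1 : Averaging.supNorm D r s f = 1)
    (hK₁ : 6 ≤ 3 * K₁) (hK₂ : 3 * K₁ ≤ K₂) (hν : (n : ℝ) + 2 ≤ ν)
    (hsmall : ε ≤ (L * r) ^ 2 / K₂ ^ (2 * ν))
    (hK : 2 ^ (13 + n) * (n : ℝ) ^ n * (L * Real.exp (s / 2) / s ^ (n + 1)) ≤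
      K₂ ^ (2 * ν - (n : ℝ) - 4)) :
    -- the non-resonant region
    (∃ (Ψ : Averaging.CVec n × Averaging.CVec n → Averaging.CVec n × Averaging.CVec n)
        (g : Averaging.CVec n → ℂ) (fss : Averaging.CVec n → Averaging.CVec n → ℂ),
      let Dz := Averaging.D0 D h (Averaging.alpha ε K₂ ν) K₁
      let rz := Averaging.rad0 ε K₁ K₂ ν L
      let U := Averaging.nbhd Dz (rz / 2)
      let s' := s * (1 - 1 / K₁) ^ 2
      Averaging.SymplecticChange Ψ U s' (Averaging.nbhd Dz rz) (s * (1 - 1 / K₁)) ∧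
      (Averaging.RealOn f D → Averaging.PreservesReal Ψ U) ∧
      DifferentiableOn ℂ g U ∧
      Averaging.HolomorphicOnTorus fss U s' ∧
      (∀ y ∈ U, ∀ x ∈ Averaging.strip n s',
        Averaging.Ham h ε f (Ψ (y, x)) = h y + (ε : ℂ) * g y + (ε : ℂ) * fss y x) ∧
      (∀ y ∈ U, Averaging.mean fss y = 0) ∧
      (∀ y ∈ U, ‖g y - Averaging.mean f y‖ ≤ Averaging.thetaBar n s L K₂ ν) ∧
      Averaging.sumNorm Dz (rz / 2) (s * (1 - 1 / K₁) / 2) fss ≤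
        ENNReal.ofReal (Averaging.remainderBound n s K₁)) ∧
    -- the simply resonant regions
    (Averaging.D1 D h (Averaging.alpha ε K₂ ν) K₁ K₂ =
      ⋃ k ∈ Averaging.generators n K₁, Averaging.D1k D h (Averaging.alpha ε K₂ ν) K₂ k) ∧
    ∀ k ∈ Averaging.generators n K₁,
      ∃ (Ψ : Averaging.CVec n × Averaging.CVec n → Averaging.CVec n × Averaging.CVec n)
        (g fss : Averaging.CVec n → Averaging.CVec n → ℂ),
      let Dk := Averaging.D1k D h (Averaging.alpha ε K₂ ν) K₂ k
      let rk := Averaging.radk ε K₂ ν L k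
      let U := Averaging.nbhd Dk (rk / 2)
      let s' := s * (1 - 1 / K₂) ^ 2
      let Λ := AddSubgroup.zmultiples k
      Averaging.SymplecticChange Ψ U s' (Averaging.nbhd Dk rk) (s * (1 - 1 / K₂)) ∧
      (Averaging.RealOn f D → Averaging.PreservesReal Ψ U) ∧
      Averaging.HolomorphicOnTorus g U s' ∧
      Averaging.HolomorphicOnTorus fss U s' ∧
      (∀ y ∈ U, ∀ x ∈ Averaging.strip n s',
        Averaging.Ham h ε f (Ψ (y, x)) = h y + (ε : ℂ) * g y x + (ε : ℂ) * fss y x) ∧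
      (∀ y ∈ U, ∀ x ∈ Averaging.strip n s', g y x = Averaging.proj Λ g y x) ∧
      (∀ y ∈ U, ∀ x ∈ Averaging.strip n s', Averaging.proj Λ fss y x = 0) ∧
      Averaging.sumNorm Dk (rk / 2) s' (fun y x => g y x - Averaging.proj Λ f y x) ≤
        ENNReal.ofReal (Averaging.theta n s L K₂ ν) ∧
      Averaging.sumNorm Dk (rk / 2) (s * (1 - 1 / K₂) / 2) fss <
        ENNReal.ofReal (Averaging.remainderBound n s K₂) := by
  have hK₁' : 2 ≤ K₁ := by linarith
  have hK₂0 : 0 < K₂ := by linarith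
  have hK₁0 : 0 < K₁ := by linarith
  have hL := hA.L_pos
  have hn := hA.two_le
  have hα := Averaging.alpha_pos (ν := ν) hε hK₂0
  have hαsq := Averaging.alpha_sq (ν := ν) hε hK₂0
  have hαr := Averaging.alpha_le hε hK₂0 hL hr hsmall
  have hP := Averaging.rpow_lower_bound hs hK₂0 hK
  set α := Averaging.alpha ε K₂ ν with hαdef
  have hU : ∀ (D' : Set (Averaging.RVec n)) (ρ : ℝ), IsOpen (Averaging.nbhd D' ρ) :=
    Averaging.isOpen_nbhd
  have hσ : ∀ K : ℝ, 2 ≤ K → 0 < s * (1 - 1 / K) ∧ 0 < s * (1 - 1 / K) ^ 2 := fun K hK => by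
    have : 1 / K ≤ 1 / 2 := by gcongr
    have h1 : 0 < 1 - 1 / K := by linarith
    exact ⟨by positivity, by positivity⟩
  refine ⟨?_, ?_, fun k hk => ?_⟩
  · have hρ : 0 < α / (4 * L * K₁) := by positivity
    have hρr : α / (4 * L * K₁) ≤ r := by
      rw [div_le_iff₀ (by positivity)]
      nlinarith [mul_pos hL hr]
    obtain ⟨Ψ, c, hΨ, hΨr, hc, ⟨C, hC⟩, hH, hdev, C', hC', hrem⟩ :=
      Averaging.hamiltonian_normal_form (Λ := ⊥) hA hf hf1 (D' := Averaging.D0 D h α K₁)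
        (fun _ h => h.1) hρ hρr hs hK₁' (by positivity : 0 < α / 4) hε rfl
        (Averaging.smallDivisor_D0 hA hα hK₁0 hρr)
        (Averaging.nonresonant_smallness hn hε hs hL hK₁' hK₂ hP hαsq)
    have hCn : Averaging.FamBound (Averaging.sel (· ∉ (⊥ : AddSubgroup (Fin n → ℤ))) c) _ _ C :=
      hC.sel
    have hσ' := (hσ K₁ hK₁').2
    -- For Λ = 0 the resonant part is the zero mode alone, hence a function of y; all other modes
    -- form the remainder.
    refine ⟨Ψ, c 0, fun y x => Averaging.evalFam (Averaging.sel (· ∉ (⊥ : AddSubgroup _)) c) (y, x),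
      hΨ, hΨr, hc 0, Averaging.holomorphicOnTorus_evalFam (hU _ _) hCn hc.sel,
      fun y hy x hx => ?_, fun y hy => ?_, fun y hy => ?_, ?_⟩
    · rw [hH y hy x hx, Averaging.evalFam_res_add (⊥ : AddSubgroup _) hC (Set.mk_mem_prod hy hx),
        Averaging.evalFam_resPart_bot]
      ring
    · rw [Averaging.mean, Averaging.fourierC_evalFam hσ' hCn hy, Averaging.sel_neg (by simp)]
    · have h1 := hdev.single hy 0
      rw [Averaging.resPart, Averaging.sel_pos (zero_mem _), Averaging.norm1_zero, zero_mul,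
        Real.exp_zero, mul_one] at h1
      exact h1.trans (Averaging.nonresonant_deviation_le hn hε hs hL hK₁' hK₂ hαsq)
    · refine (Averaging.sumNorm_le hrem fun y hy k => Averaging.fourierC_evalFam hσ' hCn hy k).trans
        (ENNReal.ofReal_le_ofReal hC'.le)
  · ext y
    simp only [Averaging.D1, Averaging.D1k, Averaging.Omega1, Set.mem_iUnion, Set.mem_sep_iff,
      exists_prop]
    tauto
  · obtain ⟨⟨j, hj, -⟩, -, hkK⟩ := id hk
    have hk0 : k ≠ 0 := by rintro rfl; simp at hj
    have hN1 := Averaging.one_le_norm_intVec hk0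
    have hN : 0 < ‖Averaging.intVec k‖ := by linarith
    have hNK : 3 * ‖Averaging.intVec k‖ ≤ K₂ := by
      have := (Averaging.norm_intVec_le k).trans hkK
      linarith
    have hK₂6 : 6 ≤ K₂ := by linarith
    have hρ : 0 < α / (L * ‖Averaging.intVec k‖) := by positivity
    have hρr : α / (L * ‖Averaging.intVec k‖) ≤ r := by
      rw [div_le_iff₀ (by positivity)]
      nlinarith [mul_pos hL hr]
    obtain ⟨Ψ, c, hΨ, hΨr, hc, ⟨C, hC⟩, hH, hdev, C', hC', hrem⟩ :=
      Averaging.hamiltonian_normal_form (Λ := AddSubgroup.zmultiples k) hA hf hf1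
        (D' := Averaging.D1k D h α K₂ k)
        (fun _ h => h.1) hρ hρr hs (by linarith) (by positivity : 0 < α * K₂ / ‖Averaging.intVec k‖)
        hε rfl (Averaging.smallDivisor_D1k hA hα hK₂0 hN hρr)
        (Averaging.resonant_smallness hn hε hs hL hK₂6 hP hαsq hN hNK)
    set Λ := AddSubgroup.zmultiples k with hΛ
    have hCr : Averaging.FamBound (Averaging.resPart Λ c) _ _ C := hC.sel
    have hCn : Averaging.FamBound (Averaging.sel (· ∉ Λ) c) _ _ C := hC.sel
    have hσ' := (hσ K₂ (by linarith)).2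
    refine ⟨Ψ, fun y x => Averaging.evalFam (Averaging.resPart Λ c) (y, x),
      fun y x => Averaging.evalFam (Averaging.sel (· ∉ Λ) c) (y, x),
      hΨ, hΨr, Averaging.holomorphicOnTorus_evalFam (hU _ _) hCr hc.sel,
      Averaging.holomorphicOnTorus_evalFam (hU _ _) hCn hc.sel,
      fun y hy x hx => ?_, fun y hy x hx => ?_, fun y hy x hx => ?_, ?_, ?_⟩
    · rw [hH y hy x hx, Averaging.evalFam_res_add Λ hC (Set.mk_mem_prod hy hx)]
      ring
    · rw [Averaging.proj_evalFam hσ' hCr hy, Averaging.resPart_resPart]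
    · rw [Averaging.proj_evalFam hσ' hCn hy, Averaging.evalFam_resPart_sel_not]
    · have hfb := Averaging.resPart_fourierC_bound Λ hC hdev
      refine (Averaging.sumNorm_le hdev fun y hy l => ?_).trans (ENNReal.ofReal_le_ofReal
        (Averaging.resonant_deviation_le hε hs hL hK₂6 hαsq hN hNK))
      rw [← Averaging.fourierC_evalFam hσ' hdev hy l]
      -- Fourier coefficients see only real angles, which lie in every strip, so the two series need
      -- to be subtracted only there.
      refine Averaging.fourierC_congr (fun θ => ?_) l
      rw [Averaging.proj_eq_evalFam]
      exact (Averaging.evalFam_resPart_sub hCr hfb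
        (Set.mk_mem_prod hy (Averaging.angle_mem_strip hσ' θ))).symm
    · refine (Averaging.sumNorm_le hrem fun y hy l => Averaging.fourierC_evalFam hσ' hCn hy l).trans_lt
        ((ENNReal.ofReal_lt_ofReal_iff ?_).2 hC')
      rw [Averaging.remainderBound]
      have : (0 : ℝ) < n := by exact_mod_cast (by omega : 0 < n)
      positivity
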